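/- Consider the surface quasi-geostrophic equation on $(0,\infty)\times\mathbb R^2$, $$\partial_t\theta+u\cdot\nabla\theta-\Delta\theta=0,\qquad u=\nabla^\perp\Lambda^{-1}\theta,\qquad \theta(0,\cdot)=\theta_0,$$ where $\nabla^\perp=(-\partial_{x_2},\partial_{x_1})$ and $\Lambda=(-\Delta)^{1/2}$. Let $L^2=L^2(\mathbb R^2;\mathbb R)$. A function $\theta\in C([0,\infty);L^2)$ is called a global mild solution with initial datum $\theta_0\in L^2$ if $$\theta(t)=e^{t\Delta}\theta_0-\int_0^t\nabla\cdot e^{(t-s)\Delta}\bigl(u(s)\theta(s)\bigr)\,ds\qquad\text{in } L^2\text{ for all } t\ge 0,$$ where the time integral is understood in the sense of tempered distributions: for every Schwartz function $\varphi$, the function $s\mapsto\langle\nabla\cdot e^{(t-s)\Delta}(u(s)\theta(s)),\varphi\rangle$ is integrable on $(0,t)$, and its integral is $\langle e^{t\Delta}\theta_0-\theta(t),\varphi\rangle$. Then for every $\theta_0\in L^2$ there is a unique global mild solution $\theta\in C([0,\infty);L^2)$ with initial datum $\theta_0$. -/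

import Mathlib

open MeasureTheory Set
open scoped ENNReal FourierTransform SchwartzMap

noncomputable section

namespace SQG

/-- The plane `ℝ²` with its Euclidean norm. -/
abbrev Plane : Type := EuclideanSpace ℝ (Fin 2)

/-- The real Hilbert space `L²(ℝ²; ℝ)`. -/
abbrev L2 : Type := Lp ℝ 2 (volume : Measure Plane)

/-- The complex Hilbert space `L²(ℝ²; ℂ)`, on which the Plancherel-Fourier transform acts. -/
abbrev L2C : Type := Lp ℂ 2 (volume : Measure Plane)

/-- The inclusion of `L²(ℝ²; ℝ)` into `L²(ℝ²; ℂ)`. -/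
def toComplex (f : L2) : L2C := Complex.ofRealCLM.compLp f

/-- The Fourier symbol `i ξ_j / |ξ|` of the operator `∂_j Λ⁻¹`, where `Λ = (-Δ)^{1/2}`. The
value at the single frequency `ξ = 0` is irrelevant. -/
def derivLambdaInvSymbol (j : Fin 2) (ξ : Plane) : ℂ :=
  Complex.I * ((ξ j / ‖ξ‖ : ℝ) : ℂ)

/-- The symbol of `∂_j Λ⁻¹` is bounded and measurable, so it defines a multiplier on `L²`. -/
theorem memLp_derivLambdaInvSymbol (j : Fin 2) :
    MemLp (derivLambdaInvSymbol j) ∞ (volume : Measure Plane) := by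
  refine memLp_top_of_bound (C := 1) ?_ (Filter.Eventually.of_forall fun ξ => ?_)
  · have h : Measurable (derivLambdaInvSymbol j) := by
      unfold derivLambdaInvSymbol
      fun_prop
    exact h.aestronglyMeasurable
  · simp only [derivLambdaInvSymbol, norm_mul, Complex.norm_I, one_mul, Complex.norm_real,
      norm_div, norm_norm]
    exact div_le_one_of_le₀ (PiLp.norm_apply_le ξ j) (norm_nonneg ξ)

/-- The Fourier multiplier operator `f ↦ 𝓕⁻¹ (m · 𝓕 f)` on `L²(ℝ²; ℂ)` with bounded symbol `m`. -/
def fourierMultiplier (m : Lp ℂ ∞ (volume : Measure Plane)) (f : L2C) : L2C :=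
  𝓕⁻ (m • 𝓕 f : L2C)

/-- The operator `∂_j Λ⁻¹` on `L²(ℝ²; ℝ)`. The multiplier operator maps real functions to real
functions, so that taking the real part only changes the codomain. -/
def derivLambdaInv (j : Fin 2) (θ : L2) : Plane → ℝ := fun x =>
  (fourierMultiplier ((memLp_derivLambdaInvSymbol j).toLp _) (toComplex θ) x).re

/-- The velocity `u = ∇^⊥ Λ⁻¹ θ = (-∂₂ Λ⁻¹ θ, ∂₁ Λ⁻¹ θ)`. -/
def velocity (θ : L2) : Plane → Plane := fun x =>
  !₂[-derivLambdaInv 1 θ x, derivLambdaInv 0 θ x]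

/-- The flux `u θ` with `u = ∇^⊥ Λ⁻¹ θ`; it is an integrable vector field on the plane. -/
def flux (θ : L2) : Plane → Plane := fun x => θ x • velocity θ x

/-- The heat kernel `(4 π t)⁻¹ exp (-|x|² / (4 t))` of the plane, for `t > 0`. -/
def heatKernel (t : ℝ) (x : Plane) : ℝ :=
  (4 * Real.pi * t)⁻¹ * Real.exp (-‖x‖ ^ 2 / (4 * t))

/-- The heat semigroup `e^{tΔ}`, `t ≥ 0`, on scalar functions or (componentwise) vector fields:
convolution with the heat kernel for `t > 0` and the identity for `t = 0`. -/
def heatSemigroup {E : Type*} [NormedAddCommGroup E] [NormedSpace ℝ E] (t : ℝ) (f : Plane → E) :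
    Plane → E :=
  if 0 < t then fun x => ∫ y, heatKernel t (x - y) • f y else f

/-- The divergence `∂₁ F₁ + ∂₂ F₂` of a vector field on the plane. -/
def divergence (F : Plane → Plane) (x : Plane) : ℝ :=
  ∑ j : Fin 2, (fderiv ℝ F x (EuclideanSpace.single j 1)) j

/-- `h = ∫_a^b g(s) ds` as an integral of tempered distributions: after pairing with an arbitrary
Schwartz function, the integral in `s` converges absolutely and has the value `⟨h, φ⟩`. -/
def HasDistributionalIntegral (g : ℝ → Plane → ℝ) (a b : ℝ) (h : Plane → ℝ) : Prop :=
  ∀ φ : 𝓢(Plane, ℝ),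
    IntervalIntegrable (fun s => ∫ x, g s x * φ x) volume a b ∧
      ∫ s in a..b, (∫ x, g s x * φ x) = ∫ x, h x * φ x

/-- `θ` is a mild solution on `[0, T]` with initial datum `θ₀`: `θ ∈ C([0, T]; L²)` and
`θ(t) = e^{tΔ} θ₀ - ∫_0^t ∇ · e^{(t - s)Δ} (u(s) θ(s)) ds` for every `t ∈ [0, T]`. -/
def IsMildSolution (T : ℝ) (θ₀ : L2) (θ : ℝ → L2) : Prop :=
  ContinuousOn θ (Icc 0 T) ∧
    ∀ t ∈ Icc (0 : ℝ) T,
      HasDistributionalIntegral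
        (fun s => divergence (heatSemigroup (t - s) (flux (θ s)))) 0 t
        (fun x => heatSemigroup t (θ₀ : Plane → ℝ) x - θ t x)

/-- `θ` is a global mild solution: `θ ∈ C([0, ∞); L²)`, and `θ` is a mild solution on `[0, T]`
for every `T > 0`. -/
def IsGlobalMildSolution (θ₀ : L2) (θ : ℝ → L2) : Prop :=
  ContinuousOn θ (Ici 0) ∧ ∀ T : ℝ, 0 < T → IsMildSolution T θ₀ θ

end SQG

end

/-!
Global well-posedness of the surface quasi-geostrophic equation with dissipation `-Δ` in `L²(ℝ²)`.

The whole argument takes place on the Fourier side. With `g(t) = 𝓕 θ(t)`, a mild solution is a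
continuous curve in `L²` such that at almost every frequency `ξ` the function `t ↦ g(t, ξ)` solves
the scalar equation `y' = -4π²|ξ|² y + bilin g g ξ` in Duhamel's form (`IsFourierMild`,
`isMildSolution_iff`). Here `bilin` is the nonlinearity `-∇ · (u θ)`, symmetrised: its kernel is
`π (ξ · η^⊥) (1/|η| - 1/|ξ - η|)`. Two facts about this kernel carry the proof.

* The difference of inverses gains a factor `|ξ| / max (|η|, |ξ - η|)` over the trivial bound
  (`abs_kernel_mul_max_le`). Hence `bilin` is bounded from `L² × Ḣ^{-1/2}` to `Ḣ^{-3/2}`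
  (`absBilin_negative_order_le`). The linear equation for the difference `w` of two solutions has
  their sum as coefficient. Its part at high frequency is small in `L²`, uniformly on a compact time
  interval, and its part at low frequency gains a derivative, so that an exponential weight in time
  makes its contribution small. Therefore the norm of `w` in a weighted `L²(0, T; Ḣ^{-1/2})` is at
  most a fraction of itself, and `w` vanishes. This is uniqueness in the class `C([0, T]; L²)`,
  without further conditions (`IsFourierMild.unique`).
* The trilinear form `∫ conj g · bilin g g` vanishes when `g` is the transform of a real function
  (`integral_conj_mul_bilin_self`), which yields the energy identity (`IsFourierMild.energy`).

The product estimate `Ḣ^{1/2} × Ḣ^{1/2} → L²` makes the equation accessible to Picard iteration in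
`L⁴(0, T; Ḣ^{1/2})`, a critical space. A solution exists on `[0, T]` once the linear evolution is
small in that space (`exists_isFourierMild_of_critNorm_le`), in particular for small `T`, or for
`T` up to a multiple of `‖g₀‖_{Ḣ^{1/2}}^{-4}`. The energy identity and interpolation bound the norm in
`L⁴(0, T; Ḣ^{1/2})` independently of `T`. If the solution could be continued beyond `T` by `δ` from
no time `t ≤ T`, then `‖g(t)‖_{Ḣ^{1/2}}^4` would be at least `c / (T + δ - t)` throughout, and the
logarithmic divergence of the integral as `δ → 0` contradicts the bound. Thus solutions can be
extended by a uniform time step, and they are global (`exists_uniform_extension`,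
`exists_global_isFourierMild`).

The equivalence of the two notions of solution rests on the convolution theorem for products of
`L²` functions (`fourier_mul_eq`), on the heat kernel as a Gaussian Fourier transform, and on
Fubini's theorem in time and frequency after pairing with a Schwartz function.
-/

noncomputable section

namespace SQG

/-! ### The symbol of the nonlinearity -/

/-- The symplectic form `ξ · η^⊥` of the frequency plane, where `η^⊥ = (-η₂, η₁)`. -/
def cross (ξ η : Plane) : ℝ := ξ 1 * η 0 - ξ 0 * η 1

/-- The symmetrised symbol `π (ξ · η^⊥) (1 / |η| - 1 / |ξ - η|)` of the nonlinearity. -/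
def kernel (ξ η : Plane) : ℝ := Real.pi * cross ξ η * (‖η‖⁻¹ - ‖ξ - η‖⁻¹)

theorem abs_cross_le (ξ η : Plane) : |cross ξ η| ≤ ‖ξ‖ * ‖η‖ := by
  apply abs_le_of_sq_le_sq _ (by positivity)
  rw [mul_pow, EuclideanSpace.norm_sq_eq, EuclideanSpace.norm_sq_eq]
  simp only [Fin.sum_univ_two, Real.norm_eq_abs, sq_abs, cross]
  nlinarith [sq_nonneg (ξ 0 * η 0 + ξ 1 * η 1)]

theorem cross_sub_right (ξ η : Plane) : cross ξ (ξ - η) = -cross ξ η := by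
  simp only [cross, PiLp.sub_apply]; ring

theorem kernel_sub (ξ η : Plane) : kernel ξ (ξ - η) = kernel ξ η := by
  simp only [kernel, cross_sub_right, sub_sub_cancel]; ring

theorem kernel_neg_neg (ξ η : Plane) : kernel (-ξ) (-η) = kernel ξ η := by
  have : -ξ - -η = -(ξ - η) := by abel
  simp only [kernel, this, norm_neg, cross, PiLp.neg_apply]; ring

theorem measurable_cross : Measurable (Function.uncurry cross) := by
  unfold cross Function.uncurry
  fun_prop

theorem measurable_kernel : Measurable (Function.uncurry kernel) := by
  have h := measurable_cross
  have h' : Measurable fun p : Plane × Plane => cross p.1 p.2 := h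
  unfold kernel Function.uncurry
  fun_prop

/-- The cancellation in the symmetrised symbol: the kernel gains a factor
`|ξ| / max (|η|, |ξ - η|)` over the size `|ξ|` of the symbol of a divergence. -/
theorem abs_kernel_mul_max_le (ξ η : Plane) :
    |kernel ξ η| * max ‖η‖ ‖ξ - η‖ ≤ Real.pi * ‖ξ‖ ^ 2 := by
  rcases eq_or_ne η 0 with rfl | hη
  · simp only [kernel, cross, PiLp.zero_apply]; simp; positivity
  rcases eq_or_ne (ξ - η) 0 with hζ | hζ
  · have : ξ = η := sub_eq_zero.mp hζ
    subst this
    simp only [kernel, cross]; simp [mul_comm]; positivity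
  have h1 := norm_pos_iff.mpr hη
  have h2 := norm_pos_iff.mpr hζ
  have hdiff : ‖η‖⁻¹ - ‖ξ - η‖⁻¹ = (‖ξ - η‖ - ‖η‖) / (‖η‖ * ‖ξ - η‖) := by field_simp
  have htri : |‖ξ - η‖ - ‖η‖| ≤ ‖ξ‖ := by
    have := abs_norm_sub_norm_le (ξ - η) (-η)
    simpa using this
  have hc1 : |cross ξ η| ≤ ‖ξ‖ * ‖η‖ := abs_cross_le ξ η
  have hc2 : |cross ξ η| ≤ ‖ξ‖ * ‖ξ - η‖ := by
    have := abs_cross_le ξ (ξ - η)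
    rwa [cross_sub_right, abs_neg] at this
  have hc : |cross ξ η| * max ‖η‖ ‖ξ - η‖ ≤ ‖ξ‖ * (‖η‖ * ‖ξ - η‖) := by
    rcases le_total ‖η‖ ‖ξ - η‖ with h | h
    · rw [max_eq_right h]; nlinarith
    · rw [max_eq_left h]; nlinarith
  rw [kernel, hdiff, abs_mul, abs_mul, abs_div, abs_of_pos Real.pi_pos,
    abs_of_pos (mul_pos h1 h2)]
  calc Real.pi * |cross ξ η| * (|‖ξ - η‖ - ‖η‖| / (‖η‖ * ‖ξ - η‖)) * max ‖η‖ ‖ξ - η‖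
      = Real.pi * (|cross ξ η| * max ‖η‖ ‖ξ - η‖) * |‖ξ - η‖ - ‖η‖| / (‖η‖ * ‖ξ - η‖) := by ring
    _ ≤ Real.pi * (‖ξ‖ * (‖η‖ * ‖ξ - η‖)) * ‖ξ‖ / (‖η‖ * ‖ξ - η‖) := by gcongr
    _ = Real.pi * ‖ξ‖ ^ 2 := by field_simp

theorem abs_kernel_le (ξ η : Plane) : |kernel ξ η| ≤ Real.pi * ‖ξ‖ := by
  have hc1 : |cross ξ η| * ‖η‖⁻¹ ≤ ‖ξ‖ := by
    rcases eq_or_ne η 0 with rfl | hη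
    · simp
    rw [mul_inv_le_iff₀ (norm_pos_iff.mpr hη)]
    exact abs_cross_le ξ η
  have hc2 : |cross ξ η| * ‖ξ - η‖⁻¹ ≤ ‖ξ‖ := by
    rcases eq_or_ne (ξ - η) 0 with h | hη
    · simp [h]
    rw [mul_inv_le_iff₀ (norm_pos_iff.mpr hη)]
    have := abs_cross_le ξ (ξ - η)
    rwa [cross_sub_right, abs_neg] at this
  rw [kernel, mul_assoc, abs_mul, abs_of_pos Real.pi_pos, abs_mul]
  gcongr
  refine le_trans ?_ (max_le hc1 hc2)
  rw [← mul_max_of_nonneg _ _ (abs_nonneg _)]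
  gcongr
  have i1 : 0 ≤ ‖η‖⁻¹ := by positivity
  have i2 : 0 ≤ ‖ξ - η‖⁻¹ := by positivity
  rw [abs_le]
  constructor
  · linarith [le_max_right ‖η‖⁻¹ ‖ξ - η‖⁻¹]
  · linarith [le_max_left ‖η‖⁻¹ ‖ξ - η‖⁻¹]

/-- The comparison `max (|ξ|, |ζ|) ≤ 2 max (|η|, |ζ|)` for `ξ = η + ζ`. -/
theorem max_norm_le_two_mul_max (ξ ζ : Plane) : max ‖ξ‖ ‖ζ‖ ≤ 2 * max ‖ξ - ζ‖ ‖ζ‖ := by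
  have h : ‖ξ‖ ≤ ‖ξ - ζ‖ + ‖ζ‖ := by simpa using norm_add_le (ξ - ζ) ζ
  have := norm_nonneg ζ
  apply max_le <;> linarith [le_max_left ‖ξ - ζ‖ ‖ζ‖, le_max_right ‖ξ - ζ‖ ‖ζ‖]

/-! ### Radial integrals -/

/-- Integration in polar coordinates of a radial function of the plane. -/
theorem lintegral_ofReal_comp_norm {f : ℝ → ℝ} (hf : ∀ r, 0 < r → 0 ≤ f r)
    (hi : IntegrableOn (fun r => r * f r) (Ioi 0)) :
    ∫⁻ x : Plane, ENNReal.ofReal (f ‖x‖) =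
      ENNReal.ofReal (2 * Real.pi * ∫ r in Ioi (0 : ℝ), r * f r) := by
  have hdim : Module.finrank ℝ Plane = 2 := by simp
  have hint : Integrable (fun x : Plane => f ‖x‖) := by
    rw [integrable_fun_norm_addHaar (volume : Measure Plane), hdim]
    simpa using hi
  rw [← ofReal_integral_eq_lintegral_ofReal hint, integral_fun_norm_addHaar, hdim]
  · have : (volume : Measure Plane).real (Metric.ball 0 1) = Real.pi := by
      simp [Measure.real, Real.pi_pos.le]
    rw [this]
    simp [mul_assoc]
  · have h0 : ∀ᵐ x : Plane, x ≠ 0 := by simp [ae_iff]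
    filter_upwards [h0] with x hx using hf _ (norm_pos_iff.mpr hx)

theorem lintegral_inv_norm_closedBall_le {R : ℝ} (hR : 0 ≤ R) :
    ∫⁻ x : Plane, ENNReal.ofReal (if ‖x‖ ≤ R then ‖x‖⁻¹ else 0) ≤
      ENNReal.ofReal (2 * Real.pi * R) := by
  have hcongr : EqOn (fun r : ℝ => r * (if r ≤ R then r⁻¹ else 0))
      ((Ioc 0 R).indicator fun _ => (1 : ℝ)) (Ioi 0) := by
    intro r hr
    have hr' : (0 : ℝ) < r := hr
    by_cases h : r ≤ R
    · simp [h, hr', hr'.ne']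
    · simp [h]
  have hi : IntegrableOn ((Ioc 0 R).indicator fun _ => (1 : ℝ)) (Ioi 0) := by
    apply Integrable.integrableOn
    rw [integrable_indicator_iff measurableSet_Ioc]
    simp [IntegrableOn]
  rw [lintegral_ofReal_comp_norm (f := fun r => if r ≤ R then r⁻¹ else 0)]
  · rw [setIntegral_congr_fun measurableSet_Ioi hcongr, setIntegral_indicator measurableSet_Ioc]
    apply ENNReal.ofReal_le_ofReal
    have : Ioi (0 : ℝ) ∩ Ioc 0 R = Ioc 0 R := by
      ext; simp +contextual
    rw [this]; simp [hR]
  · intro r hr; split_ifs <;> positivity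
  · exact hi.congr_fun hcongr.symm measurableSet_Ioi

theorem lintegral_inv_norm_div_max_sq_le {R : ℝ} (hR : 0 < R) :
    ∫⁻ x : Plane, ENNReal.ofReal (‖x‖⁻¹ / max ‖x‖ R ^ 2) ≤
      ENNReal.ofReal (4 * Real.pi * R⁻¹) := by
  have hcongr : EqOn (fun r : ℝ => r * (r⁻¹ / max r R ^ 2)) (fun r => (max r R ^ 2)⁻¹)
      (Ioi 0) := by
    intro r hr
    have hr' : (r : ℝ) ≠ 0 := ne_of_gt hr
    simp only; field_simp
  have e1 : EqOn (fun r : ℝ => (max r R ^ 2)⁻¹) (fun _ => (R ^ 2)⁻¹) (Ioc 0 R) := by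
    intro r hr; simp [max_eq_right hr.2]
  have e2 : EqOn (fun r : ℝ => (max r R ^ 2)⁻¹) (fun r => r ^ (-2 : ℝ)) (Ioi R) := by
    intro r hr
    have hr0 : 0 < r := hR.trans hr
    have hr1 : R ≤ r := le_of_lt (mem_Ioi.mp hr)
    simp only [max_eq_left hr1]
    rw [Real.rpow_neg hr0.le]; norm_num
  have i1 : IntegrableOn (fun r : ℝ => (max r R ^ 2)⁻¹) (Ioc 0 R) :=
    (integrableOn_const (by simp)).congr_fun e1.symm measurableSet_Ioc
  have i2 : IntegrableOn (fun r : ℝ => (max r R ^ 2)⁻¹) (Ioi R) :=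
    (integrableOn_Ioi_rpow_of_lt (by norm_num) hR).congr_fun e2.symm measurableSet_Ioi
  have hu : Ioc 0 R ∪ Ioi R = Ioi 0 := Ioc_union_Ioi_eq_Ioi hR.le
  rw [lintegral_ofReal_comp_norm (f := fun r => r⁻¹ / max r R ^ 2)]
  · rw [setIntegral_congr_fun measurableSet_Ioi hcongr, ← hu,
      setIntegral_union (by simp) measurableSet_Ioi i1 i2,
      setIntegral_congr_fun measurableSet_Ioc e1, setIntegral_congr_fun measurableSet_Ioi e2,
      integral_Ioi_rpow_of_lt (by norm_num) hR]
    apply ENNReal.ofReal_le_ofReal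
    have : R ^ ((-2 : ℝ) + 1) = R⁻¹ := by
      rw [show ((-2 : ℝ) + 1) = -1 by norm_num, Real.rpow_neg_one]
    rw [this]
    simp [hR.le]
    apply le_of_eq
    field_simp
    norm_num
  · intro r hr; positivity
  · rw [← hu]
    exact ((i1.union i2).congr_fun (by rw [hu]; exact hcongr.symm)
      (by rw [hu]; exact measurableSet_Ioi))

/-! ### Schur-type bounds -/

theorem sq_lintegral_mul_le {α : Type*} [MeasurableSpace α] {μ : Measure α} {f g : α → ℝ≥0∞}
    (hf : AEMeasurable f μ) (hg : AEMeasurable g μ) :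
    (∫⁻ x, f x * g x ∂μ) ^ 2 ≤ (∫⁻ x, f x ^ 2 ∂μ) * ∫⁻ x, g x ^ 2 ∂μ := by
  have h := ENNReal.lintegral_mul_le_Lp_mul_Lq μ (Real.HolderConjugate.two_two) hf hg
  calc (∫⁻ x, f x * g x ∂μ) ^ 2
      ≤ ((∫⁻ x, f x ^ (2 : ℝ) ∂μ) ^ (1 / 2 : ℝ) * (∫⁻ x, g x ^ (2 : ℝ) ∂μ) ^ (1 / 2 : ℝ)) ^ 2 := by
        gcongr; exact h
    _ = _ := by
        rw [mul_pow, ← ENNReal.rpow_natCast, ← ENNReal.rpow_natCast, ← ENNReal.rpow_mul,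
          ← ENNReal.rpow_mul]
        norm_num

/-- A Schur-type bound for bilinear operators: by the Cauchy-Schwarz inequality in `η`, a weighted
`L²` bound for `∫ m (ξ, η) W (ξ - η) P (η) dη` reduces to a bound for an integral of `m²` at
fixed `ζ = ξ - η`. -/
theorem lintegral_sq_bilinear_le {u v W P : Plane → ℝ≥0∞} {m : Plane → Plane → ℝ≥0∞}
    {C : ℝ≥0∞} (hC : C ≠ ∞) (hu : Measurable u) (hW : Measurable W) (hP : Measurable P)
    (hm : Measurable (Function.uncurry m))
    (h : ∀ ζ, ζ ≠ 0 → ∫⁻ ξ, u ξ * m ξ (ξ - ζ) ^ 2 ≤ C * v ζ) :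
    ∫⁻ ξ, u ξ * (∫⁻ η, m ξ η * (W (ξ - η) * P η)) ^ 2 ≤
      C * (∫⁻ η, P η ^ 2) * ∫⁻ ζ, v ζ * W ζ ^ 2 := by
  have hm' : ∀ ξ, Measurable (m ξ) := fun ξ => hm.of_uncurry_left
  have step (ξ : Plane) : (∫⁻ η, m ξ η * (W (ξ - η) * P η)) ^ 2 ≤
      (∫⁻ η, P η ^ 2) * ∫⁻ ζ, m ξ (ξ - ζ) ^ 2 * W ζ ^ 2 := by
    have h1 := sq_lintegral_mul_le (μ := volume) (f := P) (g := fun η => m ξ η * W (ξ - η))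
      hP.aemeasurable (((hm' ξ).mul (hW.comp (by fun_prop))).aemeasurable)
    have h2 : ∫⁻ η, (m ξ η * W (ξ - η)) ^ 2 = ∫⁻ ζ, m ξ (ξ - ζ) ^ 2 * W ζ ^ 2 := by
      rw [← lintegral_sub_left_eq_self (μ := volume) _ ξ]
      simp [mul_pow]
    rw [h2] at h1
    refine le_trans (le_of_eq ?_) h1
    congr 2 with η
    ring
  have hm2 : Measurable fun p : Plane × Plane => u p.2 * m p.2 (p.2 - p.1) ^ 2 :=
    (hu.comp measurable_snd).mul
      ((hm.comp (measurable_snd.prodMk (measurable_snd.sub measurable_fst))).pow_const 2)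
  calc ∫⁻ ξ, u ξ * (∫⁻ η, m ξ η * (W (ξ - η) * P η)) ^ 2
      ≤ ∫⁻ ξ, (∫⁻ η, P η ^ 2) * ∫⁻ ζ, u ξ * m ξ (ξ - ζ) ^ 2 * W ζ ^ 2 := by
        refine lintegral_mono fun ξ => ?_
        calc u ξ * (∫⁻ η, m ξ η * (W (ξ - η) * P η)) ^ 2
            ≤ u ξ * ((∫⁻ η, P η ^ 2) * ∫⁻ ζ, m ξ (ξ - ζ) ^ 2 * W ζ ^ 2) := by
              gcongr; exact step ξ
          _ = (∫⁻ η, P η ^ 2) * ∫⁻ ζ, u ξ * m ξ (ξ - ζ) ^ 2 * W ζ ^ 2 := by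
              rw [mul_left_comm, ← lintegral_const_mul]
              · simp only [mul_assoc]
              · exact (((hm' ξ).comp (by fun_prop)).pow_const 2).mul (hW.pow_const 2)
    _ = (∫⁻ η, P η ^ 2) * ∫⁻ ζ, ∫⁻ ξ, u ξ * m ξ (ξ - ζ) ^ 2 * W ζ ^ 2 := by
        rw [lintegral_const_mul, lintegral_lintegral_swap]
        · exact ((hm2.comp measurable_swap).mul
            ((hW.comp measurable_snd).pow_const 2)).aemeasurable
        · exact ((hm2.comp measurable_swap).mul
            ((hW.comp measurable_snd).pow_const 2)).lintegral_prod_right'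
    _ ≤ (∫⁻ η, P η ^ 2) * ∫⁻ ζ, C * (v ζ * W ζ ^ 2) := by
        have h0 : ∀ᵐ x : Plane, x ≠ 0 := by simp [ae_iff]
        refine mul_le_mul' le_rfl (lintegral_mono_ae ?_)
        filter_upwards [h0] with ζ hζ
        rw [lintegral_mul_const]
        · rw [← mul_assoc]; gcongr; exact h ζ hζ
        · exact hm2.comp (measurable_const.prodMk measurable_id)
    _ = _ := by rw [lintegral_const_mul' _ _ hC, ← mul_assoc, mul_comm C]

/-- The square of the homogeneous Sobolev norm of order `r / 2`, on the Fourier side. -/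
def hsq (r : ℤ) (a : Plane → ℂ) : ℝ≥0∞ := ∫⁻ ξ, ENNReal.ofReal (‖ξ‖ ^ r) * ‖a ξ‖ₑ ^ 2

/-- The bilinear operator with kernel `|kernel|`, on nonnegative functions. -/
def absBilin (W P : Plane → ℝ≥0∞) (ξ : Plane) : ℝ≥0∞ :=
  ∫⁻ η, ‖kernel ξ η‖ₑ * (W (ξ - η) * P η)

theorem ae_ne_zero : ∀ᵐ ξ : Plane, ξ ≠ 0 := by simp [ae_iff]

theorem sq_enorm_kernel (ξ η : Plane) : ‖kernel ξ η‖ₑ ^ 2 = ENNReal.ofReal (kernel ξ η ^ 2) := by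
  rw [← ofReal_norm, ← ENNReal.ofReal_pow (norm_nonneg _), Real.norm_eq_abs, sq_abs]

/-- The cancellation in the kernel in terms of `ξ` and `ζ = ξ - η`, the form in which it enters the
integrals over `ξ` at fixed `ζ`. -/
theorem kernel_sq_le (ξ : Plane) {ζ : Plane} (hζ : ζ ≠ 0) :
    kernel ξ (ξ - ζ) ^ 2 ≤ 4 * Real.pi ^ 2 * (‖ξ‖ ^ 4 / max ‖ξ‖ ‖ζ‖ ^ 2) := by
  have h1 := abs_kernel_mul_max_le ξ ζ
  have h2 := max_norm_le_two_mul_max ξ ζ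
  have hm : 0 < max ‖ξ‖ ‖ζ‖ := lt_max_of_lt_right (norm_pos_iff.mpr hζ)
  rw [max_comm ‖ζ‖] at h1
  have h3 : |kernel ξ ζ| * max ‖ξ‖ ‖ζ‖ ≤ 2 * Real.pi * ‖ξ‖ ^ 2 := by
    have := mul_le_mul_of_nonneg_left h2 (abs_nonneg (kernel ξ ζ))
    linarith
  rw [kernel_sub, ← mul_div_assoc, le_div_iff₀ (by positivity), ← sq_abs, ← mul_pow]
  calc (|kernel ξ ζ| * max ‖ξ‖ ‖ζ‖) ^ 2 ≤ (2 * Real.pi * ‖ξ‖ ^ 2) ^ 2 := by gcongr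
    _ = _ := by ring

theorem measurable_norm_zpow (r : ℤ) : Measurable fun ξ : Plane => ENNReal.ofReal (‖ξ‖ ^ r) := by
  fun_prop

theorem measurable_enorm_kernel :
    Measurable (Function.uncurry fun ξ η : Plane => ‖kernel ξ η‖ₑ) :=
  measurable_kernel.enorm

/-- The bilinear estimate `L² × Ḣ^{-1/2} → Ḣ^{-3/2}` for the flux. It fails without the
cancellation in the symmetrised kernel. -/
theorem absBilin_negative_order_le {W P : Plane → ℝ≥0∞} (hW : Measurable W) (hP : Measurable P) :
    ∫⁻ ξ, ENNReal.ofReal (‖ξ‖ ^ (-5 : ℤ)) * absBilin W P ξ ^ 2 ≤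
      ENNReal.ofReal (16 * Real.pi ^ 3) * (∫⁻ η, P η ^ 2) *
        ∫⁻ ζ, ENNReal.ofReal (‖ζ‖ ^ (-1 : ℤ)) * W ζ ^ 2 := by
  refine lintegral_sq_bilinear_le ENNReal.ofReal_ne_top (measurable_norm_zpow _) hW hP
    measurable_enorm_kernel fun ζ hζ => ?_
  have hR := norm_pos_iff.mpr hζ
  calc ∫⁻ ξ, ENNReal.ofReal (‖ξ‖ ^ (-5 : ℤ)) * ‖kernel ξ (ξ - ζ)‖ₑ ^ 2
      ≤ ∫⁻ ξ : Plane, ENNReal.ofReal (4 * Real.pi ^ 2) *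
          ENNReal.ofReal (‖ξ‖⁻¹ / max ‖ξ‖ ‖ζ‖ ^ 2) := by
        refine lintegral_mono_ae ?_
        filter_upwards [ae_ne_zero] with ξ hξ
        have hξ' := norm_pos_iff.mpr hξ
        rw [sq_enorm_kernel, ← ENNReal.ofReal_mul (by positivity),
          ← ENNReal.ofReal_mul (by positivity)]
        apply ENNReal.ofReal_le_ofReal
        calc ‖ξ‖ ^ (-5 : ℤ) * kernel ξ (ξ - ζ) ^ 2
            ≤ ‖ξ‖ ^ (-5 : ℤ) * (4 * Real.pi ^ 2 * (‖ξ‖ ^ 4 / max ‖ξ‖ ‖ζ‖ ^ 2)) := by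
              gcongr; exact kernel_sq_le ξ hζ
          _ = _ := by
              rw [zpow_neg]; field_simp
    _ ≤ ENNReal.ofReal (4 * Real.pi ^ 2) * ENNReal.ofReal (4 * Real.pi * ‖ζ‖⁻¹) := by
        rw [lintegral_const_mul' _ _ ENNReal.ofReal_ne_top]
        gcongr
        exact lintegral_inv_norm_div_max_sq_le hR
    _ = _ := by
        rw [← ENNReal.ofReal_mul (by positivity), ← ENNReal.ofReal_mul (by positivity), zpow_neg_one]
        congr 1; ring

/-- For a second factor supported in `|η| ≤ N` the estimate of `absBilin_negative_order_le`
gains one derivative. -/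
theorem absBilin_negative_order_le_of_bandlimited {W P : Plane → ℝ≥0∞} {N : ℝ} (hN : 0 ≤ N)
    (hW : Measurable W) (hP : Measurable P) (hPN : ∀ η, N < ‖η‖ → P η = 0) :
    ∫⁻ ξ, ENNReal.ofReal (‖ξ‖ ^ (-3 : ℤ)) * absBilin W P ξ ^ 2 ≤
      ENNReal.ofReal (4 * Real.pi ^ 3 * N ^ 2) * (∫⁻ η, P η ^ 2) *
        ∫⁻ ζ, ENNReal.ofReal (‖ζ‖ ^ (-1 : ℤ)) * W ζ ^ 2 := by
  have hset : MeasurableSet {η : Plane | ‖η‖ ≤ N} := measurableSet_le (by fun_prop) (by fun_prop)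
  have hm : Measurable (Function.uncurry fun ξ η : Plane =>
      ‖kernel ξ η‖ₑ * {η : Plane | ‖η‖ ≤ N}.indicator 1 η) :=
    measurable_enorm_kernel.mul ((measurable_one.indicator hset).comp measurable_snd)
  have hrw (ξ : Plane) : absBilin W P ξ =
      ∫⁻ η, (‖kernel ξ η‖ₑ * {η : Plane | ‖η‖ ≤ N}.indicator 1 η) * (W (ξ - η) * P η) := by
    refine lintegral_congr fun η => ?_
    by_cases h : ‖η‖ ≤ N
    · simp [h]
    · simp [h, hPN η (not_le.mp h)]
  simp only [hrw]
  refine lintegral_sq_bilinear_le ENNReal.ofReal_ne_top (measurable_norm_zpow _) hW hP hm fun ζ hζ => ?_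
  have hR := norm_pos_iff.mpr hζ
  calc ∫⁻ ξ, ENNReal.ofReal (‖ξ‖ ^ (-3 : ℤ)) *
        (‖kernel ξ (ξ - ζ)‖ₑ * {η : Plane | ‖η‖ ≤ N}.indicator 1 (ξ - ζ)) ^ 2
      ≤ ∫⁻ ξ : Plane, ENNReal.ofReal (4 * Real.pi ^ 2 * ‖ζ‖⁻¹) *
          (Metric.closedBall ζ N).indicator 1 ξ := by
        refine lintegral_mono_ae ?_
        filter_upwards [ae_ne_zero] with ξ hξ
        have hξ' := norm_pos_iff.mpr hξ
        by_cases h : ‖ξ - ζ‖ ≤ N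
        · have h' : ξ ∈ Metric.closedBall ζ N := by simpa [dist_eq_norm] using h
          simp only [mem_ofPred_eq, h, indicator_of_mem, h', Pi.one_apply, mul_one]
          rw [sq_enorm_kernel, ← ENNReal.ofReal_mul (by positivity)]
          apply ENNReal.ofReal_le_ofReal
          have hm0 : 0 < max ‖ξ‖ ‖ζ‖ := lt_max_of_lt_right hR
          calc ‖ξ‖ ^ (-3 : ℤ) * kernel ξ (ξ - ζ) ^ 2
              ≤ ‖ξ‖ ^ (-3 : ℤ) * (4 * Real.pi ^ 2 * (‖ξ‖ ^ 4 / max ‖ξ‖ ‖ζ‖ ^ 2)) := by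
                gcongr; exact kernel_sq_le ξ hζ
            _ = 4 * Real.pi ^ 2 * (‖ξ‖ / (max ‖ξ‖ ‖ζ‖ * max ‖ξ‖ ‖ζ‖)) := by
                rw [zpow_neg]; field_simp
            _ ≤ 4 * Real.pi ^ 2 * (max ‖ξ‖ ‖ζ‖ / (max ‖ξ‖ ‖ζ‖ * ‖ζ‖)) := by
                gcongr
                · exact le_max_left _ _
                · exact le_max_right _ _
            _ = _ := by field_simp
        · simp [h]
    _ = ENNReal.ofReal (4 * Real.pi ^ 2 * ‖ζ‖⁻¹) * ENNReal.ofReal (Real.pi * N ^ 2) := by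
        rw [lintegral_const_mul' _ _ ENNReal.ofReal_ne_top, lintegral_indicator_one measurableSet_closedBall,
          EuclideanSpace.volume_closedBall_fin_two]
        rw [mul_comm Real.pi, ENNReal.ofReal_mul (p := N ^ 2) (by positivity),
          ENNReal.ofReal_pow hN]
    _ = _ := by
        rw [← ENNReal.ofReal_mul (by positivity), ← ENNReal.ofReal_mul (by positivity), zpow_neg_one]
        congr 1; ring

theorem ennreal_add_sq_le (a b : ℝ≥0∞) : (a + b) ^ 2 ≤ 2 * a ^ 2 + 2 * b ^ 2 := by
  rcases eq_or_ne a ∞ with rfl | ha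
  · simp
  rcases eq_or_ne b ∞ with rfl | hb
  · simp
  lift a to NNReal using ha
  lift b to NNReal using hb
  have := add_sq_le (a := a) (b := b)
  rw [mul_add] at this
  exact_mod_cast this

/-- Half of the product estimate `Ḣ^{1/2} × Ḣ^{1/2} → L²` : the contribution of `|η| ≤ |ξ - η|`. -/
theorem lintegral_conv_low_high_le {W P : Plane → ℝ≥0∞} (hW : Measurable W) (hP : Measurable P) :
    ∫⁻ ξ, (∫⁻ η, {p : Plane × Plane | ‖p.2‖ ≤ ‖p.1 - p.2‖}.indicator 1 (ξ, η) *
        (W (ξ - η) * P η)) ^ 2 ≤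
      ENNReal.ofReal (2 * Real.pi) * (∫⁻ η, ENNReal.ofReal (‖η‖ ^ (1 : ℤ)) * P η ^ 2) *
        ∫⁻ ζ, ENNReal.ofReal (‖ζ‖ ^ (1 : ℤ)) * W ζ ^ 2 := by
  have hset : MeasurableSet {p : Plane × Plane | ‖p.2‖ ≤ ‖p.1 - p.2‖} :=
    measurableSet_le (by fun_prop) (by fun_prop)
  set S := {p : Plane × Plane | ‖p.2‖ ≤ ‖p.1 - p.2‖} with hS
  have hm : Measurable (Function.uncurry fun ξ η : Plane =>
      S.indicator 1 (ξ, η) * ENNReal.ofReal (Real.sqrt ‖η‖⁻¹)) := by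
    refine (measurable_one.indicator hset).mul ?_
    fun_prop
  have hP' : Measurable fun η => ENNReal.ofReal (Real.sqrt ‖η‖) * P η := by fun_prop
  have key := lintegral_sq_bilinear_le (u := 1) (v := fun ζ => ENNReal.ofReal (‖ζ‖ ^ (1 : ℤ)))
    (C := ENNReal.ofReal (2 * Real.pi)) ENNReal.ofReal_ne_top measurable_one hW hP' hm fun ζ hζ => ?_
  · have e1 (ξ : Plane) : ∫⁻ η, S.indicator 1 (ξ, η) * (W (ξ - η) * P η) =
        ∫⁻ η, S.indicator 1 (ξ, η) * ENNReal.ofReal (Real.sqrt ‖η‖⁻¹) *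
          (W (ξ - η) * (ENNReal.ofReal (Real.sqrt ‖η‖) * P η)) := by
      refine lintegral_congr_ae ?_
      filter_upwards [ae_ne_zero] with η hη
      have : ENNReal.ofReal (Real.sqrt ‖η‖⁻¹) * ENNReal.ofReal (Real.sqrt ‖η‖) = 1 := by
        rw [← ENNReal.ofReal_mul (by positivity), ← Real.sqrt_mul (by positivity),
          inv_mul_cancel₀ (norm_ne_zero_iff.mpr hη)]
        simp
      calc _ = S.indicator 1 (ξ, η) * (W (ξ - η) * P η) *
            (ENNReal.ofReal (Real.sqrt ‖η‖⁻¹) * ENNReal.ofReal (Real.sqrt ‖η‖)) := by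
              rw [this, mul_one]
        _ = _ := by ring
    have e2 (η : Plane) : (ENNReal.ofReal (Real.sqrt ‖η‖) * P η) ^ 2 =
        ENNReal.ofReal (‖η‖ ^ (1 : ℤ)) * P η ^ 2 := by
      rw [mul_pow, ← ENNReal.ofReal_pow (by positivity), Real.sq_sqrt (norm_nonneg _), zpow_one]
    simp only [e1]
    simpa only [e2, Pi.one_apply, one_mul] using key
  · have e3 (ξ : Plane) : (1 : Plane → ℝ≥0∞) ξ *
        (S.indicator 1 (ξ, ξ - ζ) * ENNReal.ofReal (Real.sqrt ‖ξ - ζ‖⁻¹)) ^ 2 =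
        ENNReal.ofReal (if ‖ξ - ζ‖ ≤ ‖ζ‖ then ‖ξ - ζ‖⁻¹ else 0) := by
      by_cases h : ‖ξ - ζ‖ ≤ ‖ζ‖
      · have h' : (ξ, ξ - ζ) ∈ S := by simpa [hS] using h
        simp only [h', indicator_of_mem, h, if_true, Pi.one_apply, one_mul]
        rw [← ENNReal.ofReal_pow (by positivity), Real.sq_sqrt (by positivity)]
      · have h' : (ξ, ξ - ζ) ∉ S := by simpa [hS] using h
        simp [h', h]
    simp only [e3]
    rw [lintegral_sub_right_eq_self (μ := volume)
      (fun η : Plane => ENNReal.ofReal (if ‖η‖ ≤ ‖ζ‖ then ‖η‖⁻¹ else 0)) ζ]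
    refine (lintegral_inv_norm_closedBall_le (norm_nonneg ζ)).trans (le_of_eq ?_)
    rw [ENNReal.ofReal_mul (by positivity), zpow_one]

/-- The product estimate `Ḣ^{1/2} × Ḣ^{1/2} → L²` of the plane. -/
theorem lintegral_conv_sq_le {W P : Plane → ℝ≥0∞} (hW : Measurable W) (hP : Measurable P) :
    ∫⁻ ξ, (∫⁻ η, W (ξ - η) * P η) ^ 2 ≤
      ENNReal.ofReal (8 * Real.pi) * (∫⁻ ζ, ENNReal.ofReal (‖ζ‖ ^ (1 : ℤ)) * W ζ ^ 2) *
        ∫⁻ η, ENNReal.ofReal (‖η‖ ^ (1 : ℤ)) * P η ^ 2 := by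
  set S := {p : Plane × Plane | ‖p.2‖ ≤ ‖p.1 - p.2‖} with hS
  have hset : MeasurableSet S := measurableSet_le (by fun_prop) (by fun_prop)
  have hSm : Measurable (S.indicator (1 : Plane × Plane → ℝ≥0∞)) := measurable_one.indicator hset
  have hA (ξ : Plane) : ∫⁻ η, W (ξ - η) * P η ≤
      (∫⁻ η, S.indicator 1 (ξ, η) * (W (ξ - η) * P η)) +
        ∫⁻ η, S.indicator 1 (ξ, η) * (P (ξ - η) * W η) := by
    have e : ∫⁻ η, S.indicator 1 (ξ, η) * (P (ξ - η) * W η) =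
        ∫⁻ η, S.indicator 1 (ξ, ξ - η) * (P η * W (ξ - η)) := by
      rw [← lintegral_sub_left_eq_self (μ := volume) _ ξ]
      simp
    rw [e, ← lintegral_add_left]
    · refine lintegral_mono fun η => ?_
      rcases le_total ‖η‖ ‖ξ - η‖ with h | h
      · have h' : (ξ, η) ∈ S := by simpa [hS] using h
        simp [h']
      · have h' : (ξ, ξ - η) ∈ S := by simpa [hS] using h
        simp [h', mul_comm (P η)]
    · exact (hSm.comp measurable_prodMk_left).mul (by fun_prop)
  have hmeas (W P : Plane → ℝ≥0∞) (hW : Measurable W) (hP : Measurable P) :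
      Measurable fun ξ => (∫⁻ η, S.indicator 1 (ξ, η) * (W (ξ - η) * P η)) ^ 2 := by
    refine (Measurable.lintegral_prod_right' (f := fun p : Plane × Plane =>
      S.indicator 1 (p.1, p.2) * (W (p.1 - p.2) * P p.2)) ?_).pow_const 2
    exact hSm.mul (by fun_prop)
  calc ∫⁻ ξ, (∫⁻ η, W (ξ - η) * P η) ^ 2
      ≤ ∫⁻ ξ, (2 * (∫⁻ η, S.indicator 1 (ξ, η) * (W (ξ - η) * P η)) ^ 2 +
        2 * (∫⁻ η, S.indicator 1 (ξ, η) * (P (ξ - η) * W η)) ^ 2) := by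
        refine lintegral_mono fun ξ => ?_
        have := hA ξ
        calc _ ≤ ((∫⁻ η, S.indicator 1 (ξ, η) * (W (ξ - η) * P η)) +
              ∫⁻ η, S.indicator 1 (ξ, η) * (P (ξ - η) * W η)) ^ 2 := by gcongr
          _ ≤ _ := ennreal_add_sq_le _ _
    _ ≤ _ := by
        rw [lintegral_add_left ((hmeas W P hW hP).const_mul 2), lintegral_const_mul' _ _ (by simp),
          lintegral_const_mul' _ _ (by simp)]
        grw [lintegral_conv_low_high_le hW hP, lintegral_conv_low_high_le hP hW]
        apply le_of_eq
        have : ENNReal.ofReal (8 * Real.pi) = 4 * ENNReal.ofReal (2 * Real.pi) := by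
          rw [show (8 * Real.pi) = 4 * (2 * Real.pi) by ring, ENNReal.ofReal_mul (by norm_num)]
          simp
        rw [this]
        ring

/-! ### Sobolev norms -/

theorem enorm_sq_eq_lintegral (a : L2C) : ‖a‖ₑ ^ 2 = ∫⁻ x, ‖a x‖ₑ ^ 2 := by
  rw [Lp.enorm_def, eLpNorm_eq_lintegral_rpow_enorm_toReal (by norm_num) (by norm_num)]
  rw [← ENNReal.rpow_natCast, ← ENNReal.rpow_mul]
  norm_num

theorem hsq_zero (a : L2C) : hsq 0 a = ‖a‖ₑ ^ 2 := by
  simp [hsq, enorm_sq_eq_lintegral]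

theorem hsq_congr {r : ℤ} {a b : Plane → ℂ} (h : a =ᵐ[volume] b) : hsq r a = hsq r b := by
  refine lintegral_congr_ae ?_
  filter_upwards [h] with x hx using by rw [hx]

theorem hsq_add_le (r : ℤ) {a b : Plane → ℂ} (ha : AEMeasurable a) :
    hsq r (fun ξ => a ξ + b ξ) ≤ 2 * hsq r a + 2 * hsq r b := by
  unfold hsq
  rw [← lintegral_const_mul' _ _ (by simp), ← lintegral_const_mul' _ _ (by simp),
    ← lintegral_add_left' (by fun_prop)]
  refine lintegral_mono fun ξ => ?_
  calc ENNReal.ofReal (‖ξ‖ ^ r) * ‖a ξ + b ξ‖ₑ ^ 2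
      ≤ ENNReal.ofReal (‖ξ‖ ^ r) * (2 * ‖a ξ‖ₑ ^ 2 + 2 * ‖b ξ‖ₑ ^ 2) := by
        gcongr
        exact (pow_le_pow_left' (enorm_add_le _ _) 2).trans (ennreal_add_sq_le _ _)
    _ = _ := by ring

/-- Interpolation of `Ḣ^{1/2}` between `L²` and `Ḣ¹`. -/
theorem hsq_one_sq_le {a : Plane → ℂ} (ha : AEMeasurable a) :
    hsq 1 a ^ 2 ≤ hsq 0 a * hsq 2 a := by
  have h := sq_lintegral_mul_le (μ := volume) (f := fun ξ => ‖a ξ‖ₑ)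
    (g := fun ξ : Plane => ENNReal.ofReal ‖ξ‖ * ‖a ξ‖ₑ) (by fun_prop) (by fun_prop)
  refine le_trans (le_of_eq ?_) (h.trans (le_of_eq ?_))
  · unfold hsq
    congr 2 with ξ
    rw [zpow_one]; ring
  · unfold hsq
    congr 2 with ξ
    · simp
    · rw [mul_pow, ← ENNReal.ofReal_pow (norm_nonneg _)]
      norm_cast

theorem continuous_lp_smul (m : Lp ℂ ∞ (volume : Measure Plane)) :
    Continuous fun a : L2C => (m • a : L2C) :=
  AddMonoidHomClass.continuous_of_bound
    (AddMonoidHom.mk' (fun a : L2C => (m • a : L2C)) (Lp.add_smul m)) ‖m‖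
    fun a => Lp.norm_smul_le m a

/-- Lower semicontinuity of the Sobolev norms of nonnegative order on `L²`. -/
theorem lowerSemicontinuous_hsq (r : ℕ) : LowerSemicontinuous fun a : L2C => hsq r a := by
  -- the norm is the supremum of the continuous norms over bounded sets of frequencies
  have hset (n : ℕ) : MeasurableSet {ξ : Plane | ‖ξ‖ ≤ n} :=
    measurableSet_le (by fun_prop) (by fun_prop)
  let m (n : ℕ) (ξ : Plane) : ℂ := {ξ : Plane | ‖ξ‖ ≤ n}.indicator
    (fun ξ => ((Real.sqrt (‖ξ‖ ^ r) : ℝ) : ℂ)) ξ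
  have hm (n : ℕ) : MemLp (m n) ∞ (volume : Measure Plane) := by
    refine memLp_top_of_bound (C := Real.sqrt ((n : ℝ) ^ r)) ?_
      (Filter.Eventually.of_forall fun ξ => ?_)
    · exact (Measurable.indicator (by fun_prop) (hset n)).aestronglyMeasurable
    · by_cases h : ‖ξ‖ ≤ n
      · simp only [m, mem_ofPred_eq, h, indicator_of_mem, Complex.norm_real, Real.norm_eq_abs]
        rw [abs_of_nonneg (by positivity)]
        gcongr
      · simp [m, h]
  have key (a : L2C) : hsq r a = ⨆ n : ℕ, ‖((hm n).toLp _ : Lp ℂ ∞ volume) • a‖ₑ ^ 2 := by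
    have e (n : ℕ) : ‖((hm n).toLp _ : Lp ℂ ∞ volume) • a‖ₑ ^ 2 =
        ∫⁻ ξ, {ξ : Plane | ‖ξ‖ ≤ n}.indicator
          (fun ξ => ENNReal.ofReal (‖ξ‖ ^ (r : ℤ)) * ‖a ξ‖ₑ ^ 2) ξ := by
      rw [enorm_sq_eq_lintegral]
      refine lintegral_congr_ae ?_
      filter_upwards [Lp.coeFn_lpSMul (r := 2) ((hm n).toLp _ : Lp ℂ ∞ volume) a,
        (hm n).coeFn_toLp] with ξ h1 h2
      rw [h1, Pi.smul_apply', h2, smul_eq_mul, enorm_mul, mul_pow]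
      by_cases h : ‖ξ‖ ≤ n
      · simp only [m, mem_ofPred_eq, h, indicator_of_mem]
        congr 1
        rw [← ofReal_norm, Complex.norm_real, Real.norm_eq_abs,
          abs_of_nonneg (by positivity), ← ENNReal.ofReal_pow (by positivity),
          Real.sq_sqrt (by positivity), zpow_natCast]
      · simp [m, h]
    simp only [e]
    rw [← lintegral_iSup]
    · refine lintegral_congr fun ξ => ?_
      obtain ⟨N, hN⟩ := exists_nat_ge ‖ξ‖
      apply le_antisymm
      · refine le_iSup_of_le N ?_
        rw [indicator_of_mem (by exact hN)]
      · exact iSup_le fun n => indicator_le_self _ _ _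
    · intro n
      exact Measurable.indicator ((measurable_norm_zpow _).mul
        ((Lp.stronglyMeasurable a).measurable.enorm.pow_const 2)) (hset n)
    · intro n n' hn ξ
      refine indicator_le_indicator_of_subset (fun x (hx : ‖x‖ ≤ n) => ?_) (by simp) ξ
      exact hx.trans (by exact_mod_cast hn)
  simp only [key]
  refine lowerSemicontinuous_iSup fun n => Continuous.lowerSemicontinuous ?_
  have : Continuous fun a : L2C => ((hm n).toLp _ : Lp ℂ ∞ volume) • a := by
    exact continuous_lp_smul _
  exact (ENNReal.continuous_pow 2).comp (continuous_enorm.comp this)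

/-! ### The bilinear operator -/

/-- The bilinear operator `∫ kernel (ξ, η) a (ξ - η) b (η) dη`, that is, the symmetrised
nonlinearity `-∇ · (u θ)` on the Fourier side. -/
def bilin (a b : Plane → ℂ) (ξ : Plane) : ℂ := ∫ η, (kernel ξ η : ℂ) * (a (ξ - η) * b η)

theorem bilin_comm (a b : Plane → ℂ) (ξ : Plane) : bilin a b ξ = bilin b a ξ := by
  unfold bilin
  rw [← integral_sub_left_eq_self _ volume ξ]
  simp only [kernel_sub, sub_sub_cancel, mul_comm (a _)]

theorem ae_eq_comp_sub_left {a a' : Plane → ℂ} (h : a =ᵐ[volume] a') (ξ : Plane) :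
    (fun η => a (ξ - η)) =ᵐ[volume] fun η => a' (ξ - η) :=
  (Measure.measurePreserving_sub_left volume ξ).quasiMeasurePreserving.ae_eq_comp h

theorem bilin_congr {a a' b b' : Plane → ℂ} (h : a =ᵐ[volume] a') (h' : b =ᵐ[volume] b') :
    bilin a b = bilin a' b' := by
  ext ξ
  refine integral_congr_ae ?_
  filter_upwards [ae_eq_comp_sub_left h ξ, h'] with η h1 h2
  simp only [h1, h2]

theorem integrable_mul_comp_sub (a b : L2C) (ξ : Plane) : Integrable fun η => a (ξ - η) * b η := by
  have h1 : MemLp (fun η => a (ξ - η)) 2 volume :=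
    (Lp.memLp a).comp_measurePreserving (Measure.measurePreserving_sub_left volume ξ)
  exact h1.integrable_mul (Lp.memLp b)

theorem integrable_bilin (a b : L2C) (ξ : Plane) :
    Integrable fun η => (kernel ξ η : ℂ) * (a (ξ - η) * b η) := by
  refine (integrable_mul_comp_sub a b ξ).bdd_mul (c := Real.pi * ‖ξ‖) ?_
    (Filter.Eventually.of_forall fun η => ?_)
  · exact (Complex.measurable_ofReal.comp
      measurable_kernel.of_uncurry_left).aestronglyMeasurable
  · simpa using abs_kernel_le ξ η

theorem lintegral_mul_comp_sub_le (a b : L2C) (ξ : Plane) :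
    ∫⁻ η, ‖a (ξ - η)‖ₑ * ‖b η‖ₑ ≤ ‖a‖ₑ * ‖b‖ₑ := by
  have h := sq_lintegral_mul_le (μ := volume) (f := fun η => ‖a (ξ - η)‖ₑ)
    (g := fun η => ‖b η‖ₑ)
    (((Lp.stronglyMeasurable a).measurable.comp (by fun_prop)).enorm.aemeasurable)
    (Lp.stronglyMeasurable b).measurable.enorm.aemeasurable
  rw [lintegral_sub_left_eq_self (μ := volume) (fun η => ‖a η‖ₑ ^ 2), ← enorm_sq_eq_lintegral,
    ← enorm_sq_eq_lintegral, ← mul_pow] at h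
  exact (ENNReal.pow_le_pow_left_iff (by norm_num)).mp h

theorem enorm_kernel_le (ξ η : Plane) : ‖(kernel ξ η : ℂ)‖ₑ ≤ ENNReal.ofReal (Real.pi * ‖ξ‖) := by
  rw [← ofReal_norm, Complex.norm_real]
  exact ENNReal.ofReal_le_ofReal (abs_kernel_le ξ η)

theorem enorm_bilin_le_conv (a b : Plane → ℂ) (ξ : Plane) :
    ‖bilin a b ξ‖ₑ ≤ ENNReal.ofReal (Real.pi * ‖ξ‖) * ∫⁻ η, ‖a (ξ - η)‖ₑ * ‖b η‖ₑ := by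
  refine (enorm_integral_le_lintegral_enorm _).trans ?_
  rw [← lintegral_const_mul' _ _ ENNReal.ofReal_ne_top]
  refine lintegral_mono fun η => ?_
  simp only [enorm_mul]
  gcongr
  exact enorm_kernel_le ξ η

theorem enorm_bilin_le_absBilin (a b : Plane → ℂ) (ξ : Plane) :
    ‖bilin a b ξ‖ₑ ≤ absBilin (fun η => ‖a η‖ₑ) (fun η => ‖b η‖ₑ) ξ := by
  refine (enorm_integral_le_lintegral_enorm _).trans (le_of_eq ?_)
  refine lintegral_congr fun η => ?_
  rw [enorm_mul, enorm_mul]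
  congr 1
  rw [← ofReal_norm, ← ofReal_norm, Complex.norm_real]

theorem norm_bilin_le (a b : L2C) (ξ : Plane) : ‖bilin a b ξ‖ ≤ Real.pi * ‖ξ‖ * ‖a‖ * ‖b‖ := by
  have h := (enorm_bilin_le_conv a b ξ).trans
    (mul_le_mul' le_rfl (lintegral_mul_comp_sub_le a b ξ))
  rw [← ofReal_norm, ← ofReal_norm, ← ofReal_norm, ← ENNReal.ofReal_mul (by positivity),
    ← ENNReal.ofReal_mul (by positivity), ENNReal.ofReal_le_ofReal_iff (by positivity)] at h
  linarith

/-- The value of the bilinear operator at a frequency, as a continuous bilinear form on `L²`. -/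
def bilinCLM (ξ : Plane) : L2C →L[ℂ] L2C →L[ℂ] ℂ :=
  LinearMap.mkContinuous₂ (LinearMap.mk₂ ℂ (fun a b : L2C => bilin a b ξ)
    (fun a a' b => by
      rw [bilin_congr (Lp.coeFn_add a a') (Filter.EventuallyEq.refl _ _)]
      unfold bilin
      rw [← integral_add (integrable_bilin a b ξ) (integrable_bilin a' b ξ)]
      congr with η
      simp only [Pi.add_apply]; ring)
    (fun c a b => by
      rw [bilin_congr (Lp.coeFn_smul c a) (Filter.EventuallyEq.refl _ _)]
      unfold bilin
      rw [← integral_smul]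
      congr with η
      simp only [Pi.smul_apply, smul_eq_mul]; ring)
    (fun a b b' => by
      rw [bilin_congr (Filter.EventuallyEq.refl _ _) (Lp.coeFn_add b b')]
      unfold bilin
      rw [← integral_add (integrable_bilin a b ξ) (integrable_bilin a b' ξ)]
      congr with η
      simp only [Pi.add_apply]; ring)
    (fun c a b => by
      rw [bilin_congr (Filter.EventuallyEq.refl _ _) (Lp.coeFn_smul c b)]
      unfold bilin
      rw [← integral_smul]
      congr with η
      simp only [Pi.smul_apply, smul_eq_mul]; ring)) (Real.pi * ‖ξ‖)
    (fun a b => norm_bilin_le a b ξ)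

theorem bilinCLM_apply (ξ : Plane) (a b : L2C) : bilinCLM ξ a b = bilin a b ξ := rfl

/-- Polarisation: the difference of two solutions solves a linear equation. -/
theorem bilin_self_sub_self (a b : L2C) (ξ : Plane) :
    bilin a a ξ - bilin b b ξ = bilin ↑(a - b) ↑(a + b) ξ := by
  have h := bilin_comm a b ξ
  simp only [← bilinCLM_apply] at h ⊢
  simp only [map_sub, map_add, sub_apply, h]
  ring

theorem continuous_bilin {g h : ℝ → L2C} (hg : Continuous g) (hh : Continuous h) (ξ : Plane) :
    Continuous fun s => bilin (g s) (h s) ξ := by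
  simp only [← bilinCLM_apply]
  fun_prop

theorem measurable_bilin {a b : Plane → ℂ} (ha : Measurable a) (hb : Measurable b) :
    Measurable (bilin a b) := by
  refine (StronglyMeasurable.integral_prod_right' (f := fun p : Plane × Plane =>
    (kernel p.1 p.2 : ℂ) * (a (p.1 - p.2) * b p.2)) ?_).measurable
  refine Measurable.stronglyMeasurable ?_
  exact (Complex.measurable_ofReal.comp measurable_kernel).mul (by fun_prop)

theorem measurable_coe (a : L2C) : Measurable (a : Plane → ℂ) :=
  (Lp.stronglyMeasurable a).measurable

/-- The bilinear estimate `Ḣ^{1/2} × Ḣ^{1/2} → Ḣ^{-1}` for the nonlinearity. -/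
theorem hsq_bilin_le {a b : Plane → ℂ} (ha : Measurable a) (hb : Measurable b) :
    hsq (-2) (bilin a b) ≤ ENNReal.ofReal (8 * Real.pi ^ 3) * hsq 1 a * hsq 1 b := by
  calc hsq (-2) (bilin a b)
      ≤ ∫⁻ ξ, ENNReal.ofReal (Real.pi ^ 2) * (∫⁻ η, ‖a (ξ - η)‖ₑ * ‖b η‖ₑ) ^ 2 := by
        refine lintegral_mono_ae ?_
        filter_upwards [ae_ne_zero] with ξ hξ
        have hξ' := norm_ne_zero_iff.mpr hξ
        calc _ ≤ ENNReal.ofReal (‖ξ‖ ^ (-2 : ℤ)) *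
              (ENNReal.ofReal (Real.pi * ‖ξ‖) * ∫⁻ η, ‖a (ξ - η)‖ₑ * ‖b η‖ₑ) ^ 2 := by
              gcongr; exact enorm_bilin_le_conv a b ξ
          _ = _ := by
              rw [mul_pow, ← mul_assoc, ← ENNReal.ofReal_pow (by positivity),
                ← ENNReal.ofReal_mul (by positivity)]
              congr 2
              rw [zpow_neg]; field_simp
    _ ≤ ENNReal.ofReal (Real.pi ^ 2) * (ENNReal.ofReal (8 * Real.pi) * hsq 1 a * hsq 1 b) := by
        rw [lintegral_const_mul' _ _ ENNReal.ofReal_ne_top]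
        gcongr
        exact lintegral_conv_sq_le ha.enorm hb.enorm
    _ = _ := by
        rw [← mul_assoc, ← mul_assoc, ← ENNReal.ofReal_mul (by positivity)]
        congr 3; ring

/-! ### The scalar linear equation -/

/-- The solution of the scalar equation `y' = -c y + f`, `y(0) = y₀`, by Duhamel's formula. -/
def scalarDuhamel (c : ℝ) (y₀ : ℂ) (f : ℝ → ℂ) (t : ℝ) : ℂ :=
  (Real.exp (-(c * t)) : ℂ) * y₀ + ∫ s in (0 : ℝ)..t, (Real.exp (-(c * (t - s))) : ℂ) * f s

theorem scalarDuhamel_zero (c : ℝ) (y₀ : ℂ) (f : ℝ → ℂ) : scalarDuhamel c y₀ f 0 = y₀ := by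
  simp [scalarDuhamel]

theorem scalarDuhamel_eq_exp_mul (c : ℝ) (y₀ : ℂ) (f : ℝ → ℂ) (t : ℝ) :
    scalarDuhamel c y₀ f t =
      (Real.exp (-(c * t)) : ℂ) * (y₀ + ∫ s in (0 : ℝ)..t, (Real.exp (c * s) : ℂ) * f s) := by
  rw [scalarDuhamel, mul_add, ← intervalIntegral.integral_const_mul]
  congr 1
  refine intervalIntegral.integral_congr fun s _ => ?_
  rw [← mul_assoc, ← Complex.ofReal_mul, ← Real.exp_add]
  congr 3
  ring

theorem hasDerivAt_scalarDuhamel (c : ℝ) (y₀ : ℂ) {f : ℝ → ℂ} (hf : Continuous f) (t : ℝ) :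
    HasDerivAt (scalarDuhamel c y₀ f) (-c * scalarDuhamel c y₀ f t + f t) t := by
  have hc : Continuous fun s : ℝ => (Real.exp (c * s) : ℂ) * f s := by fun_prop
  have h1 : HasDerivAt (fun t => y₀ + ∫ s in (0 : ℝ)..t, (Real.exp (c * s) : ℂ) * f s)
      ((Real.exp (c * t) : ℂ) * f t) t :=
    (hc.integral_hasStrictDerivAt 0 t).hasDerivAt.const_add y₀
  have h2 : HasDerivAt (fun t : ℝ => (Real.exp (-(c * t)) : ℂ))
      ((Real.exp (-(c * t)) * -(c * 1) : ℝ) : ℂ) t :=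
    (((hasDerivAt_id t).const_mul c).neg.exp).ofReal_comp
  have h3 := h2.mul h1
  have e : scalarDuhamel c y₀ f = fun t => (Real.exp (-(c * t)) : ℂ) *
      (y₀ + ∫ s in (0 : ℝ)..t, (Real.exp (c * s) : ℂ) * f s) :=
    funext (scalarDuhamel_eq_exp_mul c y₀ f)
  rw [e]
  convert! h3 using 1
  have : (Real.exp (-(c * t)) : ℂ) * (Real.exp (c * t) : ℂ) = 1 := by
    rw [← Complex.ofReal_mul, ← Real.exp_add]; simp
  rw [← mul_assoc (Real.exp (-(c * t)) : ℂ) (Real.exp (c * t) : ℂ), this]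
  push_cast; ring

theorem continuous_scalarDuhamel (c : ℝ) (y₀ : ℂ) {f : ℝ → ℂ} (hf : Continuous f) :
    Continuous (scalarDuhamel c y₀ f) :=
  continuous_iff_continuousAt.mpr fun t => (hasDerivAt_scalarDuhamel c y₀ hf t).continuousAt

/-- The energy identity of the scalar equation `y' = -c y + f`. -/
theorem scalarDuhamel_energy (c : ℝ) (y₀ : ℂ) {f : ℝ → ℂ} (hf : Continuous f) (t : ℝ) :
    ‖scalarDuhamel c y₀ f t‖ ^ 2 + 2 * c * ∫ s in (0 : ℝ)..t, ‖scalarDuhamel c y₀ f s‖ ^ 2 =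
      ‖y₀‖ ^ 2 + 2 * ∫ s in (0 : ℝ)..t, (starRingEnd ℂ (scalarDuhamel c y₀ f s) * f s).re := by
  set y := scalarDuhamel c y₀ f with hy
  have hyc : Continuous y := continuous_scalarDuhamel c y₀ hf
  have hstar : Continuous fun s => starRingEnd ℂ (y s) := Complex.continuous_conj.comp hyc
  have hd (s : ℝ) : HasDerivAt (fun s => ‖y s‖ ^ 2)
      (-(2 * c) * ‖y s‖ ^ 2 + 2 * (starRingEnd ℂ (y s) * f s).re) s := by
    convert! (hasDerivAt_scalarDuhamel c y₀ hf s).norm_sq using 1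
    rw [Complex.inner, ← hy, ← Complex.normSq_eq_norm_sq, Complex.normSq_apply]
    simp
    ring
  have hI := intervalIntegral.integral_eq_sub_of_hasDerivAt (a := 0) (b := t)
    (fun s _ => hd s) (Continuous.intervalIntegrable (by fun_prop) _ _)
  rw [intervalIntegral.integral_add (Continuous.intervalIntegrable (by fun_prop) _ _)
    (Continuous.intervalIntegrable (by fun_prop) _ _), intervalIntegral.integral_const_mul,
    intervalIntegral.integral_const_mul] at hI
  have h0 : y 0 = y₀ := scalarDuhamel_zero c y₀ f
  rw [h0] at hI
  linarith

/-- For a vanishing initial value, half of the dissipation absorbs the work of the source. -/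
theorem scalarDuhamel_bound {c : ℝ} (hc : 0 < c) {f : ℝ → ℂ} (hf : Continuous f) {t : ℝ}
    (ht : 0 ≤ t) :
    ‖scalarDuhamel c 0 f t‖ ^ 2 + c * ∫ s in (0 : ℝ)..t, ‖scalarDuhamel c 0 f s‖ ^ 2 ≤
      c⁻¹ * ∫ s in (0 : ℝ)..t, ‖f s‖ ^ 2 := by
  have he := scalarDuhamel_energy c 0 hf t
  set y := scalarDuhamel c 0 f with hy
  have hyc : Continuous y := continuous_scalarDuhamel c 0 hf
  have hstar : Continuous fun s => starRingEnd ℂ (y s) := Complex.continuous_conj.comp hyc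
  have hle : ∫ s in (0 : ℝ)..t, 2 * (starRingEnd ℂ (y s) * f s).re ≤
      ∫ s in (0 : ℝ)..t, (c * ‖y s‖ ^ 2 + c⁻¹ * ‖f s‖ ^ 2) := by
    refine intervalIntegral.integral_mono_on ht
      (Continuous.intervalIntegrable (by fun_prop) _ _)
      (Continuous.intervalIntegrable (by fun_prop) _ _) fun s _ => ?_
    have h1 : (starRingEnd ℂ (y s) * f s).re ≤ ‖y s‖ * ‖f s‖ := by
      refine (Complex.re_le_norm _).trans (le_of_eq ?_)
      rw [norm_mul, RCLike.norm_conj]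
    have h2 : 2 * (‖y s‖ * ‖f s‖) ≤ c * ‖y s‖ ^ 2 + c⁻¹ * ‖f s‖ ^ 2 := by
      have : 0 ≤ c⁻¹ * (c * ‖y s‖ - ‖f s‖) ^ 2 := by positivity
      have e : c⁻¹ * (c * ‖y s‖ - ‖f s‖) ^ 2 =
          c * ‖y s‖ ^ 2 + c⁻¹ * ‖f s‖ ^ 2 - 2 * (‖y s‖ * ‖f s‖) := by field_simp; ring
      linarith
    linarith
  rw [intervalIntegral.integral_const_mul, intervalIntegral.integral_add
    (Continuous.intervalIntegrable (by fun_prop) _ _)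
    (Continuous.intervalIntegrable (by fun_prop) _ _), intervalIntegral.integral_const_mul,
    intervalIntegral.integral_const_mul] at hle
  simp only [norm_zero, ne_eq, OfNat.ofNat_ne_zero, not_false_eq_true, zero_pow, zero_add] at he
  linarith

theorem ofReal_integral_norm_sq {f : ℝ → ℂ} (hf : Continuous f) {t : ℝ} (ht : 0 ≤ t) :
    ENNReal.ofReal (∫ s in (0 : ℝ)..t, ‖f s‖ ^ 2) = ∫⁻ s in Ioc 0 t, ‖f s‖ₑ ^ 2 := by
  rw [intervalIntegral.integral_of_le ht, ofReal_integral_eq_lintegral_ofReal]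
  · refine lintegral_congr fun s => ?_
    rw [ENNReal.ofReal_pow (norm_nonneg _), ofReal_norm]
  · exact (Continuous.intervalIntegrable (by fun_prop) 0 t).1
  · exact Filter.Eventually.of_forall fun s => by positivity

theorem enorm_scalarDuhamel_sq_le {c : ℝ} (hc : 0 < c) {f : ℝ → ℂ} (hf : Continuous f) {t : ℝ}
    (ht : 0 ≤ t) :
    ‖scalarDuhamel c 0 f t‖ₑ ^ 2 ≤ ENNReal.ofReal c⁻¹ * ∫⁻ s in Ioc 0 t, ‖f s‖ₑ ^ 2 := by
  rw [← ofReal_integral_norm_sq hf ht, ← ENNReal.ofReal_mul (by positivity), ← ofReal_norm,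
    ← ENNReal.ofReal_pow (norm_nonneg _)]
  apply ENNReal.ofReal_le_ofReal
  have h := scalarDuhamel_bound hc hf ht
  have : 0 ≤ c * ∫ s in (0 : ℝ)..t, ‖scalarDuhamel c 0 f s‖ ^ 2 :=
    mul_nonneg hc.le (intervalIntegral.integral_nonneg ht fun _ _ => by positivity)
  linarith

theorem lintegral_scalarDuhamel_sq_le {c : ℝ} (hc : 0 < c) {f : ℝ → ℂ} (hf : Continuous f) {t : ℝ}
    (ht : 0 ≤ t) :
    ∫⁻ s in Ioc 0 t, ‖scalarDuhamel c 0 f s‖ₑ ^ 2 ≤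
      ENNReal.ofReal (c ^ 2)⁻¹ * ∫⁻ s in Ioc 0 t, ‖f s‖ₑ ^ 2 := by
  rw [← ofReal_integral_norm_sq hf ht, ← ENNReal.ofReal_mul (by positivity),
    ← ofReal_integral_norm_sq (continuous_scalarDuhamel c 0 hf) ht]
  apply ENNReal.ofReal_le_ofReal
  have h := scalarDuhamel_bound hc hf ht
  have h0 : 0 ≤ ‖scalarDuhamel c 0 f t‖ ^ 2 := by positivity
  have h1 : c * ∫ s in (0 : ℝ)..t, ‖scalarDuhamel c 0 f s‖ ^ 2 ≤
      c⁻¹ * ∫ s in (0 : ℝ)..t, ‖f s‖ ^ 2 := by linarith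
  rw [← le_div_iff₀' hc] at h1
  refine h1.trans (le_of_eq ?_)
  field_simp

/-- An exponential weight in time increases the damping rate. -/
theorem scalarDuhamel_smul_exp (c l : ℝ) (f : ℝ → ℂ) (t : ℝ) :
    scalarDuhamel (c + l) 0 (fun s => (Real.exp (-(l * s)) : ℂ) * f s) t =
      (Real.exp (-(l * t)) : ℂ) * scalarDuhamel c 0 f t := by
  simp only [scalarDuhamel, mul_zero, zero_add]
  rw [← intervalIntegral.integral_const_mul]
  refine intervalIntegral.integral_congr fun s _ => ?_
  rw [← mul_assoc, ← mul_assoc, ← Complex.ofReal_mul, ← Complex.ofReal_mul, ← Real.exp_add,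
    ← Real.exp_add]
  congr 3
  ring

theorem scalarDuhamel_sub (c : ℝ) (y z : ℂ) {f g : ℝ → ℂ} (hf : Continuous f) (hg : Continuous g)
    (t : ℝ) : scalarDuhamel c y f t - scalarDuhamel c z g t =
      scalarDuhamel c (y - z) (fun s => f s - g s) t := by
  simp only [scalarDuhamel, mul_sub]
  rw [intervalIntegral.integral_sub (Continuous.intervalIntegrable (by fun_prop) _ _)
    (Continuous.intervalIntegrable (by fun_prop) _ _)]
  ring

theorem scalarDuhamel_congr {c : ℝ} {y : ℂ} {f g : ℝ → ℂ} {t : ℝ} (ht : 0 ≤ t)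
    (h : ∀ s ∈ Icc 0 t, f s = g s) : scalarDuhamel c y f t = scalarDuhamel c y g t := by
  unfold scalarDuhamel
  congr 1
  refine intervalIntegral.integral_congr fun s hs => ?_
  rw [uIcc_of_le ht] at hs
  simp only [h s hs]

/-- The flow property of the scalar equation. -/
theorem scalarDuhamel_add (c : ℝ) (y : ℂ) {f : ℝ → ℂ} (hf : Continuous f) (t₀ t : ℝ) :
    scalarDuhamel c y f (t₀ + t) =
      scalarDuhamel c (scalarDuhamel c y f t₀) (fun s => f (t₀ + s)) t := by
  simp only [scalarDuhamel_eq_exp_mul]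
  have hc : Continuous fun s : ℝ => (Real.exp (c * s) : ℂ) * f s := by fun_prop
  have h1 : ∫ s in (0 : ℝ)..t, (Real.exp (c * s) : ℂ) * f (t₀ + s) =
      (Real.exp (-(c * t₀)) : ℂ) * ∫ s in t₀..(t₀ + t), (Real.exp (c * s) : ℂ) * f s := by
    have e := intervalIntegral.integral_comp_add_left (a := 0) (b := t)
      (fun s => (Real.exp (c * s) : ℂ) * f s) t₀
    rw [add_zero] at e
    rw [← e, ← intervalIntegral.integral_const_mul]
    refine intervalIntegral.integral_congr fun s _ => ?_
    rw [← mul_assoc, ← Complex.ofReal_mul, ← Real.exp_add]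
    congr 3
    ring
  rw [h1, ← intervalIntegral.integral_add_adjacent_intervals (b := t₀)
    (hc.intervalIntegrable _ _) (hc.intervalIntegrable _ _)]
  have e2 : (Real.exp (-(c * (t₀ + t))) : ℂ) =
      (Real.exp (-(c * t)) : ℂ) * (Real.exp (-(c * t₀)) : ℂ) := by
    rw [← Complex.ofReal_mul, ← Real.exp_add]; congr 2; ring
  rw [e2]; ring

/-! ### The heat equation on the Fourier side -/

/-- The constant `4 π²`: the symbol of `-Δ` is `heatRate * |ξ|²`. -/
def heatRate : ℝ := 4 * Real.pi ^ 2

theorem heatRate_pos : 0 < heatRate := by unfold heatRate; positivity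

/-- Duhamel's formula for the heat equation with source, on the Fourier side. -/
def duhamel (a : Plane → ℂ) (F : ℝ → Plane → ℂ) (t : ℝ) (ξ : Plane) : ℂ :=
  scalarDuhamel (heatRate * ‖ξ‖ ^ 2) (a ξ) (fun s => F s ξ) t

theorem measurable_uncurry_of_caratheodory {F : ℝ → Plane → ℂ}
    (hc : ∀ ξ, Continuous fun s => F s ξ) (hm : ∀ s, Measurable (F s)) :
    Measurable (Function.uncurry F) :=
  measurable_uncurry_of_continuous_of_measurable hc hm

theorem measurable_duhamel {a : Plane → ℂ} (ha : Measurable a) {F : ℝ → Plane → ℂ}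
    (hc : ∀ ξ, Continuous fun s => F s ξ) (hm : ∀ s, Measurable (F s)) (t : ℝ) :
    Measurable (duhamel a F t) := by
  have hF : Measurable fun p : Plane × ℝ => F p.2 p.1 :=
    (measurable_uncurry_of_caratheodory hc hm).comp measurable_swap
  have hint (S : Set ℝ) : Measurable fun ξ : Plane =>
      ∫ s in S, (Real.exp (-(heatRate * ‖ξ‖ ^ 2 * (t - s))) : ℂ) * F s ξ := by
    refine (StronglyMeasurable.integral_prod_right' (f := fun p : Plane × ℝ =>
      (Real.exp (-(heatRate * ‖p.1‖ ^ 2 * (t - p.2))) : ℂ) * F p.2 p.1) ?_).measurable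
    exact ((Complex.measurable_ofReal.comp (by fun_prop)).mul hF).stronglyMeasurable
  unfold duhamel scalarDuhamel intervalIntegral
  exact Measurable.add (by fun_prop) ((hint _).sub (hint _))

theorem measurable_uncurry_duhamel {a : Plane → ℂ} (ha : Measurable a) {F : ℝ → Plane → ℂ}
    (hc : ∀ ξ, Continuous fun s => F s ξ) (hm : ∀ s, Measurable (F s)) :
    Measurable (Function.uncurry (duhamel a F)) :=
  measurable_uncurry_of_caratheodory
    (fun ξ => continuous_scalarDuhamel _ _ (hc ξ)) (measurable_duhamel ha hc hm)

theorem duhamel_add_eq (a : Plane → ℂ) (F : ℝ → Plane → ℂ) (t : ℝ) (ξ : Plane) :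
    duhamel a F t ξ = duhamel a 0 t ξ + duhamel 0 F t ξ := by
  simp [duhamel, scalarDuhamel]

theorem norm_duhamel_zero_le (a : Plane → ℂ) {t : ℝ} (ht : 0 ≤ t) (ξ : Plane) :
    ‖duhamel a 0 t ξ‖ ≤ ‖a ξ‖ := by
  simp only [duhamel, scalarDuhamel, Pi.zero_apply, mul_zero, intervalIntegral.integral_zero,
    add_zero, norm_mul, Complex.norm_real, Real.norm_eq_abs, Real.abs_exp]
  apply mul_le_of_le_one_left (norm_nonneg _)
  have := heatRate_pos
  rw [Real.exp_le_one_iff]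
  simp only [Left.neg_nonpos_iff]
  positivity

section Estimates

variable {F : ℝ → Plane → ℂ} {T : ℝ}

theorem lintegral_hsq_eq (r : ℤ) (hc : ∀ ξ, Continuous fun s => F s ξ)
    (hm : ∀ s, Measurable (F s)) (S : Set ℝ) :
    ∫⁻ s in S, hsq r (F s) =
      ∫⁻ ξ, ENNReal.ofReal (‖ξ‖ ^ r) * ∫⁻ s in S, ‖F s ξ‖ₑ ^ 2 := by
  have hF : Measurable fun p : ℝ × Plane => F p.1 p.2 := measurable_uncurry_of_caratheodory hc hm
  unfold hsq
  rw [lintegral_lintegral_swap]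
  · refine lintegral_congr fun ξ => ?_
    rw [lintegral_const_mul' _ _ ENNReal.ofReal_ne_top]
  · exact (((measurable_norm_zpow r).comp measurable_snd).mul (hF.enorm.pow_const 2)).aemeasurable

/-- A square-integrable majorant, uniform in time, of the Duhamel term. -/
theorem enorm_duhamel_sq_le (hc : ∀ ξ, Continuous fun s => F s ξ) {t : ℝ} (ht : t ∈ Icc 0 T)
    {ξ : Plane} (hξ : ξ ≠ 0) :
    ‖duhamel 0 F t ξ‖ₑ ^ 2 ≤ ENNReal.ofReal heatRate⁻¹ *
      (ENNReal.ofReal (‖ξ‖ ^ (-2 : ℤ)) * ∫⁻ s in Ioc 0 T, ‖F s ξ‖ₑ ^ 2) := by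
  have hξ' := norm_pos_iff.mpr hξ
  have hk := heatRate_pos
  refine (enorm_scalarDuhamel_sq_le (c := heatRate * ‖ξ‖ ^ 2) (by positivity) (hc ξ) ht.1).trans ?_
  rw [mul_inv, ENNReal.ofReal_mul (by positivity), mul_assoc]
  gcongr
  · exact le_of_eq (by rw [zpow_neg]; norm_cast)
  · exact ht.2

/-- A source in `L²(0, T; Ḣ⁻¹)` yields a solution of the heat equation in `L^∞(0, T; L²)`. -/
theorem hsq_zero_duhamel_le (hc : ∀ ξ, Continuous fun s => F s ξ) (hm : ∀ s, Measurable (F s))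
    {t : ℝ} (ht : t ∈ Icc 0 T) :
    hsq 0 (duhamel 0 F t) ≤
      ENNReal.ofReal heatRate⁻¹ * ∫⁻ s in Ioc 0 T, hsq (-2) (F s) := by
  rw [lintegral_hsq_eq _ hc hm, ← lintegral_const_mul' _ _ ENNReal.ofReal_ne_top]
  refine lintegral_mono_ae ?_
  filter_upwards [ae_ne_zero] with ξ hξ
  simpa using enorm_duhamel_sq_le hc ht hξ

/-- A source in `L²(0, T; Ḣ⁻¹)` yields a solution of the heat equation in `L²(0, T; Ḣ¹)`. -/
theorem lintegral_hsq_two_duhamel_le (hc : ∀ ξ, Continuous fun s => F s ξ)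
    (hm : ∀ s, Measurable (F s)) (hT : 0 ≤ T) :
    ∫⁻ t in Ioc 0 T, hsq 2 (duhamel 0 F t) ≤
      ENNReal.ofReal (heatRate ^ 2)⁻¹ * ∫⁻ s in Ioc 0 T, hsq (-2) (F s) := by
  have hk := heatRate_pos
  rw [lintegral_hsq_eq _ hc hm, lintegral_hsq_eq (F := duhamel 0 F) _
    (fun ξ => continuous_scalarDuhamel _ _ (hc ξ)) (measurable_duhamel measurable_zero hc hm),
    ← lintegral_const_mul' _ _ ENNReal.ofReal_ne_top]
  refine lintegral_mono_ae ?_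
  filter_upwards [ae_ne_zero] with ξ hξ
  have hξ' := norm_pos_iff.mpr hξ
  calc _ ≤ ENNReal.ofReal (‖ξ‖ ^ (2 : ℤ)) * (ENNReal.ofReal ((heatRate * ‖ξ‖ ^ 2) ^ 2)⁻¹ *
        ∫⁻ s in Ioc 0 T, ‖F s ξ‖ₑ ^ 2) := by
        gcongr
        exact lintegral_scalarDuhamel_sq_le (c := heatRate * ‖ξ‖ ^ 2) (by positivity) (hc ξ) hT
    _ = _ := by
        rw [← mul_assoc, ← mul_assoc, ← ENNReal.ofReal_mul (by positivity),
          ← ENNReal.ofReal_mul (by positivity)]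
        congr 2
        rw [zpow_neg]
        field_simp

/-- A source in `L²(0, T; Ḣ⁻¹)` yields a solution of the heat equation in `L⁴(0, T; Ḣ^{1/2})`, by
interpolation. -/
theorem lintegral_hsq_one_sq_duhamel_le (hc : ∀ ξ, Continuous fun s => F s ξ)
    (hm : ∀ s, Measurable (F s)) (hT : 0 ≤ T) :
    ∫⁻ t in Ioc 0 T, hsq 1 (duhamel 0 F t) ^ 2 ≤
      ENNReal.ofReal (heatRate ^ 3)⁻¹ * (∫⁻ s in Ioc 0 T, hsq (-2) (F s)) ^ 2 := by
  have hk := heatRate_pos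
  set Φ := ∫⁻ s in Ioc 0 T, hsq (-2) (F s) with hΦ
  calc ∫⁻ t in Ioc 0 T, hsq 1 (duhamel 0 F t) ^ 2
      ≤ ∫⁻ t in Ioc 0 T, ENNReal.ofReal heatRate⁻¹ * Φ * hsq 2 (duhamel 0 F t) := by
        refine setLIntegral_mono' measurableSet_Ioc fun t ht => ?_
        refine (hsq_one_sq_le (measurable_duhamel measurable_zero hc hm t).aemeasurable).trans ?_
        gcongr
        exact hsq_zero_duhamel_le hc hm ⟨ht.1.le, ht.2⟩
    _ = ENNReal.ofReal heatRate⁻¹ * Φ * ∫⁻ t in Ioc 0 T, hsq 2 (duhamel 0 F t) := by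
        rw [lintegral_const_mul]
        have := measurable_uncurry_duhamel (a := 0) measurable_zero hc hm
        have h2 : Measurable fun p : ℝ × Plane => duhamel 0 F p.1 p.2 := this
        exact Measurable.lintegral_prod_right' (f := fun p : ℝ × Plane =>
          ENNReal.ofReal (‖p.2‖ ^ (2 : ℤ)) * ‖duhamel 0 F p.1 p.2‖ₑ ^ 2)
          (((measurable_norm_zpow 2).comp measurable_snd).mul (h2.enorm.pow_const 2))
    _ ≤ ENNReal.ofReal heatRate⁻¹ * Φ * (ENNReal.ofReal (heatRate ^ 2)⁻¹ * Φ) := by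
        gcongr; exact lintegral_hsq_two_duhamel_le hc hm hT
    _ = ENNReal.ofReal heatRate⁻¹ * ENNReal.ofReal (heatRate ^ 2)⁻¹ * Φ ^ 2 := by ring
    _ = _ := by
        rw [← ENNReal.ofReal_mul (by positivity)]
        congr 2
        rw [← mul_inv]; ring

/-- A source in `L²(0, T; Ḣ⁻¹)` yields a solution of the heat equation in `C([0, T]; L²)`: the
Duhamel formula is continuous in time at every frequency and has a square-integrable majorant. -/
theorem exists_continuous_duhamel (h₀ : L2C) (hc : ∀ ξ, Continuous fun s => F s ξ)
    (hm : ∀ s, Measurable (F s)) (hT : 0 ≤ T) (hΦ : ∫⁻ s in Ioc 0 T, hsq (-2) (F s) ≠ ∞) :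
    ∃ G : ℝ → L2C, Continuous G ∧ ∀ t ∈ Icc 0 T, G t =ᵐ[volume] duhamel h₀ F t := by
  have hk := heatRate_pos
  have hmd := measurable_duhamel (measurable_coe h₀) hc hm
  let B (ξ : Plane) : ℝ≥0∞ := 2 * ‖h₀ ξ‖ₑ ^ 2 + 2 * (ENNReal.ofReal heatRate⁻¹ *
      (ENNReal.ofReal (‖ξ‖ ^ (-2 : ℤ)) * ∫⁻ s in Ioc 0 T, ‖F s ξ‖ₑ ^ 2))
  have hBm : Measurable fun ξ => 2 * ‖h₀ ξ‖ₑ ^ 2 :=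
    ((measurable_coe h₀).enorm.pow_const 2).const_mul 2
  have hB : ∫⁻ ξ, B ξ ≠ ∞ := by
    simp only [B]
    rw [lintegral_add_left hBm, lintegral_const_mul' _ _ (by simp),
      lintegral_const_mul' _ _ (by simp), lintegral_const_mul' _ _ ENNReal.ofReal_ne_top,
      ← lintegral_hsq_eq _ hc hm, ← enorm_sq_eq_lintegral]
    finiteness
  have hle (t : ℝ) (ht : t ∈ Icc 0 T) (ξ : Plane) (hξ : ξ ≠ 0) : ‖duhamel h₀ F t ξ‖ₑ ^ 2 ≤ B ξ := by
    rw [duhamel_add_eq]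
    refine (pow_le_pow_left' (enorm_add_le _ _) 2).trans ((ennreal_add_sq_le _ _).trans ?_)
    refine add_le_add (mul_le_mul' le_rfl (pow_le_pow_left' ?_ 2)) (mul_le_mul' le_rfl ?_)
    · exact enorm_le_iff_norm_le.mpr (norm_duhamel_zero_le _ ht.1 ξ)
    · exact enorm_duhamel_sq_le hc ht hξ
  have hmem (t : ℝ) (ht : t ∈ Icc 0 T) : MemLp (duhamel h₀ F t) 2 volume := by
    refine ⟨(hmd t).aestronglyMeasurable, ?_⟩
    rw [eLpNorm_lt_top_iff_lintegral_rpow_enorm_lt_top (by norm_num) (by norm_num)]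
    refine lt_of_le_of_lt ?_ hB.lt_top
    refine lintegral_mono_ae ?_
    filter_upwards [ae_ne_zero] with ξ hξ
    simpa using hle t ht ξ hξ
  let τ (t : ℝ) : ℝ := projIcc 0 T hT t
  have hτ (t : ℝ) : τ t ∈ Icc 0 T := (projIcc 0 T hT t).2
  have hτc : Continuous τ := continuous_subtype_val.comp continuous_projIcc
  refine ⟨fun t => (hmem (τ t) (hτ t)).toLp _, ?_, fun t ht => ?_⟩
  · rw [continuous_iff_continuousAt]
    intro t
    rw [ContinuousAt, Lp.tendsto_Lp_iff_tendsto_eLpNorm'']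
    have key : Filter.Tendsto (fun s => ∫⁻ ξ, ‖duhamel h₀ F (τ s) ξ - duhamel h₀ F (τ t) ξ‖ₑ ^ 2)
        (nhds t) (nhds (∫⁻ _ : Plane, 0)) := by
      refine tendsto_lintegral_filter_of_dominated_convergence (fun ξ => 2 * B ξ + 2 * B ξ)
        (Filter.Eventually.of_forall fun s => ((hmd _).sub (hmd _)).enorm.pow_const 2)
        (Filter.Eventually.of_forall fun s => ?_) ?_ ?_
      · filter_upwards [ae_ne_zero] with ξ hξ
        refine (pow_le_pow_left' enorm_sub_le 2).trans ((ennreal_add_sq_le _ _).trans ?_)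
        gcongr
        · exact hle _ (hτ s) ξ hξ
        · exact hle _ (hτ t) ξ hξ
      · have e : (fun ξ => 2 * B ξ + 2 * B ξ) = fun ξ => 4 * B ξ := by ext ξ; ring
        rw [e, lintegral_const_mul' _ _ (by simp)]
        finiteness
      · refine Filter.Eventually.of_forall fun ξ => ?_
        have h1 : Continuous fun s => ‖duhamel h₀ F (τ s) ξ - duhamel h₀ F (τ t) ξ‖ₑ ^ 2 := by
          have h2 : Continuous fun s => duhamel h₀ F (τ s) ξ :=
            (continuous_scalarDuhamel _ _ (hc ξ)).comp hτc
          exact (ENNReal.continuous_pow 2).comp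
            (continuous_enorm.comp (h2.sub continuous_const))
        simpa using h1.tendsto t
    rw [lintegral_zero] at key
    have := (ENNReal.continuous_rpow_const (y := 1 / 2)).tendsto 0 |>.comp key
    rw [ENNReal.zero_rpow_of_pos (by norm_num)] at this
    refine this.congr fun s => ?_
    rw [eLpNorm_eq_lintegral_rpow_enorm_toReal (by norm_num) (by norm_num)]
    simp
  · refine (MemLp.coeFn_toLp _).trans ?_
    simp [τ, projIcc_of_mem hT ht]

end Estimates

/-! ### Uniqueness -/

theorem measurable_hsq {F : ℝ → Plane → ℂ} (r : ℤ) (hc : ∀ ξ, Continuous fun s => F s ξ)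
    (hm : ∀ s, Measurable (F s)) : Measurable fun s => hsq r (F s) := by
  have hF : Measurable fun p : ℝ × Plane => F p.1 p.2 := measurable_uncurry_of_caratheodory hc hm
  exact Measurable.lintegral_prod_right' (f := fun p : ℝ × Plane =>
    ENNReal.ofReal (‖p.2‖ ^ r) * ‖F p.1 p.2‖ₑ ^ 2)
    (((measurable_norm_zpow r).comp measurable_snd).mul (hF.enorm.pow_const 2))

/-- The part of the square of the `L²` norm carried by the frequencies above `N`. -/
def tailSq (N : ℝ) (a : Plane → ℂ) : ℝ≥0∞ := ∫⁻ η, {η : Plane | N < ‖η‖}.indicator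
  (fun η => ‖a η‖ₑ ^ 2) η

theorem measurableSet_lt_norm (N : ℝ) : MeasurableSet {η : Plane | N < ‖η‖} :=
  measurableSet_lt (by fun_prop) (by fun_prop)

theorem tendsto_tailSq (a : L2C) :
    Filter.Tendsto (fun n : ℕ => tailSq n a) Filter.atTop (nhds 0) := by
  have hfin : ∫⁻ η, ‖a η‖ₑ ^ 2 ≠ ∞ := by rw [← enorm_sq_eq_lintegral]; finiteness
  have := tendsto_lintegral_of_dominated_convergence (μ := (volume : Measure Plane))
    (F := fun n : ℕ => {η : Plane | (n : ℝ) < ‖η‖}.indicator (fun η => ‖a η‖ₑ ^ 2))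
    (f := fun _ => 0) (fun η => ‖a η‖ₑ ^ 2)
    (fun n => Measurable.indicator ((measurable_coe a).enorm.pow_const 2)
      (measurableSet_lt_norm _))
    (fun n => Filter.Eventually.of_forall fun η => indicator_le_self _ _ _) hfin
    (Filter.Eventually.of_forall fun η => ?_)
  · simpa [tailSq] using this
  · obtain ⟨N, hN⟩ := exists_nat_ge ‖η‖
    refine tendsto_const_nhds.congr' ?_
    filter_upwards [Filter.eventually_ge_atTop N] with n hn
    have : ‖η‖ ≤ n := hN.trans (by exact_mod_cast hn)
    simp [this]

theorem tailSq_anti {N M : ℝ} (h : N ≤ M) (a : Plane → ℂ) : tailSq M a ≤ tailSq N a :=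
  lintegral_mono fun η => indicator_le_indicator_of_subset
    (fun x (hx : M < ‖x‖) => lt_of_le_of_lt h hx) (by simp) η

theorem tailSq_le (N : ℝ) (a b : L2C) : tailSq N b ≤ 2 * tailSq N a + 2 * ‖b - a‖ₑ ^ 2 := by
  rw [enorm_sq_eq_lintegral, tailSq, tailSq, ← lintegral_const_mul' _ _ (by simp),
    ← lintegral_const_mul' _ _ (by simp), ← lintegral_add_left]
  · refine lintegral_mono_ae ?_
    filter_upwards [Lp.coeFn_sub b a] with η hη
    by_cases h : N < ‖η‖
    · simp only [mem_ofPred_eq, h, indicator_of_mem, hη, Pi.sub_apply]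
      refine le_trans ?_ (ennreal_add_sq_le _ _)
      gcongr
      simpa using enorm_add_le (a η) (b η - a η)
    · simp [h]
  · exact (Measurable.indicator ((measurable_coe a).enorm.pow_const 2)
      (measurableSet_lt_norm _)).const_mul 2

/-- A compact subset of `L²` has uniformly small tails at high frequency. -/
theorem exists_forall_tailSq_le {K : Set L2C} (hK : IsCompact K) {ε : ℝ≥0∞} (hε : 0 < ε) :
    ∃ N : ℕ, ∀ a ∈ K, tailSq N a ≤ ε := by
  refine hK.induction_on (p := fun S => ∃ N : ℕ, ∀ a ∈ S, tailSq N a ≤ ε) ⟨0, by simp⟩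
    (fun S S' hS ⟨N, hN⟩ => ⟨N, fun a ha => hN a (hS ha)⟩) ?_ fun a _ => ?_
  · rintro S S' ⟨N, hN⟩ ⟨M, hM⟩
    refine ⟨max N M, fun a ha => ?_⟩
    rcases ha with ha | ha
    · exact (tailSq_anti (by simp) a).trans (hN a ha)
    · exact (tailSq_anti (by simp) a).trans (hM a ha)
  · have h4 : 0 < ε / 4 := ENNReal.div_pos hε.ne' (by simp)
    obtain ⟨N, hN⟩ := ((tendsto_tailSq a).eventually (ge_mem_nhds h4)).exists
    have hcont : Continuous fun b : L2C => ‖b - a‖ₑ ^ 2 :=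
      (ENNReal.continuous_pow 2).comp (continuous_enorm.comp (continuous_id.sub continuous_const))
    have hev : ∀ᶠ b in nhds a, ‖b - a‖ₑ ^ 2 < ε / 4 := by
      refine hcont.continuousAt.eventually (gt_mem_nhds ?_)
      simpa using h4
    refine ⟨{b | ‖b - a‖ₑ ^ 2 < ε / 4}, nhdsWithin_le_nhds hev, N, fun b hb => ?_⟩
    calc tailSq N b ≤ 2 * tailSq N a + 2 * ‖b - a‖ₑ ^ 2 := tailSq_le _ _ _
      _ ≤ 2 * (ε / 4) + 2 * (ε / 4) := by
          gcongr
          exact le_of_lt hb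
      _ = ε := by
          rw [← two_mul, ← mul_assoc]
          norm_num
          exact ENNReal.mul_div_cancel (by simp) (by simp)

/-- The bilinear estimate behind uniqueness: at frequency `ξ`, the resolvent
`(heatRate |ξ|² + l)⁻¹` absorbs two derivatives for the high-frequency part of `p` and yields a
negative power of `l` for its low-frequency part. -/
theorem lintegral_resolvent_bilin_le (w p : L2C) {N l : ℝ} (hN : 0 ≤ N) (hl : 0 < l) :
    ∫⁻ ξ, ENNReal.ofReal (‖ξ‖ ^ (-1 : ℤ)) * (ENNReal.ofReal ((heatRate * ‖ξ‖ ^ 2 + l) ^ 2)⁻¹ *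
        ‖bilin w p ξ‖ₑ ^ 2) ≤
      (ENNReal.ofReal (2 * (heatRate ^ 2)⁻¹ * (16 * Real.pi ^ 3)) * tailSq N p +
        ENNReal.ofReal (2 * (heatRate * l)⁻¹ * (4 * Real.pi ^ 3 * N ^ 2)) * ‖p‖ₑ ^ 2) *
          hsq (-1) w := by
  have hk := heatRate_pos
  set S := {η : Plane | N < ‖η‖} with hS
  have hSm : MeasurableSet S := measurableSet_lt_norm N
  have hwm : Measurable fun η => ‖w η‖ₑ := (measurable_coe w).enorm
  have hpm : Measurable fun η => ‖p η‖ₑ := (measurable_coe p).enorm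
  set W : Plane → ℝ≥0∞ := fun η => ‖w η‖ₑ with hW
  set P₁ : Plane → ℝ≥0∞ := S.indicator fun η => ‖p η‖ₑ with hP₁
  set P₂ : Plane → ℝ≥0∞ := Sᶜ.indicator fun η => ‖p η‖ₑ with hP₂
  have hP₁m : Measurable P₁ := hpm.indicator hSm
  have hP₂m : Measurable P₂ := hpm.indicator hSm.compl
  have hmb (P : Plane → ℝ≥0∞) (hP : Measurable P) : Measurable (absBilin W P) :=
    Measurable.lintegral_prod_right' (f := fun q : Plane × Plane =>
      ‖kernel q.1 q.2‖ₑ * (W (q.1 - q.2) * P q.2))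
      (measurable_enorm_kernel.mul (by fun_prop))
  have hsplit (ξ : Plane) : ‖bilin w p ξ‖ₑ ^ 2 ≤
      2 * absBilin W P₁ ξ ^ 2 + 2 * absBilin W P₂ ξ ^ 2 := by
    refine (pow_le_pow_left' ?_ 2).trans (ennreal_add_sq_le _ _)
    refine (enorm_bilin_le_absBilin w p ξ).trans (le_of_eq ?_)
    unfold absBilin
    rw [← lintegral_add_left]
    · refine lintegral_congr fun η => ?_
      rw [← mul_add, ← mul_add]
      congr 2
      exact (congrFun (indicator_self_add_compl S fun η => ‖p η‖ₑ) η).symm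
    · exact (measurable_enorm_kernel.comp measurable_prodMk_left).mul (by fun_prop)
  have hP₁sq : ∫⁻ η, P₁ η ^ 2 = tailSq N p := by
    refine lintegral_congr fun η => ?_
    by_cases h : η ∈ S
    · simp only [hP₁, h, indicator_of_mem]; rw [indicator_of_mem]; exact h
    · simp only [hP₁, h, not_false_eq_true, indicator_of_notMem]; rw [indicator_of_notMem]
      · simp
      · exact h
  have hP₂sq : ∫⁻ η, P₂ η ^ 2 ≤ ‖p‖ₑ ^ 2 := by
    rw [enorm_sq_eq_lintegral]
    refine lintegral_mono fun η => ?_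
    gcongr
    exact indicator_le_self _ _ _
  calc ∫⁻ ξ, ENNReal.ofReal (‖ξ‖ ^ (-1 : ℤ)) *
        (ENNReal.ofReal ((heatRate * ‖ξ‖ ^ 2 + l) ^ 2)⁻¹ * ‖bilin w p ξ‖ₑ ^ 2)
      ≤ ∫⁻ ξ, (ENNReal.ofReal (2 * (heatRate ^ 2)⁻¹) *
            (ENNReal.ofReal (‖ξ‖ ^ (-5 : ℤ)) * absBilin W P₁ ξ ^ 2) +
          ENNReal.ofReal (2 * (heatRate * l)⁻¹) *
            (ENNReal.ofReal (‖ξ‖ ^ (-3 : ℤ)) * absBilin W P₂ ξ ^ 2)) := by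
        refine lintegral_mono_ae ?_
        filter_upwards [ae_ne_zero] with ξ hξ
        have hξ' := norm_pos_iff.mpr hξ
        grw [hsplit ξ]
        rw [mul_add, mul_add, ← mul_assoc, ← mul_assoc, ← mul_assoc, ← mul_assoc,
          ← mul_assoc, ← mul_assoc]
        have e2 (a b : ℝ) (ha : 0 ≤ a) (hb : 0 ≤ b) :
            ENNReal.ofReal a * ENNReal.ofReal b * 2 = ENNReal.ofReal (a * b * 2) := by
          rw [← ENNReal.ofReal_mul ha, ENNReal.ofReal_mul (p := a * b) (by positivity)]
          simp
        rw [e2 _ _ (by positivity) (by positivity), ← ENNReal.ofReal_mul (by positivity),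
          ← ENNReal.ofReal_mul (by positivity)]
        gcongr ?_ * _ + ?_ * _
        · apply ENNReal.ofReal_le_ofReal
          calc ‖ξ‖ ^ (-1 : ℤ) * ((heatRate * ‖ξ‖ ^ 2 + l) ^ 2)⁻¹ * 2
              ≤ ‖ξ‖ ^ (-1 : ℤ) * ((heatRate * ‖ξ‖ ^ 2) ^ 2)⁻¹ * 2 := by
                gcongr; linarith
            _ = _ := by
                rw [zpow_neg, zpow_neg]; field_simp
        · apply ENNReal.ofReal_le_ofReal
          calc ‖ξ‖ ^ (-1 : ℤ) * ((heatRate * ‖ξ‖ ^ 2 + l) ^ 2)⁻¹ * 2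
              ≤ ‖ξ‖ ^ (-1 : ℤ) * (heatRate * ‖ξ‖ ^ 2 * l)⁻¹ * 2 := by
                gcongr; nlinarith [sq_nonneg (heatRate * ‖ξ‖ ^ 2), mul_pos hk hl, sq_nonneg l,
                  mul_nonneg (mul_nonneg hk.le (sq_nonneg ‖ξ‖)) hl.le]
            _ = _ := by
                rw [zpow_neg, zpow_neg]; field_simp
    _ = ENNReal.ofReal (2 * (heatRate ^ 2)⁻¹) *
          (∫⁻ ξ, ENNReal.ofReal (‖ξ‖ ^ (-5 : ℤ)) * absBilin W P₁ ξ ^ 2) +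
        ENNReal.ofReal (2 * (heatRate * l)⁻¹) *
          ∫⁻ ξ, ENNReal.ofReal (‖ξ‖ ^ (-3 : ℤ)) * absBilin W P₂ ξ ^ 2 := by
        rw [lintegral_add_left, lintegral_const_mul' _ _ ENNReal.ofReal_ne_top,
          lintegral_const_mul' _ _ ENNReal.ofReal_ne_top]
        exact ((measurable_norm_zpow _).mul ((hmb P₁ hP₁m).pow_const 2)).const_mul _
    _ ≤ ENNReal.ofReal (2 * (heatRate ^ 2)⁻¹) *
          (ENNReal.ofReal (16 * Real.pi ^ 3) * tailSq N p * hsq (-1) w) +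
        ENNReal.ofReal (2 * (heatRate * l)⁻¹) *
          (ENNReal.ofReal (4 * Real.pi ^ 3 * N ^ 2) * ‖p‖ₑ ^ 2 * hsq (-1) w) := by
        gcongr
        · rw [← hP₁sq]
          exact absBilin_negative_order_le hwm hP₁m
        · refine (absBilin_negative_order_le_of_bandlimited hN hwm hP₂m fun η hη => ?_).trans ?_
          · have : η ∈ S := hη
            simp [hP₂, this]
          · gcongr
            exact le_of_eq rfl
    _ = _ := by
        rw [ENNReal.ofReal_mul (p := 2 * (heatRate ^ 2)⁻¹) (by positivity),
          ENNReal.ofReal_mul (p := 2 * (heatRate * l)⁻¹) (by positivity)]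
        ring

/-- `g` is a mild solution on `[0, T]` with initial datum `g₀`, on the Fourier side. -/
def IsFourierMild (T : ℝ) (g₀ : L2C) (g : ℝ → L2C) : Prop :=
  ContinuousOn g (Icc 0 T) ∧
    ∀ t ∈ Icc 0 T, g t =ᵐ[volume] duhamel g₀ (fun s => bilin (g s) (g s)) t

theorem IsFourierMild.apply_zero {T : ℝ} {g₀ : L2C} {g : ℝ → L2C} (h : IsFourierMild T g₀ g)
    (hT : 0 ≤ T) : g 0 = g₀ := by
  refine Lp.ext ((h.2 0 ⟨le_rfl, hT⟩).trans (Filter.Eventually.of_forall fun ξ => ?_))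
  simp [duhamel, scalarDuhamel_zero]

theorem duhamel_congr {a : Plane → ℂ} {F G : ℝ → Plane → ℂ} {t : ℝ} (ht : 0 ≤ t)
    (h : ∀ s ∈ Icc 0 t, F s = G s) : duhamel a F t = duhamel a G t := by
  ext ξ
  exact scalarDuhamel_congr ht fun s hs => by rw [h s hs]

/-- Every mild solution on `[0, T]` agrees there with one that is continuous on all of `ℝ`. -/
theorem IsFourierMild.exists_continuous {T : ℝ} (hT : 0 ≤ T) {g₀ : L2C} {g : ℝ → L2C}
    (h : IsFourierMild T g₀ g) :
    ∃ G : ℝ → L2C, Continuous G ∧ EqOn G g (Icc 0 T) ∧ IsFourierMild T g₀ G := by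
  have hG : Continuous (IccExtend hT ((Icc 0 T).domRestrict g)) :=
    (continuousOn_iff_continuous_domRestrict.mp h.1).Icc_extend'
  have he : EqOn (IccExtend hT ((Icc 0 T).domRestrict g)) g (Icc 0 T) := fun t ht => by
    simp [IccExtend_of_mem hT _ ht]
  refine ⟨_, hG, he, hG.continuousOn, fun t ht => ?_⟩
  rw [he ht]
  refine (h.2 t ht).trans (Filter.EventuallyEq.of_eq ?_)
  refine duhamel_congr ht.1 fun s hs => ?_
  rw [he ⟨hs.1, hs.2.trans ht.2⟩]

/-- A continuous curve in `L²` that satisfies the linear equation `w' = -heatRate |ξ|² w + bilin w p`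
with vanishing initial datum is zero. The norm of `L²(0, T; Ḣ^{-1/2})` with an exponential weight in
time shows this: `w` need not have more regularity than `L²`, so the estimate has to be made at
negative order, where the cancellation in the kernel is available. -/
theorem eq_zero_of_eq_duhamel_bilin {T : ℝ} (hT : 0 < T) {w p : ℝ → L2C} (hw : Continuous w)
    (hp : Continuous p)
    (h : ∀ t ∈ Icc 0 T, w t =ᵐ[volume] duhamel 0 (fun s => bilin (w s) (p s)) t) :
    ∀ t ∈ Icc 0 T, w t = 0 := by
  have hk := heatRate_pos
  -- uniform bounds on the compact time interval
  obtain ⟨M, hM⟩ : ∃ M : ℝ, ∀ s ∈ Icc 0 T, ‖p s‖ ≤ M ∧ ‖w s‖ ≤ M := by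
    obtain ⟨M₁, h₁⟩ := isCompact_Icc.exists_bound_of_continuousOn (hp.continuousOn (s := Icc 0 T))
    obtain ⟨M₂, h₂⟩ := isCompact_Icc.exists_bound_of_continuousOn (hw.continuousOn (s := Icc 0 T))
    exact ⟨max M₁ M₂, fun s hs => ⟨(h₁ s hs).trans (le_max_left _ _),
      (h₂ s hs).trans (le_max_right _ _)⟩⟩
  have hM0 : 0 ≤ M := (norm_nonneg _).trans (hM 0 ⟨le_rfl, hT.le⟩).1
  -- The cutoff `N` makes the high-frequency term of `lintegral_resolvent_bilin_le` at most `1/4`,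
  -- uniformly in time by compactness; then the weight `l` does the same to the low-frequency term.
  set c₁ := 2 * (heatRate ^ 2)⁻¹ * (16 * Real.pi ^ 3) with hc₁
  have hc₁0 : 0 < c₁ := by positivity
  obtain ⟨N, hN⟩ := exists_forall_tailSq_le (isCompact_Icc.image hp (s := Icc 0 T))
    (ε := ENNReal.ofReal (4 * c₁)⁻¹) (by simpa using hc₁0)
  set l : ℝ := 4 * (2 * heatRate⁻¹ * (4 * Real.pi ^ 3 * (N : ℝ) ^ 2)) * M ^ 2 + 1 with hl
  have hl0 : 0 < l := by positivity
  have hfix (s : ℝ) (hs : s ∈ Icc 0 T) (v : L2C) :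
      ∫⁻ ξ, ENNReal.ofReal (‖ξ‖ ^ (-1 : ℤ)) *
        (ENNReal.ofReal ((heatRate * ‖ξ‖ ^ 2 + l) ^ 2)⁻¹ * ‖bilin v (p s) ξ‖ₑ ^ 2) ≤
      ENNReal.ofReal (1 / 2) * hsq (-1) v := by
    refine (lintegral_resolvent_bilin_le v (p s) (Nat.cast_nonneg N) hl0).trans ?_
    gcongr
    have e1 : ENNReal.ofReal c₁ * tailSq N (p s) ≤ ENNReal.ofReal (1 / 4) := by
      grw [hN _ (mem_image_of_mem p hs)]
      rw [← ENNReal.ofReal_mul hc₁0.le]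
      apply ENNReal.ofReal_le_ofReal
      apply le_of_eq; field_simp
    have e2 : ENNReal.ofReal (2 * (heatRate * l)⁻¹ * (4 * Real.pi ^ 3 * (N : ℝ) ^ 2)) *
        ‖p s‖ₑ ^ 2 ≤ ENNReal.ofReal (1 / 4) := by
      rw [← ofReal_norm, ← ENNReal.ofReal_pow (norm_nonneg _),
        ← ENNReal.ofReal_mul (by positivity)]
      apply ENNReal.ofReal_le_ofReal
      calc _ ≤ 2 * (heatRate * l)⁻¹ * (4 * Real.pi ^ 3 * (N : ℝ) ^ 2) * M ^ 2 := by
            gcongr; exact (hM s hs).1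
        _ = (2 * heatRate⁻¹ * (4 * Real.pi ^ 3 * (N : ℝ) ^ 2) * M ^ 2) / l := by
            rw [mul_inv]; field_simp
        _ ≤ 1 / 4 := by
            rw [div_le_iff₀ hl0, hl]; linarith
    calc _ ≤ ENNReal.ofReal (1 / 4) + ENNReal.ofReal (1 / 4) := add_le_add e1 e2
      _ = _ := by rw [← ENNReal.ofReal_add (by norm_num) (by norm_num)]; norm_num
  -- the curve `w`, multiplied by a decaying exponential
  set W : ℝ → L2C := fun s => (Real.exp (-(l * s)) : ℂ) • w s with hW
  have hWc : Continuous W := by fun_prop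
  set F : ℝ → Plane → ℂ := fun s => bilin (W s) (p s) with hF
  have hFc (ξ : Plane) : Continuous fun s => F s ξ := continuous_bilin hWc hp ξ
  have hFm (s : ℝ) : Measurable (F s) := measurable_bilin (measurable_coe _) (measurable_coe _)
  set V : ℝ → Plane → ℂ := fun s ξ =>
    (Real.exp (-(l * s)) : ℂ) * duhamel 0 (fun s => bilin (w s) (p s)) s ξ with hV
  have hwc (ξ : Plane) : Continuous fun s => bilin (w s) (p s) ξ := continuous_bilin hw hp ξ
  have hwm (s : ℝ) : Measurable (bilin (w s) (p s)) :=
    measurable_bilin (measurable_coe _) (measurable_coe _)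
  have hVc (ξ : Plane) : Continuous fun s => V s ξ := by
    have := continuous_scalarDuhamel (heatRate * ‖ξ‖ ^ 2) 0 (hwc ξ)
    exact Continuous.mul (by fun_prop) this
  have hVm (s : ℝ) : Measurable (V s) :=
    (measurable_duhamel measurable_zero hwc hwm s).const_mul _
  have hVW (s : ℝ) (hs : s ∈ Icc 0 T) : (W s : Plane → ℂ) =ᵐ[volume] V s := by
    filter_upwards [Lp.coeFn_smul (Real.exp (-(l * s)) : ℂ) (w s), h s hs] with ξ h1 h2
    rw [hW]
    simp only [h1, Pi.smul_apply, h2, smul_eq_mul, hV]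
  have hVF (s : ℝ) (ξ : Plane) : V s ξ =
      scalarDuhamel (heatRate * ‖ξ‖ ^ 2 + l) 0 (fun s => F s ξ) s := by
    simp only [hV, duhamel, Pi.zero_apply]
    rw [← scalarDuhamel_smul_exp]
    congr with s
    simp only [hF, hW, ← bilinCLM_apply, map_smul, smul_apply, smul_eq_mul]
  -- `X` is finite and at most half of itself, so it vanishes
  set X := ∫⁻ s in Ioc 0 T, hsq (-1) (V s) with hX
  have hXX : X ≤ ENNReal.ofReal (1 / 2) * X := by
    calc X = ∫⁻ ξ, ENNReal.ofReal (‖ξ‖ ^ (-1 : ℤ)) * ∫⁻ s in Ioc 0 T, ‖V s ξ‖ₑ ^ 2 :=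
          lintegral_hsq_eq _ hVc hVm _
      _ ≤ ∫⁻ ξ, ENNReal.ofReal (‖ξ‖ ^ (-1 : ℤ)) *
          (ENNReal.ofReal ((heatRate * ‖ξ‖ ^ 2 + l) ^ 2)⁻¹ * ∫⁻ s in Ioc 0 T, ‖F s ξ‖ₑ ^ 2) := by
          refine lintegral_mono fun ξ => ?_
          gcongr
          simp only [hVF]
          exact lintegral_scalarDuhamel_sq_le (by positivity) (hFc ξ) hT.le
      _ = ∫⁻ s in Ioc 0 T, ∫⁻ ξ, ENNReal.ofReal (‖ξ‖ ^ (-1 : ℤ)) *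
          (ENNReal.ofReal ((heatRate * ‖ξ‖ ^ 2 + l) ^ 2)⁻¹ * ‖F s ξ‖ₑ ^ 2) := by
          have hFu : Measurable fun q : ℝ × Plane => F q.1 q.2 :=
            measurable_uncurry_of_caratheodory hFc hFm
          rw [lintegral_lintegral_swap]
          · refine lintegral_congr fun ξ => ?_
            rw [lintegral_const_mul' _ _ ENNReal.ofReal_ne_top,
              lintegral_const_mul' _ _ ENNReal.ofReal_ne_top]
          · refine Measurable.aemeasurable ?_
            exact ((measurable_norm_zpow _).comp measurable_snd).mul
              (Measurable.mul (by fun_prop) (hFu.enorm.pow_const 2))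
      _ ≤ ∫⁻ s in Ioc 0 T, ENNReal.ofReal (1 / 2) * hsq (-1) (V s) := by
          refine setLIntegral_mono' measurableSet_Ioc fun s hs => ?_
          have hs' : s ∈ Icc 0 T := ⟨hs.1.le, hs.2⟩
          rw [← hsq_congr (hVW s hs')]
          exact hfix s hs' (W s)
      _ = _ := lintegral_const_mul' _ _ ENNReal.ofReal_ne_top
  have hXfin : X ≠ ∞ := by
    -- at low frequency the Duhamel term is `O(|ξ|)`, which compensates the weight `|ξ|⁻¹`
    set A : ℝ := (T * (Real.pi * M * M)) ^ 2 with hA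
    have hlow (s : ℝ) (hs : s ∈ Icc 0 T) (ξ : Plane) :
        ‖duhamel 0 (fun s => bilin (w s) (p s)) s ξ‖ ≤ T * (Real.pi * M * M) * ‖ξ‖ := by
      simp only [duhamel, scalarDuhamel, Pi.zero_apply, mul_zero, zero_add]
      have hb : ∀ r ∈ uIoc 0 s, ‖(Real.exp (-(heatRate * ‖ξ‖ ^ 2 * (s - r))) : ℂ) *
          bilin (w r) (p r) ξ‖ ≤ Real.pi * ‖ξ‖ * M * M := by
        intro r hr
        rw [uIoc_of_le hs.1] at hr
        have hr' : r ∈ Icc 0 T := ⟨hr.1.le, hr.2.trans hs.2⟩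
        rw [norm_mul, Complex.norm_real, Real.norm_eq_abs, Real.abs_exp]
        have h1 : Real.exp (-(heatRate * ‖ξ‖ ^ 2 * (s - r))) ≤ 1 := by
          rw [Real.exp_le_one_iff, Left.neg_nonpos_iff]
          have := sub_nonneg.mpr hr.2
          positivity
        calc _ ≤ 1 * (Real.pi * ‖ξ‖ * ‖w r‖ * ‖p r‖) := by
              gcongr; exact norm_bilin_le _ _ _
          _ ≤ 1 * (Real.pi * ‖ξ‖ * M * M) := by
              gcongr
              · exact (hM r hr').2
              · exact (hM r hr').1
          _ = _ := one_mul _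
      refine (intervalIntegral.norm_integral_le_of_norm_le_const hb).trans ?_
      rw [sub_zero, abs_of_nonneg hs.1]
      calc Real.pi * ‖ξ‖ * M * M * s ≤ Real.pi * ‖ξ‖ * M * M * T := by gcongr; exact hs.2
        _ = _ := by ring
    have hbound (s : ℝ) (hs : s ∈ Icc 0 T) :
        hsq (-1) (V s) ≤ ENNReal.ofReal A * volume (Metric.closedBall (0 : Plane) 1) +
          ENNReal.ofReal (M ^ 2) := by
      have h2 : hsq (-1) (V s) ≤ ∫⁻ ξ, ((Metric.closedBall (0 : Plane) 1).indicator
          (fun _ => ENNReal.ofReal A) ξ + ‖w s ξ‖ₑ ^ 2) := by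
        refine lintegral_mono_ae ?_
        filter_upwards [ae_ne_zero, h s hs] with ξ hξ h3
        have hξ' := norm_pos_iff.mpr hξ
        have hVle : ‖V s ξ‖ ≤ ‖w s ξ‖ := by
          simp only [hV, norm_mul, Complex.norm_real, Real.norm_eq_abs, Real.abs_exp, ← h3]
          apply mul_le_of_le_one_left (norm_nonneg _)
          rw [Real.exp_le_one_iff, Left.neg_nonpos_iff]
          exact mul_nonneg hl0.le hs.1
        by_cases h1 : ‖ξ‖ ≤ 1
        · have hmem : ξ ∈ Metric.closedBall (0 : Plane) 1 := by simpa using h1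
          rw [indicator_of_mem hmem]
          refine le_add_right ?_
          rw [← ofReal_norm, ← ENNReal.ofReal_pow (norm_nonneg _),
            ← ENNReal.ofReal_mul (by positivity)]
          apply ENNReal.ofReal_le_ofReal
          have h4 : ‖V s ξ‖ ≤ T * (Real.pi * M * M) * ‖ξ‖ := by
            refine hVle.trans ?_
            rw [h3]; exact hlow s hs ξ
          calc ‖ξ‖ ^ (-1 : ℤ) * ‖V s ξ‖ ^ 2
              ≤ ‖ξ‖ ^ (-1 : ℤ) * (T * (Real.pi * M * M) * ‖ξ‖) ^ 2 := by gcongr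
            _ = A * ‖ξ‖ := by rw [hA, zpow_neg_one]; field_simp
            _ ≤ A := mul_le_of_le_one_right (by positivity) h1
        · refine le_add_left ?_
          rw [← ofReal_norm, ← ofReal_norm, ← ENNReal.ofReal_pow (norm_nonneg _),
            ← ENNReal.ofReal_pow (norm_nonneg _), ← ENNReal.ofReal_mul (by positivity)]
          apply ENNReal.ofReal_le_ofReal
          have h5 : ‖ξ‖ ^ (-1 : ℤ) ≤ 1 := by
            rw [zpow_neg_one]; exact inv_le_one_of_one_le₀ (not_le.mp h1).le
          calc ‖ξ‖ ^ (-1 : ℤ) * ‖V s ξ‖ ^ 2 ≤ 1 * ‖w s ξ‖ ^ 2 := by gcongr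
            _ = _ := one_mul _
      refine h2.trans ?_
      rw [lintegral_add_left (measurable_const.indicator measurableSet_closedBall),
        lintegral_indicator_const measurableSet_closedBall, ← enorm_sq_eq_lintegral]
      gcongr
      rw [← ofReal_norm, ← ENNReal.ofReal_pow (norm_nonneg _)]
      apply ENNReal.ofReal_le_ofReal
      gcongr
      exact (hM s hs).2
    refine ne_top_of_le_ne_top ?_ (setLIntegral_mono' measurableSet_Ioc
      fun s hs => hbound s ⟨hs.1.le, hs.2⟩)
    rw [setLIntegral_const]
    have := (measure_closedBall_lt_top (μ := volume) (x := (0 : Plane)) (r := 1)).ne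
    rw [Real.volume_Ioc]
    finiteness
  have hX0 : X = 0 := by
    by_contra hne
    have h1 : ENNReal.ofReal (1 / 2) * X < 1 * X :=
      ENNReal.mul_lt_mul_left hne hXfin (by simp)
    rw [one_mul] at h1
    exact absurd hXX (not_le.mpr h1)
  have hae : w =ᵐ[volume.restrict (Icc 0 T)] fun _ => 0 := by
    rw [← Measure.restrict_congr_set Ioc_ae_eq_Icc]
    have h1 := (lintegral_eq_zero_iff (measurable_hsq (-1) hVc hVm)).mp hX0
    have h2 := ae_restrict_mem (μ := volume) (measurableSet_Ioc (a := (0 : ℝ)) (b := T))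
    filter_upwards [h1, h2] with s hs1 hs2
    have hs' : s ∈ Icc 0 T := ⟨hs2.1.le, hs2.2⟩
    have hV0 : hsq (-1) (V s) = 0 := hs1
    have hV1 := (lintegral_eq_zero_iff (μ := volume)
      (f := fun ξ : Plane => ENNReal.ofReal (‖ξ‖ ^ (-1 : ℤ)) * ‖V s ξ‖ₑ ^ 2)
      ((measurable_norm_zpow _).mul ((hVm s).enorm.pow_const 2))).mp hV0
    refine Lp.ext ?_
    filter_upwards [hV1, ae_ne_zero, h s hs', Lp.coeFn_zero ℂ 2 (volume : Measure Plane)]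
      with ξ h3 h4 h5 h6
    have hξ' := norm_pos_iff.mpr h4
    have hpos : ENNReal.ofReal (‖ξ‖ ^ (-1 : ℤ)) ≠ 0 := by
      rw [ne_eq, ENNReal.ofReal_eq_zero, not_le]; positivity
    have h7 : V s ξ = 0 := by simpa [hpos, hξ'.ne', h4] using h3
    rw [h6, h5]
    simpa [hV, Real.exp_ne_zero] using h7
  intro t ht
  exact Measure.eqOn_Icc_of_ae_eq volume hT.ne hae hw.continuousOn continuousOn_const ht

/-- Mild solutions in `C([0, T]; L²)` are unique. -/
theorem IsFourierMild.unique {T : ℝ} {g₀ : L2C} {g g' : ℝ → L2C} (hT : 0 ≤ T)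
    (h : IsFourierMild T g₀ g) (h' : IsFourierMild T g₀ g') : EqOn g g' (Icc 0 T) := by
  rcases hT.eq_or_lt with rfl | hT'
  · intro t ht
    obtain rfl : t = 0 := le_antisymm ht.2 ht.1
    rw [h.apply_zero le_rfl, h'.apply_zero le_rfl]
  obtain ⟨G, hG, hGg, hGm⟩ := h.exists_continuous hT
  obtain ⟨G', hG', hGg', hGm'⟩ := h'.exists_continuous hT
  have key := eq_zero_of_eq_duhamel_bilin hT' (w := fun s => G s - G' s) (p := fun s => G s + G' s)
    (hG.sub hG') (hG.add hG') fun t ht => ?_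
  · intro t ht
    rw [← hGg ht, ← hGg' ht]
    exact sub_eq_zero.mp (key t ht)
  · filter_upwards [Lp.coeFn_sub (G t) (G' t), hGm.2 t ht, hGm'.2 t ht] with ξ h1 h2 h3
    rw [h1, Pi.sub_apply, h2, h3]
    unfold duhamel
    rw [scalarDuhamel_sub _ _ _ (continuous_bilin hG hG ξ) (continuous_bilin hG' hG' ξ)]
    simp only [bilin_self_sub_self, sub_self, Pi.zero_apply]

/-! ### Local existence -/

/-- The fourth power of the critical norm `L⁴(0, T; Ḣ^{1/2})`, on the Fourier side. -/
def critNorm (T : ℝ) (F : ℝ → Plane → ℂ) : ℝ≥0∞ := ∫⁻ t in Ioc 0 T, hsq 1 (F t) ^ 2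

theorem measurable_hsq_comp (r : ℕ) {g : ℝ → L2C} (hg : Continuous g) :
    Measurable fun s => hsq r (g s) :=
  ((lowerSemicontinuous_hsq r).comp hg).measurable

theorem critNorm_congr {T : ℝ} {F G : ℝ → Plane → ℂ}
    (h : ∀ t ∈ Ioc 0 T, F t =ᵐ[volume] G t) : critNorm T F = critNorm T G :=
  setLIntegral_congr_fun measurableSet_Ioc fun t ht => by simp only [hsq_congr (h t ht)]

theorem hsq_neg (r : ℤ) (b : Plane → ℂ) : hsq r (fun ξ => -b ξ) = hsq r b := by
  simp [hsq]

theorem hsq_one_add_sq_le {a b c : Plane → ℂ} (ha : Measurable a)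
    (hc : c =ᵐ[volume] fun ξ => a ξ + b ξ) :
    hsq 1 c ^ 2 ≤ 8 * hsq 1 a ^ 2 + 8 * hsq 1 b ^ 2 := by
  rw [hsq_congr hc]
  refine (pow_le_pow_left' (hsq_add_le 1 ha.aemeasurable) 2).trans ?_
  refine (ennreal_add_sq_le _ _).trans (le_of_eq ?_)
  ring

theorem critNorm_add_le {T : ℝ} {g h : ℝ → L2C} (hg : Continuous g) :
    critNorm T (fun t => ↑(g t + h t)) ≤
      8 * critNorm T (fun t => g t) + 8 * critNorm T (fun t => h t) := by
  unfold critNorm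
  rw [← lintegral_const_mul' _ _ (by simp), ← lintegral_const_mul' _ _ (by simp),
    ← lintegral_add_left]
  · refine lintegral_mono fun t => ?_
    exact hsq_one_add_sq_le (measurable_coe _) (Lp.coeFn_add (g t) (h t))
  · exact ((measurable_hsq_comp 1 hg).pow_const 2).const_mul 8

theorem critNorm_neg (T : ℝ) (g : ℝ → L2C) :
    critNorm T (fun t => ↑(-g t)) = critNorm T (fun t => g t) := by
  unfold critNorm
  refine lintegral_congr fun t => ?_
  rw [hsq_congr (Lp.coeFn_neg (g t))]
  exact congrArg (· ^ 2) (hsq_neg 1 _)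

/-- The constant of the bilinear estimate `Ḣ^{1/2} × Ḣ^{1/2} → Ḣ^{-1}`. -/
def bilinConst : ℝ := 8 * Real.pi ^ 3

theorem bilinConst_pos : 0 < bilinConst := by unfold bilinConst; positivity

/-- The bilinear estimate `L⁴ Ḣ^{1/2} × L⁴ Ḣ^{1/2} → L² Ḣ^{-1}`. -/
theorem sq_lintegral_hsq_bilin_le (T : ℝ) {u v : ℝ → L2C} (hu : Continuous u)
    (hv : Continuous v) :
    (∫⁻ s in Ioc 0 T, hsq (-2) (bilin (u s) (v s))) ^ 2 ≤
      ENNReal.ofReal (bilinConst ^ 2) * critNorm T (fun t => u t) * critNorm T (fun t => v t) := by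
  have h1 : ∫⁻ s in Ioc 0 T, hsq (-2) (bilin (u s) (v s)) ≤
      ENNReal.ofReal bilinConst * ∫⁻ s in Ioc 0 T, hsq 1 (u s) * hsq 1 (v s) := by
    rw [← lintegral_const_mul' _ _ ENNReal.ofReal_ne_top]
    refine lintegral_mono fun s => ?_
    rw [← mul_assoc]
    exact hsq_bilin_le (measurable_coe _) (measurable_coe _)
  refine (pow_le_pow_left' h1 2).trans ?_
  rw [mul_pow, mul_assoc, ENNReal.ofReal_pow bilinConst_pos.le]
  gcongr
  exact sq_lintegral_mul_le (measurable_hsq_comp 1 hu).aemeasurable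
    (measurable_hsq_comp 1 hv).aemeasurable

section Iteration

variable {T : ℝ} {u v : ℝ → L2C}

/-- The nonlinear term is bounded on `L⁴(0, T; Ḣ^{1/2})`, with a constant independent of `T`. -/
theorem critNorm_duhamel_bilin_le (hT : 0 ≤ T) (hu : Continuous u) (hv : Continuous v) :
    critNorm T (duhamel 0 fun s => bilin (u s) (v s)) ≤
      ENNReal.ofReal ((heatRate ^ 3)⁻¹ * bilinConst ^ 2) *
        critNorm T (fun t => u t) * critNorm T (fun t => v t) := by
  have hk := heatRate_pos
  refine (lintegral_hsq_one_sq_duhamel_le (F := fun s => bilin (u s) (v s))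
    (continuous_bilin hu hv) (fun s => measurable_bilin (measurable_coe _) (measurable_coe _))
    hT).trans ?_
  rw [ENNReal.ofReal_mul (by positivity), mul_assoc, mul_assoc, ← mul_assoc (ENNReal.ofReal _)]
  rw [mul_assoc (ENNReal.ofReal (heatRate ^ 3)⁻¹)]
  gcongr
  rw [← mul_assoc]
  exact sq_lintegral_hsq_bilin_le T hu hv

theorem hsq_zero_duhamel_bilin_sq_le (hu : Continuous u) (hv : Continuous v) {t : ℝ}
    (ht : t ∈ Icc 0 T) :
    hsq 0 (duhamel 0 (fun s => bilin (u s) (v s)) t) ^ 2 ≤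
      ENNReal.ofReal ((heatRate ^ 2)⁻¹ * bilinConst ^ 2) *
        critNorm T (fun t => u t) * critNorm T (fun t => v t) := by
  have hk := heatRate_pos
  refine (pow_le_pow_left' (hsq_zero_duhamel_le (F := fun s => bilin (u s) (v s))
    (continuous_bilin hu hv) (fun s => measurable_bilin (measurable_coe _) (measurable_coe _))
    ht) 2).trans ?_
  rw [mul_pow, ← ENNReal.ofReal_pow (by positivity), inv_pow, ENNReal.ofReal_mul (by positivity),
    mul_assoc, mul_assoc (ENNReal.ofReal (heatRate ^ 2)⁻¹)]
  gcongr
  rw [← mul_assoc]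
  exact sq_lintegral_hsq_bilin_le T hu hv

/-- One step of Picard's iteration. -/
theorem exists_picard_step (h₀ : L2C) (hT : 0 ≤ T) (hu : Continuous u)
    (hfin : critNorm T (fun t => u t) ≠ ∞) :
    ∃ G : ℝ → L2C, Continuous G ∧
      (∀ t ∈ Icc 0 T, G t =ᵐ[volume] duhamel h₀ (fun s => bilin (u s) (u s)) t) ∧
      critNorm T (fun t => G t) ≤ 8 * critNorm T (duhamel h₀ 0) +
        8 * (ENNReal.ofReal ((heatRate ^ 3)⁻¹ * bilinConst ^ 2) *
          critNorm T (fun t => u t) * critNorm T (fun t => u t)) := by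
  have hΦ : ∫⁻ s in Ioc 0 T, hsq (-2) (bilin (u s) (u s)) ≠ ∞ := by
    have h := sq_lintegral_hsq_bilin_le T hu hu
    have h2 : (∫⁻ s in Ioc 0 T, hsq (-2) (bilin (u s) (u s))) ^ 2 ≠ ∞ :=
      ne_top_of_le_ne_top (by finiteness) h
    simpa using h2
  have hc := continuous_bilin hu hu
  have hm : ∀ s, Measurable (bilin (u s) (u s)) := fun s =>
    measurable_bilin (measurable_coe _) (measurable_coe _)
  obtain ⟨G, hG, hGe⟩ := exists_continuous_duhamel h₀ hc hm hT hΦ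
  refine ⟨G, hG, hGe, ?_⟩
  have hmlin (t : ℝ) : Measurable (duhamel h₀ 0 t) :=
    measurable_duhamel (measurable_coe h₀) (fun ξ => continuous_const) (fun s => measurable_zero) t
  calc critNorm T (fun t => G t)
      ≤ ∫⁻ t in Ioc 0 T, (8 * hsq 1 (duhamel h₀ 0 t) ^ 2 +
          8 * hsq 1 (duhamel 0 (fun s => bilin (u s) (u s)) t) ^ 2) := by
        refine setLIntegral_mono' measurableSet_Ioc fun t ht => ?_
        refine hsq_one_add_sq_le (hmlin t) ((hGe t ⟨ht.1.le, ht.2⟩).trans ?_)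
        exact Filter.Eventually.of_forall fun ξ => duhamel_add_eq _ _ _ _
    _ = 8 * critNorm T (duhamel h₀ 0) +
          8 * critNorm T (duhamel 0 fun s => bilin (u s) (u s)) := by
        unfold critNorm
        rw [lintegral_add_left, lintegral_const_mul' _ _ (by simp),
          lintegral_const_mul' _ _ (by simp)]
        refine Measurable.const_mul (Measurable.pow_const ?_ 2) 8
        exact measurable_hsq 1 (fun ξ => continuous_scalarDuhamel _ _ continuous_const) hmlin
    _ ≤ _ := by
        gcongr
        exact critNorm_duhamel_bilin_le hT hu hu

end Iteration

/-- The smallness threshold for the linear evolution in Picard's iteration. With `ε` the threshold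
and `D` the constant of `critNorm_duhamel_bilin_le`, it is chosen such that `D * (256 * ε) = 1 / 16`:
the iteration maps the set `critNorm ≤ 16 * ε` into itself and contracts differences there by the
factor `1 / 16`. -/
def picardThreshold : ℝ := (4096 * ((heatRate ^ 3)⁻¹ * bilinConst ^ 2))⁻¹

theorem picardThreshold_pos : 0 < picardThreshold := by
  have := heatRate_pos
  have := bilinConst_pos
  unfold picardThreshold; positivity

/-- Local existence: there is a mild solution on `[0, T]` as soon as the linear evolution of the
initial datum is small in `L⁴(0, T; Ḣ^{1/2})`. -/
theorem exists_isFourierMild_of_critNorm_le {T : ℝ} (hT : 0 ≤ T) (h₀ : L2C)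
    (hlin : critNorm T (duhamel h₀ 0) ≤ ENNReal.ofReal picardThreshold) :
    ∃ g : ℝ → L2C, Continuous g ∧ IsFourierMild T h₀ g ∧ critNorm T (fun t => g t) ≠ ∞ := by
  have hk := heatRate_pos
  have hb := bilinConst_pos
  have hε := picardThreshold_pos
  set ε := picardThreshold with hεd
  set D := (heatRate ^ 3)⁻¹ * bilinConst ^ 2 with hD
  have hD0 : 0 < D := by positivity
  have hDε : D * (256 * ε) = 1 / 16 := by
    rw [hεd, picardThreshold, ← hD]; field_simp; norm_num
  let B := {g : ℝ → L2C // Continuous g ∧ critNorm T (fun t => g t) ≤ ENNReal.ofReal (16 * ε)}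
  have hstep (g : B) : ∃ g' : B, ∀ t ∈ Icc 0 T,
      g'.1 t =ᵐ[volume] duhamel h₀ (fun s => bilin (g.1 s) (g.1 s)) t := by
    obtain ⟨g, hg, hgB⟩ := g
    obtain ⟨G, hG, hGe, hGn⟩ := exists_picard_step h₀ hT hg (ne_top_of_le_ne_top ENNReal.ofReal_ne_top hgB)
    refine ⟨⟨G, hG, hGn.trans ?_⟩, hGe⟩
    grw [hlin, hgB]
    have e8 : (8 : ℝ≥0∞) = ENNReal.ofReal 8 := by simp
    rw [e8, ← ENNReal.ofReal_mul (by positivity), ← ENNReal.ofReal_mul (by positivity),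
      ← ENNReal.ofReal_mul (by positivity), ← ENNReal.ofReal_mul (by positivity),
      ← ENNReal.ofReal_add (by positivity) (by positivity)]
    apply ENNReal.ofReal_le_ofReal
    have : 8 * (D * (16 * ε) * (16 * ε)) = 8 * ε * (D * (256 * ε)) := by ring
    rw [this, hDε]
    linarith
  choose Ψ hΨ using hstep
  have hzero : critNorm T (fun _ => ((0 : L2C) : Plane → ℂ)) ≤ ENNReal.ofReal (16 * ε) := by
    have : hsq 1 ((0 : L2C) : Plane → ℂ) = 0 := by
      rw [hsq_congr (Lp.coeFn_zero ℂ 2 (volume : Measure Plane))]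
      simp [hsq]
    simp only [critNorm, this]
    simp
  let u (n : ℕ) : B := Ψ^[n] ⟨fun _ => 0, continuous_const, hzero⟩
  have hu (n : ℕ) : ∀ t ∈ Icc 0 T,
      (u (n + 1)).1 t =ᵐ[volume] duhamel h₀ (fun s => bilin ((u n).1 s) ((u n).1 s)) t := by
    have : u (n + 1) = Ψ (u n) := Function.iterate_succ_apply' Ψ n _
    rw [this]
    exact hΨ (u n)
  have huc (n : ℕ) : Continuous (u n).1 := (u n).2.1
  have hub (n : ℕ) : critNorm T (fun t => (u n).1 t) ≤ ENNReal.ofReal (16 * ε) := (u n).2.2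
  have e8 : (8 : ℝ≥0∞) = ENNReal.ofReal 8 := by simp
  have hsum (n : ℕ) : critNorm T (fun t => ↑((u (n + 1)).1 t + (u n).1 t)) ≤
      ENNReal.ofReal (256 * ε) := by
    refine (critNorm_add_le (huc (n + 1))).trans ?_
    grw [hub, hub]
    rw [e8, ← ENNReal.ofReal_mul (by positivity), ← ENNReal.ofReal_add (by positivity)
      (by positivity)]
    apply ENNReal.ofReal_le_ofReal
    linarith
  have hdiff₀ : critNorm T (fun t => ↑((u 1).1 t - (u 0).1 t)) ≤ ENNReal.ofReal (256 * ε) := by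
    simp only [sub_eq_add_neg]
    refine (critNorm_add_le (huc 1)).trans ?_
    rw [critNorm_neg]
    grw [hub, hub]
    rw [e8, ← ENNReal.ofReal_mul (by positivity), ← ENNReal.ofReal_add (by positivity)
      (by positivity)]
    apply ENNReal.ofReal_le_ofReal
    linarith
  -- the difference of two iterates solves a linear equation with small coefficient
  have hdiff (n : ℕ) : ∀ t ∈ Icc 0 T, ((u (n + 2)).1 t - (u (n + 1)).1 t : L2C) =ᵐ[volume]
      duhamel 0 (fun s => bilin ↑((u (n + 1)).1 s - (u n).1 s)
        ↑((u (n + 1)).1 s + (u n).1 s)) t := by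
    intro t ht
    filter_upwards [Lp.coeFn_sub ((u (n + 2)).1 t) ((u (n + 1)).1 t), hu (n + 1) t ht, hu n t ht]
      with ξ h1 h2 h3
    rw [h1, Pi.sub_apply, h2, h3]
    unfold duhamel
    rw [scalarDuhamel_sub _ _ _ (continuous_bilin (huc _) (huc _) ξ)
      (continuous_bilin (huc _) (huc _) ξ)]
    simp only [bilin_self_sub_self, sub_self, Pi.zero_apply]
  have hgeo (n : ℕ) : critNorm T (fun t => ↑((u (n + 1)).1 t - (u n).1 t)) ≤
      ENNReal.ofReal (256 * ε * (1 / 16) ^ n) := by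
    induction n with
    | zero => simpa using hdiff₀
    | succ n ih =>
      rw [critNorm_congr fun t ht => hdiff n t ⟨ht.1.le, ht.2⟩]
      refine (critNorm_duhamel_bilin_le (u := fun s => (u (n + 1)).1 s - (u n).1 s)
        (v := fun s => (u (n + 1)).1 s + (u n).1 s) hT ((huc _).sub (huc _)) ((huc _).add (huc _))).trans ?_
      grw [ih, hsum n]
      rw [← ENNReal.ofReal_mul (by positivity), ← ENNReal.ofReal_mul (by positivity)]
      apply ENNReal.ofReal_le_ofReal
      have : D * (256 * ε * (1 / 16) ^ n) * (256 * ε) =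
          256 * ε * (1 / 16) ^ n * (D * (256 * ε)) := by ring
      rw [← hD, this, hDε, pow_succ]
      linarith
  set M : ℝ := 1 + heatRate * (16 * ε) with hM
  have hM1 : 1 ≤ M := by rw [hM]; linarith [mul_pos hk (mul_pos (by norm_num : (0 : ℝ) < 16) hε)]
  have hsup (n : ℕ) : ∀ t ∈ Icc 0 T,
      ‖(u (n + 2)).1 t - (u (n + 1)).1 t‖ ≤ M * (1 / 2) ^ n := by
    intro t ht
    have h1 : ‖(u (n + 2)).1 t - (u (n + 1)).1 t‖ₑ ^ 4 ≤
        ENNReal.ofReal (heatRate * (16 * ε) * (1 / 16) ^ n) := by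
      rw [show (4 : ℕ) = 2 * 2 by norm_num, pow_mul, ← hsq_zero, hsq_congr (hdiff n t ht)]
      refine (hsq_zero_duhamel_bilin_sq_le (u := fun s => (u (n + 1)).1 s - (u n).1 s)
        (v := fun s => (u (n + 1)).1 s + (u n).1 s) ((huc _).sub (huc _)) ((huc _).add (huc _)) ht).trans ?_
      grw [hgeo n, hsum n]
      rw [← ENNReal.ofReal_mul (by positivity), ← ENNReal.ofReal_mul (by positivity)]
      apply ENNReal.ofReal_le_ofReal
      have : (heatRate ^ 2)⁻¹ * bilinConst ^ 2 * (256 * ε * (1 / 16) ^ n) * (256 * ε) =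
          heatRate * (256 * ε) * (1 / 16) ^ n * (D * (256 * ε)) := by
        rw [hD]; field_simp
      rw [this, hDε]
      apply le_of_eq; ring
    rw [← ofReal_norm, ← ENNReal.ofReal_pow (norm_nonneg _),
      ENNReal.ofReal_le_ofReal_iff (by positivity)] at h1
    refine le_of_pow_le_pow_left₀ (n := 4) (by norm_num) (by positivity) (h1.trans ?_)
    have e16 : ((1 / 2 : ℝ) ^ n) ^ 4 = (1 / 16) ^ n := by
      rw [← pow_mul, mul_comm, pow_mul]; norm_num
    rw [mul_pow, e16]
    gcongr
    calc heatRate * (16 * ε) ≤ M := by rw [hM]; linarith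
      _ ≤ M ^ 4 := le_self_pow₀ hM1 (by norm_num)
  -- Passage to the limit in `C([0, T]; L²)`. The sequence starts at the first iterate, since the
  -- estimates `hsup` compare iterates of index at least one.
  let f (n : ℕ) : C(Icc 0 T, L2C) := ⟨fun t => (u (n + 1)).1 t, (huc _).comp continuous_subtype_val⟩
  have hcau : CauchySeq f := by
    refine cauchySeq_of_le_geometric (1 / 2) M (by norm_num) fun n => ?_
    rw [dist_comm, ContinuousMap.dist_le (by positivity)]
    intro t
    rw [dist_eq_norm]
    exact hsup n t t.2
  obtain ⟨f₀, hf₀⟩ := cauchySeq_tendsto_of_complete hcau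
  set g : ℝ → L2C := IccExtend hT f₀ with hg
  have hgc : Continuous g := f₀.continuous.Icc_extend'
  have hlim (t : ℝ) (ht : t ∈ Icc 0 T) :
      Filter.Tendsto (fun n => (u (n + 1)).1 t) Filter.atTop (nhds (g t)) := by
    have h1 := ((continuous_eval_const (F := C(Icc 0 T, L2C)) (⟨t, ht⟩ : Icc 0 T)).tendsto f₀).comp hf₀
    rw [hg, IccExtend_of_mem hT _ ht]
    exact h1
  have hcrit : critNorm T (fun t => g t) ≤ ENNReal.ofReal (16 * ε) := by
    have hlsc : LowerSemicontinuous fun a : L2C => hsq 1 a ^ 2 :=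
      (ENNReal.continuous_pow 2).comp_lowerSemicontinuous (lowerSemicontinuous_hsq 1)
        fun a b hab => pow_le_pow_left' hab 2
    calc critNorm T (fun t => g t)
        ≤ ∫⁻ t in Ioc 0 T, Filter.liminf (fun n => hsq 1 ((u (n + 1)).1 t) ^ 2) Filter.atTop := by
          refine setLIntegral_mono' measurableSet_Ioc fun t ht => ?_
          refine (Filter.le_liminf_iff (by isBoundedDefault) (by isBoundedDefault)).mpr fun y hy => ?_
          exact (hlim t ⟨ht.1.le, ht.2⟩).eventually (hlsc (g t) y hy)
      _ ≤ Filter.liminf (fun n => critNorm T (fun t => (u (n + 1)).1 t)) Filter.atTop :=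
          lintegral_liminf_le fun n => (measurable_hsq_comp 1 (huc _)).pow_const 2
      _ ≤ _ := Filter.liminf_le_of_frequently_le'
          (Filter.Frequently.of_forall fun n => hub (n + 1))
  refine ⟨g, hgc, ⟨hgc.continuousOn, fun t ht => ?_⟩, ne_top_of_le_ne_top ENNReal.ofReal_ne_top hcrit⟩
  -- the iterates are bounded in `C([0, T]; L²)`
  obtain ⟨R, hR⟩ : ∃ R, ∀ n, ∀ s ∈ Icc 0 T, ‖(u (n + 1)).1 s‖ ≤ R := by
    obtain ⟨R, hR⟩ := (Metric.isBounded_range_of_tendsto f hf₀).exists_norm_le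
    exact ⟨R, fun n s hs => ((f n).norm_coe_le_norm ⟨s, hs⟩).trans (hR _ (mem_range_self n))⟩
  have hduh (ξ : Plane) : Filter.Tendsto
      (fun n => duhamel h₀ (fun s => bilin ((u (n + 1)).1 s) ((u (n + 1)).1 s)) t ξ) Filter.atTop
      (nhds (duhamel h₀ (fun s => bilin (g s) (g s)) t ξ)) := by
    unfold duhamel scalarDuhamel
    refine Filter.Tendsto.add tendsto_const_nhds ?_
    refine intervalIntegral.tendsto_integral_filter_of_dominated_convergence
      (fun _ => Real.pi * ‖ξ‖ * R * R) (Filter.Eventually.of_forall fun n => ?_)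
      (Filter.Eventually.of_forall fun n => Filter.Eventually.of_forall fun s hs => ?_)
      (by simp) (Filter.Eventually.of_forall fun s hs => ?_)
    · have := continuous_bilin (huc (n + 1)) (huc (n + 1)) ξ
      exact Continuous.aestronglyMeasurable (by fun_prop)
    · rw [uIoc_of_le ht.1] at hs
      have hs' : s ∈ Icc 0 T := ⟨hs.1.le, hs.2.trans ht.2⟩
      rw [norm_mul, Complex.norm_real, Real.norm_eq_abs, Real.abs_exp]
      have h1 : Real.exp (-(heatRate * ‖ξ‖ ^ 2 * (t - s))) ≤ 1 := by
        rw [Real.exp_le_one_iff, Left.neg_nonpos_iff]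
        have := sub_nonneg.mpr hs.2
        positivity
      have hR0 : 0 ≤ R := (norm_nonneg _).trans (hR 0 s hs')
      calc _ ≤ 1 * (Real.pi * ‖ξ‖ * ‖(u (n + 1)).1 s‖ * ‖(u (n + 1)).1 s‖) := by
            gcongr; exact norm_bilin_le _ _ _
        _ ≤ 1 * (Real.pi * ‖ξ‖ * R * R) := by
            gcongr
            · exact hR n s hs'
            · exact hR n s hs'
        _ = _ := one_mul _
    · rw [uIoc_of_le ht.1] at hs
      refine Filter.Tendsto.const_mul _ ?_
      have hl := hlim s ⟨hs.1.le, hs.2.trans ht.2⟩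
      have hcont : Continuous fun a : L2C => bilinCLM ξ a a := by fun_prop
      exact (hcont.tendsto (g s)).comp hl
  -- along a subsequence the iterates converge almost everywhere, so the limit solves the equation
  have hmeas := tendstoInMeasure_of_tendsto_Lp
    ((hlim t ht).comp (Filter.tendsto_add_atTop_nat 1))
  obtain ⟨ns, hns, hae⟩ := hmeas.exists_seq_tendsto_ae
  have hall : ∀ᵐ ξ, ∀ n, (u (n + 2)).1 t ξ =
      duhamel h₀ (fun s => bilin ((u (n + 1)).1 s) ((u (n + 1)).1 s)) t ξ :=
    ae_all_iff.mpr fun n => hu (n + 1) t ht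
  filter_upwards [hae, hall] with ξ h1 h2
  refine tendsto_nhds_unique h1 ?_
  refine ((hduh ξ).comp hns.tendsto_atTop).congr fun n => ?_
  exact (h2 (ns n)).symm

/-! ### The linear evolution -/

theorem lintegral_hsq_two_duhamel_zero_le (h₀ : L2C) {T : ℝ} (hT : 0 ≤ T) :
    ∫⁻ t in Ioc 0 T, hsq 2 (duhamel h₀ 0 t) ≤ ENNReal.ofReal (2 * heatRate)⁻¹ * ‖h₀‖ₑ ^ 2 := by
  have hk := heatRate_pos
  have hc (ξ : Plane) : Continuous fun t => duhamel h₀ 0 t ξ :=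
    continuous_scalarDuhamel _ _ continuous_const
  have hm (t : ℝ) : Measurable (duhamel h₀ 0 t) :=
    measurable_duhamel (measurable_coe h₀) (fun ξ => continuous_const) (fun s => measurable_zero) t
  rw [lintegral_hsq_eq _ hc hm, enorm_sq_eq_lintegral, ← lintegral_const_mul' _ _
    ENNReal.ofReal_ne_top]
  refine lintegral_mono_ae ?_
  filter_upwards [ae_ne_zero] with ξ hξ
  have hξ' := norm_pos_iff.mpr hξ
  rw [← ofReal_integral_norm_sq (hc ξ) hT, ← ENNReal.ofReal_mul (by positivity), ← ofReal_norm,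
    ← ENNReal.ofReal_pow (norm_nonneg _), ← ENNReal.ofReal_mul (by positivity)]
  apply ENNReal.ofReal_le_ofReal
  have h := scalarDuhamel_energy (heatRate * ‖ξ‖ ^ 2) (h₀ ξ) (f := fun _ => 0) continuous_const T
  simp only [mul_zero, Complex.zero_re, intervalIntegral.integral_zero, add_zero] at h
  have h2 : 2 * (heatRate * ‖ξ‖ ^ 2) * ∫ t in (0 : ℝ)..T, ‖duhamel h₀ 0 t ξ‖ ^ 2 ≤ ‖h₀ ξ‖ ^ 2 := by
    rw [← h]
    exact le_add_of_nonneg_left (by positivity)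
  rw [inv_mul_eq_div, le_div_iff₀ (by positivity)]
  calc _ = 2 * (heatRate * ‖ξ‖ ^ 2) * ∫ t in (0 : ℝ)..T, ‖duhamel h₀ 0 t ξ‖ ^ 2 := by
        norm_cast; ring
    _ ≤ _ := h2

theorem hsq_duhamel_zero_le (r : ℤ) (a : Plane → ℂ) {t : ℝ} (ht : 0 ≤ t) :
    hsq r (duhamel a 0 t) ≤ hsq r a := by
  refine lintegral_mono fun ξ => ?_
  gcongr
  exact enorm_le_iff_norm_le.mpr (norm_duhamel_zero_le a ht ξ)

/-- Local existence for arbitrary initial data in `L²`. -/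
theorem exists_local_isFourierMild (h₀ : L2C) : ∃ T : ℝ, 0 < T ∧ ∃ g : ℝ → L2C,
    Continuous g ∧ IsFourierMild T h₀ g ∧ critNorm T (fun t => g t) ≠ ∞ := by
  have hk := heatRate_pos
  have hm (t : ℝ) : Measurable (duhamel h₀ 0 t) :=
    measurable_duhamel (measurable_coe h₀) (fun ξ => continuous_const) (fun s => measurable_zero) t
  have hfin : ∫⁻ t in Ioc (0 : ℝ) 1, hsq 1 (duhamel h₀ 0 t) ^ 2 ≠ ∞ := by
    have h1 : ∫⁻ t in Ioc (0 : ℝ) 1, hsq 1 (duhamel h₀ 0 t) ^ 2 ≤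
        ‖h₀‖ₑ ^ 2 * ∫⁻ t in Ioc (0 : ℝ) 1, hsq 2 (duhamel h₀ 0 t) := by
      rw [← lintegral_const_mul' _ _ (by finiteness)]
      refine setLIntegral_mono' measurableSet_Ioc fun t ht => ?_
      refine (hsq_one_sq_le (hm t).aemeasurable).trans ?_
      gcongr
      rw [← hsq_zero]
      exact hsq_duhamel_zero_le 0 _ ht.1.le
    refine ne_top_of_le_ne_top ?_ (h1.trans (mul_le_mul' le_rfl
      (lintegral_hsq_two_duhamel_zero_le h₀ zero_le_one)))
    finiteness
  have hε : ENNReal.ofReal picardThreshold ≠ 0 := by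
    simpa using picardThreshold_pos
  obtain ⟨δ, hδ, hδ'⟩ := exists_pos_setLIntegral_lt_of_measure_lt hfin hε
  obtain ⟨T, hT, hTδ⟩ : ∃ T : ℝ, 0 < T ∧ T ≤ 1 ∧ ENNReal.ofReal T < δ := by
    obtain ⟨q, hq0, hq⟩ := ENNReal.lt_iff_exists_nnreal_btwn.mp hδ
    refine ⟨min q 1, ?_, min_le_right _ _, ?_⟩
    · simpa using hq0
    · refine lt_of_le_of_lt (ENNReal.ofReal_le_ofReal (min_le_left _ _)) ?_
      simpa using hq
  refine ⟨T, hT, exists_isFourierMild_of_critNorm_le hT.le h₀ (le_of_lt ?_)⟩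
  have := hδ' (Ioc 0 T) (lt_of_le_of_lt (Measure.restrict_apply_le _ _) (by simpa using hTδ.2))
  rwa [Measure.restrict_restrict_of_subset (Ioc_subset_Ioc_right hTδ.1)] at this

/-- For initial data in `Ḣ^{1/2}` the lifespan is bounded below in terms of the norm. -/
theorem exists_isFourierMild_of_hsq_le {T : ℝ} (hT : 0 ≤ T) (h₀ : L2C)
    (h : ENNReal.ofReal T * hsq 1 h₀ ^ 2 ≤ ENNReal.ofReal picardThreshold) :
    ∃ g : ℝ → L2C, Continuous g ∧ IsFourierMild T h₀ g ∧ critNorm T (fun t => g t) ≠ ∞ := by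
  refine exists_isFourierMild_of_critNorm_le hT h₀ (le_trans ?_ h)
  calc critNorm T (duhamel h₀ 0) ≤ ∫⁻ _ in Ioc 0 T, hsq 1 h₀ ^ 2 := by
        refine setLIntegral_mono' measurableSet_Ioc fun t ht => ?_
        gcongr
        exact hsq_duhamel_zero_le 1 _ ht.1.le
    _ = _ := by rw [setLIntegral_const, Real.volume_Ioc, sub_zero, mul_comm]

/-! ### Hermitian symmetry -/

theorem memLp_herm (a : L2C) : MemLp (fun ξ => starRingEnd ℂ (a (-ξ))) 2 (volume : Measure Plane) := by
  have h : MemLp (fun ξ => a (-ξ)) 2 (volume : Measure Plane) :=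
    (Lp.memLp a).comp_measurePreserving (Measure.measurePreserving_neg volume)
  exact h.star

/-- The involution `a ↦ conj (a (-ξ))` of `L²`. On the Fourier side, its fixed points correspond to
the real-valued functions. -/
def herm (a : L2C) : L2C := (memLp_herm a).toLp _

theorem coeFn_herm (a : L2C) : herm a =ᵐ[volume] fun ξ => starRingEnd ℂ (a (-ξ)) :=
  MemLp.coeFn_toLp _

theorem ae_eq_comp_neg {a b : Plane → ℂ} (h : a =ᵐ[volume] b) :
    (fun ξ => a (-ξ)) =ᵐ[volume] fun ξ => b (-ξ) :=
  (Measure.measurePreserving_neg volume).quasiMeasurePreserving.ae_eq_comp h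

theorem herm_sub (a b : L2C) : herm (a - b) = herm a - herm b := by
  refine Lp.ext ?_
  filter_upwards [coeFn_herm (a - b), coeFn_herm a, coeFn_herm b, Lp.coeFn_sub (herm a) (herm b),
    ae_eq_comp_neg (Lp.coeFn_sub a b)] with ξ h1 h2 h3 h4 h5
  rw [h1, h4, Pi.sub_apply, h2, h3, h5, Pi.sub_apply, map_sub]

theorem enorm_herm (a : L2C) : ‖herm a‖ₑ = ‖a‖ₑ := by
  have h : ‖herm a‖ₑ ^ 2 = ‖a‖ₑ ^ 2 := by
    rw [enorm_sq_eq_lintegral, enorm_sq_eq_lintegral,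
      ← lintegral_neg_eq_self (μ := volume) fun ξ => ‖a ξ‖ₑ ^ 2]
    refine lintegral_congr_ae ?_
    filter_upwards [coeFn_herm a] with ξ h1
    rw [h1, ← ofReal_norm, ← ofReal_norm, RCLike.norm_conj]
  exact (ENNReal.pow_right_strictMono (by norm_num)).injective h

theorem continuous_herm : Continuous herm := by
  refine Isometry.continuous fun a b => ?_
  rw [edist_eq_enorm_sub, edist_eq_enorm_sub, ← herm_sub, enorm_herm]

theorem bilin_herm (a b : L2C) (ξ : Plane) :
    bilin (herm a) (herm b) ξ = starRingEnd ℂ (bilin a b (-ξ)) := by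
  rw [bilin_congr (coeFn_herm a) (coeFn_herm b)]
  unfold bilin
  rw [← integral_conj, ← integral_neg_eq_self]
  refine integral_congr_ae (Filter.Eventually.of_forall fun η => ?_)
  simp only [map_mul, Complex.conj_ofReal]
  have h1 : kernel ξ (-η) = kernel (-ξ) η := by
    rw [← kernel_neg_neg ξ (-η), neg_neg]
  have h2 : -(ξ - -η) = -ξ - η := by abel
  rw [h1, h2, neg_neg]

theorem scalarDuhamel_conj (c : ℝ) (y : ℂ) (f : ℝ → ℂ) (t : ℝ) :
    scalarDuhamel c (starRingEnd ℂ y) (fun s => starRingEnd ℂ (f s)) t =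
      starRingEnd ℂ (scalarDuhamel c y f t) := by
  simp only [scalarDuhamel, map_add, map_mul, Complex.conj_ofReal,
    ← intervalIntegral.intervalIntegral_conj]

theorem IsFourierMild.herm {T : ℝ} {g₀ : L2C} {g : ℝ → L2C} (h : IsFourierMild T g₀ g) :
    IsFourierMild T (herm g₀) fun t => herm (g t) := by
  refine ⟨continuous_herm.comp_continuousOn h.1, fun t ht => ?_⟩
  filter_upwards [coeFn_herm (g t), ae_eq_comp_neg (h.2 t ht), coeFn_herm g₀] with ξ h1 h2 h3
  rw [h1, h2]
  simp only [duhamel, bilin_herm, h3, norm_neg]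
  rw [scalarDuhamel_conj]

/-- Solutions with Hermitian initial data are Hermitian, by uniqueness. -/
theorem IsFourierMild.herm_eq {T : ℝ} {g₀ : L2C} {g : ℝ → L2C} (hT : 0 ≤ T)
    (h : IsFourierMild T g₀ g) (h₀ : SQG.herm g₀ = g₀) {t : ℝ} (ht : t ∈ Icc 0 T) :
    SQG.herm (g t) = g t := by
  have h' := h.herm
  rw [h₀] at h'
  exact h'.unique hT h ht

/-! ### The energy identity -/

theorem abs_cross_mul_inv_norm_le (ξ η : Plane) : |cross ξ η * ‖η‖⁻¹| ≤ ‖ξ‖ := by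
  rw [abs_mul, abs_of_nonneg (inv_nonneg.mpr (norm_nonneg η))]
  rcases eq_or_ne η 0 with rfl | hη
  · simp
  rw [mul_inv_le_iff₀ (norm_pos_iff.mpr hη)]
  exact abs_cross_le ξ η

theorem measurable_cross_mul_inv_norm :
    Measurable fun p : Plane × Plane => cross p.1 p.2 * ‖p.2‖⁻¹ := by
  have h : Measurable fun p : Plane × Plane => cross p.1 p.2 := measurable_cross
  fun_prop

theorem integrable_unsymmetrised (a b : L2C) (ξ : Plane) :
    Integrable fun η => ((cross ξ η * ‖η‖⁻¹ : ℝ) : ℂ) * (a (ξ - η) * b η) := by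
  refine (integrable_mul_comp_sub a b ξ).bdd_mul (c := ‖ξ‖) ?_
    (Filter.Eventually.of_forall fun η => ?_)
  · have : Measurable fun η : Plane => cross ξ η * ‖η‖⁻¹ :=
      measurable_cross_mul_inv_norm.comp measurable_prodMk_left
    exact (Complex.measurable_ofReal.comp this).aestronglyMeasurable
  · rw [Complex.norm_real]
    exact abs_cross_mul_inv_norm_le ξ η

/-- On the diagonal, the bilinear operator is given by the unsymmetrised symbol
`2 π (ξ · η^⊥) / |η|` of `-∇ · (u θ)`. -/
theorem bilin_self_eq (a : L2C) (ξ : Plane) :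
    bilin a a ξ = 2 * Real.pi * ∫ η, ((cross ξ η * ‖η‖⁻¹ : ℝ) : ℂ) * (a (ξ - η) * a η) := by
  set f : Plane → ℂ := fun η => ((cross ξ η * ‖η‖⁻¹ : ℝ) : ℂ) * (a (ξ - η) * a η) with hf
  have hi : Integrable f := integrable_unsymmetrised a a ξ
  have e (η : Plane) : (kernel ξ η : ℂ) * (a (ξ - η) * a η) =
      Real.pi * f η + Real.pi * f (ξ - η) := by
    simp only [hf, kernel, cross_sub_right, sub_sub_cancel]
    push_cast
    ring
  unfold bilin
  simp only [e]
  rw [integral_add (hi.const_mul _) ((hi.comp_sub_left ξ).const_mul _), integral_const_mul,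
    integral_const_mul, integral_sub_left_eq_self f volume ξ]
  ring

theorem hsq_one_ne_top {a : L2C} (h : hsq 2 a ≠ ∞) : hsq 1 a ≠ ∞ := by
  have h1 := hsq_one_sq_le (measurable_coe a).aemeasurable
  rw [hsq_zero] at h1
  have h2 : hsq 1 a ^ 2 ≠ ∞ := ne_top_of_le_ne_top (by finiteness) h1
  simpa using h2

/-- The trilinear form converges absolutely on `Ḣ¹`, which justifies the change of the order of
integration in `integral_conj_mul_bilin_self`. -/
theorem integrable_trilinear {a : L2C} (h : hsq 2 a ≠ ∞) :
    Integrable (fun p : Plane × Plane => starRingEnd ℂ (a p.1) *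
      (((cross p.1 p.2 * ‖p.2‖⁻¹ : ℝ) : ℂ) * (a (p.1 - p.2) * a p.2))) (volume.prod volume) := by
  have ham := measurable_coe a
  have hconv : Measurable fun ξ => ∫⁻ η, ‖a (ξ - η)‖ₑ * ‖a η‖ₑ :=
    Measurable.lintegral_prod_right' (f := fun p : Plane × Plane => ‖a (p.1 - p.2)‖ₑ * ‖a p.2‖ₑ)
      (by fun_prop)
  refine ⟨Measurable.aestronglyMeasurable ?_, ?_⟩
  · exact (Complex.continuous_conj.measurable.comp (ham.comp measurable_fst)).mul
      ((Complex.measurable_ofReal.comp measurable_cross_mul_inv_norm).mul (by fun_prop))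
  rw [hasFiniteIntegral_iff_enorm, lintegral_prod]
  · refine lt_of_le_of_lt (b := ∫⁻ ξ, (ENNReal.ofReal ‖ξ‖ * ‖a ξ‖ₑ) *
      ∫⁻ η, ‖a (ξ - η)‖ₑ * ‖a η‖ₑ) ?_ ?_
    · refine lintegral_mono fun ξ => ?_
      rw [← lintegral_const_mul' _ _ (by finiteness)]
      refine lintegral_mono fun η => ?_
      simp only [enorm_mul]
      have h1 : ‖starRingEnd ℂ (a ξ)‖ₑ = ‖a ξ‖ₑ := by
        rw [← ofReal_norm, ← ofReal_norm, RCLike.norm_conj]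
      have h2 : ‖((cross ξ η * ‖η‖⁻¹ : ℝ) : ℂ)‖ₑ ≤ ENNReal.ofReal ‖ξ‖ := by
        rw [← ofReal_norm, Complex.norm_real]
        exact ENNReal.ofReal_le_ofReal (abs_cross_mul_inv_norm_le ξ η)
      calc _ ≤ ‖a ξ‖ₑ * (ENNReal.ofReal ‖ξ‖ * (‖a (ξ - η)‖ₑ * ‖a η‖ₑ)) := by
            rw [h1]; gcongr
        _ = _ := by ring
    · have h3 := sq_lintegral_mul_le (μ := volume)
        (f := fun ξ : Plane => ENNReal.ofReal ‖ξ‖ * ‖a ξ‖ₑ)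
        (g := fun ξ => ∫⁻ η, ‖a (ξ - η)‖ₑ * ‖a η‖ₑ) (by fun_prop) hconv.aemeasurable
      have h4 : ∫⁻ ξ, (ENNReal.ofReal ‖ξ‖ * ‖a ξ‖ₑ) ^ 2 = hsq 2 a := by
        refine lintegral_congr fun ξ => ?_
        rw [mul_pow, ← ENNReal.ofReal_pow (norm_nonneg _)]
        norm_cast
      have h5 := lintegral_conv_sq_le ham.enorm ham.enorm
      have h6 : ∫⁻ ζ, ENNReal.ofReal (‖ζ‖ ^ (1 : ℤ)) * ‖a ζ‖ₑ ^ 2 = hsq 1 a := rfl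
      rw [h6] at h5
      rw [h4] at h3
      have h7 := h3.trans (mul_le_mul' le_rfl h5)
      have h8 := hsq_one_ne_top h
      have h9 : (∫⁻ ξ, (ENNReal.ofReal ‖ξ‖ * ‖a ξ‖ₑ) * ∫⁻ η, ‖a (ξ - η)‖ₑ * ‖a η‖ₑ) ^ 2 ≠ ∞ :=
        ne_top_of_le_ne_top (by finiteness) h7
      exact lt_top_iff_ne_top.mpr (by simpa using h9)
  · refine Measurable.aemeasurable (Measurable.enorm ?_)
    exact (Complex.continuous_conj.measurable.comp (ham.comp measurable_fst)).mul
      ((Complex.measurable_ofReal.comp measurable_cross_mul_inv_norm).mul (by fun_prop))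

/-- The nonlinearity does no work: for real-valued `θ` the trilinear form `∫ (u · ∇θ) θ` vanishes,
by the antisymmetry of `ξ · η^⊥` under `ξ ↦ η - ξ`. -/
theorem integral_conj_mul_bilin_self {a : L2C} (h : hsq 2 a ≠ ∞) (ha : herm a = a) :
    ∫ ξ, starRingEnd ℂ (a ξ) * bilin a a ξ = 0 := by
  have hherm : ∀ᵐ ξ, a (-ξ) = starRingEnd ℂ (a ξ) := by
    have h1 := coeFn_herm a
    rw [ha] at h1
    filter_upwards [h1] with ξ hξ
    rw [hξ, Complex.conj_conj]
  have hint := integrable_trilinear h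
  have e1 (ξ : Plane) : starRingEnd ℂ (a ξ) * bilin a a ξ = 2 * Real.pi *
      ∫ η, starRingEnd ℂ (a ξ) * (((cross ξ η * ‖η‖⁻¹ : ℝ) : ℂ) * (a (ξ - η) * a η)) := by
    rw [bilin_self_eq, integral_const_mul]; ring
  simp only [e1]
  rw [integral_const_mul, integral_integral_swap hint]
  have e2 (η : Plane) : ∫ ξ, starRingEnd ℂ (a ξ) *
      (((cross ξ η * ‖η‖⁻¹ : ℝ) : ℂ) * (a (ξ - η) * a η)) = 0 := by
    set J := ∫ ξ, starRingEnd ℂ (a ξ) *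
      (((cross ξ η * ‖η‖⁻¹ : ℝ) : ℂ) * (a (ξ - η) * a η)) with hJ
    have hneg : J = -J := by
      conv_lhs => rw [hJ, ← integral_sub_left_eq_self _ volume η]
      rw [hJ, ← integral_neg]
      refine integral_congr_ae ?_
      have h2 : ∀ᵐ ξ, a (-(ξ - η)) = starRingEnd ℂ (a (ξ - η)) :=
        (measurePreserving_sub_right volume η).quasiMeasurePreserving.ae hherm
      filter_upwards [hherm, h2] with ξ h3 h4
      have e3 : η - ξ - η = -ξ := by abel
      have e4 : η - ξ = -(ξ - η) := by abel
      have e5 : cross (η - ξ) η = -cross ξ η := by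
        simp only [cross, PiLp.sub_apply]; ring
      rw [e3, e5, e4, h3, h4, Complex.conj_conj]
      push_cast
      ring
    exact self_eq_neg.mp hneg
  simp only [e2, integral_zero, mul_zero]

theorem lintegral_hsq_two_duhamel_ne_top (g₀ : L2C) {F : ℝ → Plane → ℂ} {t : ℝ} (ht : 0 ≤ t)
    (hFc : ∀ ξ, Continuous fun s => F s ξ) (hFm : ∀ s, Measurable (F s))
    (hΦ : ∫⁻ s in Ioc 0 t, hsq (-2) (F s) ≠ ∞) :
    ∫⁻ s in Ioc 0 t, hsq 2 (duhamel g₀ F s) ≠ ∞ := by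
  have h1 : ∫⁻ s in Ioc 0 t, hsq 2 (duhamel g₀ F s) ≤
      ∫⁻ s in Ioc 0 t, (2 * hsq 2 (duhamel g₀ 0 s) + 2 * hsq 2 (duhamel 0 F s)) := by
    refine lintegral_mono fun s => ?_
    have e : duhamel g₀ F s = fun ξ => duhamel g₀ 0 s ξ + duhamel 0 F s ξ :=
      funext fun ξ => duhamel_add_eq _ _ _ _
    rw [e]
    exact hsq_add_le 2 (measurable_duhamel (measurable_coe g₀) (fun ξ => continuous_const)
      (fun s => measurable_zero) s).aemeasurable
  refine ne_top_of_le_ne_top ?_ h1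
  rw [lintegral_add_left, lintegral_const_mul' _ _ (by simp), lintegral_const_mul' _ _ (by simp)]
  · have h2 := lintegral_hsq_two_duhamel_zero_le g₀ ht
    have h3 := lintegral_hsq_two_duhamel_le hFc hFm ht
    have h4 : ∫⁻ s in Ioc 0 t, hsq 2 (duhamel g₀ 0 s) ≠ ∞ :=
      ne_top_of_le_ne_top (by finiteness) h2
    have h5 : ∫⁻ s in Ioc 0 t, hsq 2 (duhamel 0 F s) ≠ ∞ :=
      ne_top_of_le_ne_top (by finiteness) h3
    finiteness
  · exact (measurable_hsq 2 (fun ξ => continuous_scalarDuhamel _ _ continuous_const)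
      fun s => measurable_duhamel (measurable_coe g₀) (fun ξ => continuous_const)
        (fun s => measurable_zero) s).const_mul 2

/-- The duality between `L²(0, t; Ḣ¹)` and `L²(0, t; Ḣ⁻¹)`. -/
theorem integrable_conj_mul {y F : ℝ → Plane → ℂ} {t : ℝ} (hyc : ∀ ξ, Continuous fun s => y s ξ)
    (hym : ∀ s, Measurable (y s)) (hFc : ∀ ξ, Continuous fun s => F s ξ)
    (hFm : ∀ s, Measurable (F s)) (hY : ∫⁻ s in Ioc 0 t, hsq 2 (y s) ≠ ∞)
    (hΦ : ∫⁻ s in Ioc 0 t, hsq (-2) (F s) ≠ ∞) :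
    Integrable (fun p : Plane × ℝ => starRingEnd ℂ (y p.2 p.1) * F p.2 p.1)
      (volume.prod (volume.restrict (Ioc 0 t))) := by
  have hFu : Measurable fun p : Plane × ℝ => F p.2 p.1 :=
    (measurable_uncurry_of_caratheodory hFc hFm).comp measurable_swap
  have hyu : Measurable fun p : Plane × ℝ => y p.2 p.1 :=
    (measurable_uncurry_of_caratheodory hyc hym).comp measurable_swap
  have hmeas : Measurable fun p : Plane × ℝ => starRingEnd ℂ (y p.2 p.1) * F p.2 p.1 :=
    (Complex.continuous_conj.measurable.comp hyu).mul hFu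
  refine ⟨hmeas.aestronglyMeasurable, ?_⟩
  rw [hasFiniteIntegral_iff_enorm]
  have e : ∫⁻ p : Plane × ℝ, ‖starRingEnd ℂ (y p.2 p.1) * F p.2 p.1‖ₑ
        ∂(volume.prod (volume.restrict (Ioc 0 t))) =
      ∫⁻ p : Plane × ℝ, (ENNReal.ofReal ‖p.1‖ * ‖y p.2 p.1‖ₑ) *
        (ENNReal.ofReal ‖p.1‖⁻¹ * ‖F p.2 p.1‖ₑ) ∂(volume.prod (volume.restrict (Ioc 0 t))) := by
    have h0 : ∀ᵐ p : Plane × ℝ ∂(volume.prod (volume.restrict (Ioc 0 t))), p.1 ≠ 0 :=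
      Measure.quasiMeasurePreserving_fst.ae ae_ne_zero
    refine lintegral_congr_ae ?_
    filter_upwards [h0] with p hp
    have hp' := norm_pos_iff.mpr hp
    have h1 : ENNReal.ofReal ‖p.1‖ * ENNReal.ofReal ‖p.1‖⁻¹ = 1 := by
      rw [← ENNReal.ofReal_mul (norm_nonneg _), mul_inv_cancel₀ hp'.ne', ENNReal.ofReal_one]
    have h2 : ‖starRingEnd ℂ (y p.2 p.1)‖ₑ = ‖y p.2 p.1‖ₑ := by
      rw [← ofReal_norm, ← ofReal_norm, RCLike.norm_conj]
    rw [enorm_mul, h2]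
    calc _ = (ENNReal.ofReal ‖p.1‖ * ENNReal.ofReal ‖p.1‖⁻¹) *
          (‖y p.2 p.1‖ₑ * ‖F p.2 p.1‖ₑ) := by rw [h1, one_mul]
      _ = _ := by ring
  rw [e]
  have h3 := sq_lintegral_mul_le (μ := volume.prod (volume.restrict (Ioc 0 t)))
    (f := fun p : Plane × ℝ => ENNReal.ofReal ‖p.1‖ * ‖y p.2 p.1‖ₑ)
    (g := fun p : Plane × ℝ => ENNReal.ofReal ‖p.1‖⁻¹ * ‖F p.2 p.1‖ₑ)
    (Measurable.aemeasurable (Measurable.mul (by fun_prop) hyu.enorm))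
    (Measurable.aemeasurable (Measurable.mul (by fun_prop) hFu.enorm))
  have h4 : ∫⁻ p : Plane × ℝ, (ENNReal.ofReal ‖p.1‖ * ‖y p.2 p.1‖ₑ) ^ 2
      ∂(volume.prod (volume.restrict (Ioc 0 t))) = ∫⁻ s in Ioc 0 t, hsq 2 (y s) := by
    rw [lintegral_hsq_eq 2 hyc hym, lintegral_prod]
    · refine lintegral_congr fun ξ => ?_
      rw [← lintegral_const_mul' _ _ ENNReal.ofReal_ne_top]
      refine lintegral_congr fun s => ?_
      rw [mul_pow, ← ENNReal.ofReal_pow (norm_nonneg _)]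
      norm_cast
    · exact ((Measurable.mul (by fun_prop) hyu.enorm).pow_const 2).aemeasurable
  have h5 : ∫⁻ p : Plane × ℝ, (ENNReal.ofReal ‖p.1‖⁻¹ * ‖F p.2 p.1‖ₑ) ^ 2
      ∂(volume.prod (volume.restrict (Ioc 0 t))) = ∫⁻ s in Ioc 0 t, hsq (-2) (F s) := by
    rw [lintegral_hsq_eq (-2) hFc hFm, lintegral_prod]
    · refine lintegral_congr fun ξ => ?_
      rw [← lintegral_const_mul' _ _ ENNReal.ofReal_ne_top]
      refine lintegral_congr fun s => ?_
      rw [mul_pow, ← ENNReal.ofReal_pow (by positivity), zpow_neg, inv_pow]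
      norm_cast
    · exact ((Measurable.mul (by fun_prop) hFu.enorm).pow_const 2).aemeasurable
  rw [h4, h5] at h3
  have h6 := ne_top_of_le_ne_top (by finiteness) h3
  exact lt_top_iff_ne_top.mpr (by simpa using h6)

section Energy

variable {T : ℝ} {g₀ : L2C} {g : ℝ → L2C}

/-- The energy identity for mild solutions in the class `L⁴(0, T; Ḣ^{1/2})`. -/
theorem IsFourierMild.energy (hg : Continuous g) (hm : IsFourierMild T g₀ g)
    (hcrit : critNorm T (fun t => g t) ≠ ∞) (h₀ : SQG.herm g₀ = g₀) {t : ℝ} (ht : t ∈ Icc 0 T) :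
    ‖g t‖ₑ ^ 2 + ENNReal.ofReal (2 * heatRate) * ∫⁻ s in Ioc 0 t, hsq 2 (g s) = ‖g₀‖ₑ ^ 2 := by
  have hk := heatRate_pos
  have hT : 0 ≤ T := ht.1.trans ht.2
  set F : ℝ → Plane → ℂ := fun s => bilin (g s) (g s) with hF
  have hFc (ξ : Plane) : Continuous fun s => F s ξ := continuous_bilin hg hg ξ
  have hFm (s : ℝ) : Measurable (F s) := measurable_bilin (measurable_coe _) (measurable_coe _)
  set y : ℝ → Plane → ℂ := duhamel g₀ F with hy
  have hyc (ξ : Plane) : Continuous fun s => y s ξ := continuous_scalarDuhamel _ _ (hFc ξ)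
  have hym (s : ℝ) : Measurable (y s) := measurable_duhamel (measurable_coe g₀) hFc hFm s
  have hyg (s : ℝ) (hs : s ∈ Ioc 0 t) : (g s : Plane → ℂ) =ᵐ[volume] y s :=
    hm.2 s ⟨hs.1.le, hs.2.trans ht.2⟩
  have hΦ : ∫⁻ s in Ioc 0 t, hsq (-2) (F s) ≠ ∞ := by
    have h := sq_lintegral_hsq_bilin_le T hg hg
    have h2 : (∫⁻ s in Ioc 0 T, hsq (-2) (F s)) ^ 2 ≠ ∞ :=
      ne_top_of_le_ne_top (by finiteness) h
    exact ne_top_of_le_ne_top (by simpa using h2)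
      (lintegral_mono_set (Ioc_subset_Ioc_right ht.2))
  have hY : ∫⁻ s in Ioc 0 t, hsq 2 (y s) ≠ ∞ :=
    lintegral_hsq_two_duhamel_ne_top g₀ ht.1 hFc hFm hΦ
  have hprod := integrable_conj_mul hyc hym hFc hFm hY hΦ
  set H : Plane → ℂ := fun ξ => ∫ s in (0 : ℝ)..t, starRingEnd ℂ (y s ξ) * F s ξ with hH
  have hHe (ξ : Plane) : H ξ = ∫ s in Ioc 0 t, starRingEnd ℂ (y s ξ) * F s ξ :=
    intervalIntegral.integral_of_le ht.1
  have hHint : Integrable H := by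
    rw [show H = fun ξ => ∫ s in Ioc 0 t, starRingEnd ℂ (y s ξ) * F s ξ from funext hHe]
    exact hprod.integral_prod_left
  have hH0 : ∫ ξ, H ξ = 0 := by
    simp only [hHe]
    rw [integral_integral_swap hprod]
    have h1 : ∀ᵐ s ∂(volume.restrict (Ioc 0 t)), hsq 2 (y s) < ∞ :=
      ae_lt_top (measurable_hsq 2 hyc hym) hY
    have h2 := ae_restrict_mem (μ := volume) (measurableSet_Ioc (a := (0 : ℝ)) (b := t))
    rw [integral_congr_ae (g := fun _ => (0 : ℂ)), integral_zero]
    filter_upwards [h1, h2] with s hs1 hs2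
    have hs : s ∈ Icc 0 T := ⟨hs2.1.le, hs2.2.trans ht.2⟩
    have hfin : hsq 2 (g s) ≠ ∞ := by
      rw [hsq_congr (hyg s hs2)]; exact hs1.ne
    rw [← integral_conj_mul_bilin_self hfin (hm.herm_eq hT h₀ hs)]
    refine integral_congr_ae ?_
    filter_upwards [hyg s hs2] with ξ hξ
    rw [hξ]
  -- integrate the scalar energy identity over all frequencies
  have hsc (ξ : Plane) : ‖y t ξ‖ ^ 2 + 2 * (heatRate * ‖ξ‖ ^ 2) *
      ∫ s in (0 : ℝ)..t, ‖y s ξ‖ ^ 2 = ‖g₀ ξ‖ ^ 2 + 2 * (H ξ).re := by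
    have h1 := scalarDuhamel_energy (heatRate * ‖ξ‖ ^ 2) (g₀ ξ) (hFc ξ) t
    have h2 : (H ξ).re = ∫ s in (0 : ℝ)..t, (starRingEnd ℂ (y s ξ) * F s ξ).re := by
      have hst : Continuous fun s => starRingEnd ℂ (y s ξ) * F s ξ :=
        (Complex.continuous_conj.comp (hyc ξ)).mul (hFc ξ)
      exact (Complex.reCLM.intervalIntegral_comp_comm (hst.intervalIntegrable 0 t)).symm
    rw [h2]
    exact h1
  have hg₀ : Integrable fun ξ => ‖g₀ ξ‖ ^ 2 := (Lp.memLp g₀).integrable_norm_pow (by norm_num)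
  have hreint : Integrable fun ξ => (H ξ).re := hHint.re
  have hre : ∫ ξ, (H ξ).re = 0 := by
    have h1 : ∫ ξ, (H ξ).re = (∫ ξ, H ξ).re := integral_re hHint
    rw [h1, hH0, Complex.zero_re]
  have hL : ∫⁻ ξ, ENNReal.ofReal (‖g₀ ξ‖ ^ 2 + 2 * (H ξ).re) = ‖g₀‖ₑ ^ 2 := by
    have hsum : Integrable fun ξ => ‖g₀ ξ‖ ^ 2 + 2 * (H ξ).re := hg₀.add (hreint.const_mul 2)
    rw [← ofReal_integral_eq_lintegral_ofReal hsum,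
      integral_add hg₀ (hreint.const_mul 2), integral_const_mul, hre, mul_zero, add_zero,
      ofReal_integral_eq_lintegral_ofReal hg₀, enorm_sq_eq_lintegral]
    · refine lintegral_congr fun ξ => ?_
      rw [ENNReal.ofReal_pow (norm_nonneg _), ofReal_norm]
    · exact Filter.Eventually.of_forall fun ξ => by positivity
    · refine Filter.Eventually.of_forall fun ξ => ?_
      change 0 ≤ ‖g₀ ξ‖ ^ 2 + 2 * (H ξ).re
      rw [← hsc]
      have : 0 ≤ ∫ s in (0 : ℝ)..t, ‖y s ξ‖ ^ 2 :=
        intervalIntegral.integral_nonneg ht.1 fun _ _ => by positivity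
      positivity
  rw [← hL]
  have hR (ξ : Plane) : ENNReal.ofReal (‖g₀ ξ‖ ^ 2 + 2 * (H ξ).re) = ‖y t ξ‖ₑ ^ 2 +
      ENNReal.ofReal (2 * heatRate) * (ENNReal.ofReal (‖ξ‖ ^ (2 : ℤ)) *
        ∫⁻ s in Ioc 0 t, ‖y s ξ‖ₑ ^ 2) := by
    have : 0 ≤ ∫ s in (0 : ℝ)..t, ‖y s ξ‖ ^ 2 :=
      intervalIntegral.integral_nonneg ht.1 fun _ _ => by positivity
    rw [← hsc, ENNReal.ofReal_add (by positivity) (by positivity), ENNReal.ofReal_pow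
      (norm_nonneg _), ofReal_norm, ← ofReal_integral_norm_sq (hyc ξ) ht.1,
      ← ENNReal.ofReal_mul (by positivity), ← ENNReal.ofReal_mul (by positivity)]
    congr 2
    norm_cast
    ring
  simp only [hR]
  rw [lintegral_add_left ((hym t).enorm.pow_const 2), lintegral_const_mul' _ _
    ENNReal.ofReal_ne_top, ← lintegral_hsq_eq 2 hyc hym, enorm_sq_eq_lintegral]
  congr 1
  · refine lintegral_congr_ae ?_
    filter_upwards [hm.2 t ht] with ξ hξ
    rw [hξ]
  · congr 1
    refine setLIntegral_congr_fun measurableSet_Ioc fun s hs => ?_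
    exact hsq_congr (hyg s hs)

/-- The energy identity bounds the critical norm independently of the length of the interval. -/
theorem IsFourierMild.critNorm_le (hT : 0 ≤ T) (hg : Continuous g) (hm : IsFourierMild T g₀ g)
    (hcrit : critNorm T (fun t => g t) ≠ ∞) (h₀ : SQG.herm g₀ = g₀) :
    ENNReal.ofReal (2 * heatRate) * critNorm T (fun t => g t) ≤ ‖g₀‖ₑ ^ 4 := by
  have hE := hm.energy (t := T) hg hcrit h₀ ⟨hT, le_rfl⟩
  calc ENNReal.ofReal (2 * heatRate) * critNorm T (fun t => g t)
      ≤ ENNReal.ofReal (2 * heatRate) * ∫⁻ s in Ioc 0 T, ‖g₀‖ₑ ^ 2 * hsq 2 (g s) := by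
        refine mul_le_mul_right ?_ _
        refine setLIntegral_mono' measurableSet_Ioc fun s (hs : s ∈ Ioc 0 T) => ?_
        refine (hsq_one_sq_le (measurable_coe _).aemeasurable).trans ?_
        gcongr
        rw [hsq_zero, ← hm.energy (t := s) hg hcrit h₀ ⟨hs.1.le, hs.2⟩]
        exact le_self_add
    _ = ‖g₀‖ₑ ^ 2 * (ENNReal.ofReal (2 * heatRate) * ∫⁻ s in Ioc 0 T, hsq 2 (g s)) := by
        rw [lintegral_const_mul' _ _ (by finiteness)]; ring
    _ ≤ ‖g₀‖ₑ ^ 2 * ‖g₀‖ₑ ^ 2 := by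
        gcongr
        rw [← hE]
        exact le_add_self
    _ = _ := by ring

end Energy

/-! ### Global existence -/

section Global

variable {T : ℝ} {g₀ : L2C} {g : ℝ → L2C}

theorem IsFourierMild.mono {T' : ℝ} (h : IsFourierMild T g₀ g) (hT : T' ≤ T) :
    IsFourierMild T' g₀ g :=
  ⟨h.1.mono (Icc_subset_Icc_right hT), fun t ht => h.2 t (Icc_subset_Icc_right hT ht)⟩

theorem IsFourierMild.congr {g' : ℝ → L2C} (h : IsFourierMild T g₀ g)
    (hg : EqOn g' g (Icc 0 T)) : IsFourierMild T g₀ g' := by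
  refine ⟨h.1.congr hg, fun t ht => ?_⟩
  rw [hg ht]
  refine (h.2 t ht).trans (Filter.Eventually.of_forall fun ξ => ?_)
  refine scalarDuhamel_congr ht.1 fun s hs => ?_
  simp only [hg ⟨hs.1, hs.2.trans ht.2⟩]

theorem critNorm_mono {T' : ℝ} (hT : T' ≤ T) (F : ℝ → Plane → ℂ) : critNorm T' F ≤ critNorm T F :=
  lintegral_mono_set (Ioc_subset_Ioc_right hT)

/-- A mild solution can be continued by a mild solution starting from its final value. -/
theorem IsFourierMild.exists_glue {t₀ τ : ℝ} {h : ℝ → L2C} (ht₀ : 0 ≤ t₀) (hτ : 0 ≤ τ)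
    (hg : Continuous g) (hgm : IsFourierMild t₀ g₀ g) (hgc : critNorm t₀ (fun t => g t) ≠ ∞)
    (hh : Continuous h) (hhm : IsFourierMild τ (g t₀) h) (hhc : critNorm τ (fun t => h t) ≠ ∞) :
    ∃ k : ℝ → L2C, Continuous k ∧ IsFourierMild (t₀ + τ) g₀ k ∧
      critNorm (t₀ + τ) (fun t => k t) ≠ ∞ := by
  set k : ℝ → L2C := fun t => if t ≤ t₀ then g t else h (t - t₀) with hk
  have hk1 {t : ℝ} (ht : t ≤ t₀) : k t = g t := if_pos ht
  have hk2 {t : ℝ} (ht : 0 ≤ t) : k (t₀ + t) = h t := by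
    rcases ht.eq_or_lt with rfl | ht'
    · rw [add_zero, hk1 le_rfl, hhm.apply_zero hτ]
    · simp only [hk]
      rw [if_neg (by linarith), add_sub_cancel_left]
  have hkc : Continuous k := by
    refine Continuous.if_le hg (hh.comp (continuous_id.sub continuous_const)) continuous_id
      continuous_const fun t ht => ?_
    simp only [ht, sub_self, hhm.apply_zero hτ]
  refine ⟨k, hkc, ⟨hkc.continuousOn, fun t ht => ?_⟩, ?_⟩
  · rcases le_total t t₀ with h1 | h1
    · rw [hk1 h1]
      refine (hgm.2 t ⟨ht.1, h1⟩).trans (Filter.Eventually.of_forall fun ξ => ?_)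
      refine scalarDuhamel_congr ht.1 fun s hs => ?_
      simp only [hk1 (hs.2.trans h1)]
    · obtain ⟨r, rfl⟩ : ∃ r, t = t₀ + r := ⟨t - t₀, by ring⟩
      have hr : 0 ≤ r := by linarith
      rw [hk2 hr]
      filter_upwards [hhm.2 r ⟨hr, by linarith [ht.2]⟩, hgm.2 t₀ ⟨ht₀, le_rfl⟩] with ξ h2 h3
      rw [h2]
      unfold duhamel at h3 ⊢
      have h4 : scalarDuhamel (heatRate * ‖ξ‖ ^ 2) (g₀ ξ) (fun s => bilin (k s) (k s) ξ) t₀ =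
          g t₀ ξ := by
        rw [h3]
        exact scalarDuhamel_congr ht₀ fun s hs => by simp only [hk1 hs.2]
      rw [scalarDuhamel_add _ _ (continuous_bilin hkc hkc ξ), h4]
      exact scalarDuhamel_congr hr fun s hs => by simp only [hk2 hs.1]
  · have hsplit : Ioc 0 (t₀ + τ) = Ioc 0 t₀ ∪ Ioc t₀ (t₀ + τ) :=
      (Ioc_union_Ioc_eq_Ioc ht₀ (by linarith)).symm
    have h1 : critNorm (t₀ + τ) (fun t => k t) ≤
        critNorm t₀ (fun t => g t) + critNorm τ (fun t => h t) := by
      unfold critNorm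
      rw [hsplit]
      refine (lintegral_union_le _ _ _).trans (le_of_eq ?_)
      congr 1
      · refine setLIntegral_congr_fun measurableSet_Ioc fun t ht => ?_
        simp only [hk1 ht.2]
      · have e := (measurePreserving_add_left volume t₀).setLIntegral_comp_preimage_emb
          (MeasurableEquiv.addLeft t₀).measurableEmbedding
          (fun t => hsq 1 (k t) ^ 2) (Ioc t₀ (t₀ + τ))
        rw [← e]
        simp only [preimage_const_add_Ioc, sub_self, add_sub_cancel_left]
        refine setLIntegral_congr_fun measurableSet_Ioc fun t ht => ?_
        simp only [hk2 ht.1.le]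
    exact ne_top_of_le_ne_top (by finiteness) h1

/-- The critical norm is finite only if the `Ḣ^{1/2}` norm at some time `t` is small enough for a
lifespan reaching beyond `T` by `δ`: otherwise its fourth power would be at least
`c / (T + δ - t)`, whose integral is large when `δ` is small. -/
theorem exists_hsq_le_of_critNorm_le {c M δ : ℝ} (hc : 0 < c) (hδ : 0 < δ) (hT : 0 ≤ T)
    (hM₀ : 0 ≤ M) {F : ℝ → Plane → ℂ} (hF : critNorm T F ≤ ENNReal.ofReal M)
    (hM : M < c * Real.log ((T + δ) / δ)) :
    ∃ t ∈ Ioc 0 T, ENNReal.ofReal (T + δ - t) * hsq 1 (F t) ^ 2 ≤ ENNReal.ofReal c := by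
  by_contra! hcon
  have h1 : ∫⁻ t in Ioc 0 T, ENNReal.ofReal (c * (T + δ - t)⁻¹) ≤ critNorm T F := by
    refine setLIntegral_mono' measurableSet_Ioc fun t ht => ?_
    have hpos : 0 < T + δ - t := by linarith [ht.2]
    rw [← div_eq_mul_inv, ENNReal.ofReal_div_of_pos hpos]
    refine ENNReal.div_le_of_le_mul ?_
    rw [mul_comm]
    exact (hcon t ht).le
  have hcont : ContinuousOn (fun t : ℝ => c * (T + δ - t)⁻¹) (Icc 0 T) := by
    refine continuousOn_const.mul (ContinuousOn.inv₀ (by fun_prop) fun t ht => ?_)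
    have : 0 < T + δ - t := by linarith [ht.2]
    exact this.ne'
  have hint : ∫ t in (0 : ℝ)..T, c * (T + δ - t)⁻¹ = c * Real.log ((T + δ) / δ) := by
    rw [intervalIntegral.integral_const_mul,
      intervalIntegral.integral_comp_sub_left (fun x => x⁻¹) (T + δ), sub_zero,
      add_sub_cancel_left, integral_inv_of_pos hδ (by linarith)]
  rw [← ofReal_integral_eq_lintegral_ofReal
    (hcont.integrableOn_Icc.mono_set Ioc_subset_Icc_self)
    ((ae_restrict_mem measurableSet_Ioc).mono fun t ht => ?_),
    ← intervalIntegral.integral_of_le hT, hint] at h1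
  · exact absurd ((ENNReal.ofReal_le_ofReal_iff hM₀).mp (h1.trans hF)) (not_le.mpr hM)
  · have hpos : 0 < T + δ - t := by linarith [ht.2]
    change 0 ≤ c * (T + δ - t)⁻¹
    positivity

/-- A solution that exists on a time interval of length at least `η` can be extended by a time
`δ` that depends only on `η` and on the size of the initial datum. -/
theorem exists_uniform_extension {η : ℝ} (hη : 0 < η) (h₀ : herm g₀ = g₀) :
    ∃ δ : ℝ, 0 < δ ∧ ∀ (T : ℝ) (g : ℝ → L2C), η ≤ T → Continuous g → IsFourierMild T g₀ g →
      critNorm T (fun t => g t) ≠ ∞ → ∃ g' : ℝ → L2C, Continuous g' ∧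
        IsFourierMild (T + δ) g₀ g' ∧ critNorm (T + δ) (fun t => g' t) ≠ ∞ := by
  have hk := heatRate_pos
  have hc := picardThreshold_pos
  set M : ℝ := ‖g₀‖ ^ 4 / (2 * heatRate) with hM
  set δ : ℝ := η * Real.exp (-(M / picardThreshold)) with hδ
  have hδ0 : 0 < δ := by positivity
  refine ⟨δ, hδ0, fun T g hT hg hm hcrit => ?_⟩
  have hT0 : 0 ≤ T := hη.le.trans hT
  have h1 : critNorm T (fun t => g t) ≤ ENNReal.ofReal M := by
    rw [hM, ENNReal.ofReal_div_of_pos (by positivity), ENNReal.le_div_iff_mul_le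
      (Or.inl (by simpa using hk)) (Or.inl ENNReal.ofReal_ne_top), mul_comm,
      ENNReal.ofReal_pow (norm_nonneg _), ofReal_norm]
    exact hm.critNorm_le hT0 hg hcrit h₀
  have h2 : M < picardThreshold * Real.log ((T + δ) / δ) := by
    rw [← div_lt_iff₀' hc, Real.lt_log_iff_exp_lt (by positivity), lt_div_iff₀ hδ0, hδ,
      mul_left_comm, ← Real.exp_add, add_neg_cancel, Real.exp_zero, mul_one, ← hδ]
    linarith
  obtain ⟨t, ht, hts⟩ := exists_hsq_le_of_critNorm_le hc hδ0 hT0 (by positivity) h1 h2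
  obtain ⟨h, hh, hhm, hhc⟩ := exists_isFourierMild_of_hsq_le
    (T := T + δ - t) (by linarith [ht.2]) (g t) hts
  have := (hm.mono ht.2).exists_glue ht.1.le (by linarith [ht.2]) hg
    (ne_top_of_le_ne_top hcrit (critNorm_mono ht.2 _)) hh hhm hhc
  rwa [add_sub_cancel] at this

/-- Global existence for initial data with Hermitian symmetry, that is, for the Fourier
transforms of real functions. -/
theorem exists_global_isFourierMild (h₀ : herm g₀ = g₀) :
    ∃ g : ℝ → L2C, ∀ T : ℝ, IsFourierMild T g₀ g := by
  obtain ⟨η, hη, g₁, hg₁, hm₁, hc₁⟩ := exists_local_isFourierMild g₀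
  obtain ⟨δ, hδ, hext⟩ := exists_uniform_extension hη h₀
  have hn (n : ℕ) : ∃ g : ℝ → L2C, Continuous g ∧ IsFourierMild (η + n * δ) g₀ g ∧
      critNorm (η + n * δ) (fun t => g t) ≠ ∞ := by
    induction n with
    | zero => exact ⟨g₁, hg₁, by simpa using hm₁, by simpa using hc₁⟩
    | succ n ih =>
      obtain ⟨g, hg, hm, hc⟩ := ih
      have := hext _ g (by nlinarith [n.cast_nonneg (α := ℝ)]) hg hm hc
      rwa [add_assoc, ← add_one_mul, ← Nat.cast_succ] at this
  have hT (T : ℝ) : ∃ g : ℝ → L2C, IsFourierMild T g₀ g := by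
    obtain ⟨n, hn'⟩ := exists_nat_ge (T / δ)
    obtain ⟨g, -, hm, -⟩ := hn n
    refine ⟨g, hm.mono ?_⟩
    rw [div_le_iff₀ hδ] at hn'
    linarith
  choose G hG using hT
  refine ⟨fun t => G t t, fun T => (hG T).congr fun t ht => ?_⟩
  exact (hG t).unique ht.1 ((hG T).mono ht.2) ⟨ht.1, le_rfl⟩

end Global

/-! ### The Fourier transform on `L²` -/

/-- The plane wave `x ↦ exp (2πi ξ · x)`. -/
def planeWave (ξ x : Plane) : ℂ := Complex.exp ((2 * Real.pi * inner ℝ ξ x : ℝ) * Complex.I)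

theorem norm_planeWave (ξ x : Plane) : ‖planeWave ξ x‖ = 1 :=
  Complex.norm_exp_ofReal_mul_I _

theorem conj_planeWave (ξ x : Plane) : starRingEnd ℂ (planeWave ξ x) = planeWave (-ξ) x := by
  simp only [planeWave]
  rw [← Complex.exp_conj, map_mul, Complex.conj_ofReal, Complex.conj_I]
  simp [inner_neg_left]

theorem planeWave_add (ξ η x : Plane) :
    planeWave (ξ + η) x = planeWave ξ x * planeWave η x := by
  simp only [planeWave, inner_add_left]
  rw [← Complex.exp_add]
  push_cast
  ring_nf

theorem continuous_planeWave (ξ : Plane) : Continuous (planeWave ξ) := by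
  unfold planeWave
  fun_prop

theorem fourier_eq_integral (f : Plane → ℂ) (ξ : Plane) :
    𝓕 f ξ = ∫ x, planeWave (-ξ) x * f x := by
  rw [Real.fourier_eq']
  refine integral_congr_ae (Filter.Eventually.of_forall fun x => ?_)
  simp only [planeWave, smul_eq_mul, inner_neg_left, real_inner_comm]
  ring_nf

theorem fourierInv_eq_integral (f : Plane → ℂ) (x : Plane) :
    𝓕⁻ f x = ∫ ξ, planeWave x ξ * f ξ := by
  rw [Real.fourierInv_eq_fourier_neg, fourier_eq_integral, neg_neg]

theorem integral_fourier_mul {f g : Plane → ℂ} (hf : Integrable f) (hg : Integrable g) :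
    ∫ ξ, 𝓕 f ξ * g ξ = ∫ x, f x * 𝓕 g x := by
  simpa using! VectorFourier.integral_bilin_fourierIntegral_eq_flip (.mul ℂ ℂ) (L := innerₗ Plane)
    Real.continuous_fourierChar continuous_inner hf hg

theorem integral_fourierInv_mul {f : Plane → ℂ} (hf : Integrable f) (φ : 𝓢(Plane, ℂ)) :
    ∫ x, 𝓕⁻ f x * φ x = ∫ ξ, f ξ * (𝓕⁻ φ) ξ := by
  have h := integral_fourier_mul hf.comp_neg φ.integrable
  rw [← Real.fourierInv_eq_fourier_comp_neg] at h
  rw [h, ← integral_neg_eq_self]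
  refine integral_congr_ae (Filter.Eventually.of_forall fun x => ?_)
  simp only [neg_neg]
  rw [SchwartzMap.fourierInv_coe, Real.fourierInv_eq_fourier_neg]

theorem continuous_fourier {f : Plane → ℂ} (hf : Integrable f) : Continuous (𝓕 f) :=
  VectorFourier.fourierIntegral_continuous Real.continuous_fourierChar
    (L := innerₗ Plane) continuous_inner hf

/-- The Fourier transform on `L²` is symmetric. -/
theorem integral_fourier_lp_mul (f : L2C) (φ : 𝓢(Plane, ℂ)) :
    ∫ ξ, (𝓕 f : L2C) ξ * φ ξ = ∫ x, f x * (𝓕 φ) x := by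
  have h := congrArg (fun T => T φ) (Lp.fourier_toTemperedDistribution_eq f)
  simp only [TemperedDistribution.fourier_apply, Lp.toTemperedDistribution_apply,
    smul_eq_mul] at h
  simp only [mul_comm _ (φ _), mul_comm _ ((𝓕 φ) _)]
  exact h.symm

/-- Parseval's identity for an `L²` function and a Schwartz function. -/
theorem integral_lp_mul (f : L2C) (φ : 𝓢(Plane, ℂ)) :
    ∫ x, f x * φ x = ∫ ξ, (𝓕 f : L2C) ξ * (𝓕⁻ φ) ξ := by
  rw [integral_fourier_lp_mul, FourierTransform.fourier_fourierInv_eq]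

theorem locallyIntegrable_lp (f : L2C) : LocallyIntegrable f volume :=
  (Lp.memLp f).locallyIntegrable (by norm_num)

/-- For integrable functions, the Fourier transform on `L²` is given by the Fourier integral. -/
theorem fourier_toLp_ae {f : Plane → ℂ} (h1 : Integrable f) (h2 : MemLp f 2) :
    (𝓕 (h2.toLp f) : L2C) =ᵐ[volume] 𝓕 f := by
  refine ae_eq_of_integral_contDiff_smul_eq (locallyIntegrable_lp _)
    (continuous_fourier h1).locallyIntegrable fun g hg hg' => ?_
  have hc : HasCompactSupport fun x => (g x : ℂ) := hg'.comp_left Complex.ofReal_zero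
  set φ : 𝓢(Plane, ℂ) := hc.toSchwartzMap (Complex.ofRealCLM.contDiff.comp hg)
  have hφ (x : Plane) : φ x = g x := rfl
  simp only [Complex.real_smul, ← hφ, mul_comm (φ _)]
  rw [integral_fourier_lp_mul, integral_fourier_mul h1 φ.integrable]
  refine integral_congr_ae ?_
  filter_upwards [h2.coeFn_toLp] with x hx
  rw [hx, SchwartzMap.fourier_coe]

theorem integrable_lp_mul {f g : Plane → ℂ} (hf : MemLp f 2) (hg : MemLp g 2) :
    Integrable fun x : Plane => f x * g x := hf.integrable_mul hg

theorem inner_eq_integral (f g : L2C) : inner ℂ f g = ∫ x, starRingEnd ℂ (f x) * g x := by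
  rw [L2.inner_def]
  refine integral_congr_ae (Filter.Eventually.of_forall fun x => ?_)
  simp only [RCLike.inner_apply, mul_comm]

theorem continuous_integral_lp_mul {w : Plane → ℂ} (hw : MemLp w 2) :
    Continuous fun f : L2C => ∫ x, f x * w x := by
  have h : (fun f : L2C => ∫ x, f x * w x) = fun f => inner ℂ (hw.star.toLp _) f := by
    ext f
    rw [inner_eq_integral]
    refine integral_congr_ae ?_
    filter_upwards [hw.star.coeFn_toLp] with x hx
    rw [hx]
    simp [mul_comm]
  rw [h]
  fun_prop

/-- Two continuous maps on `L²` that agree on Schwartz functions are equal. -/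
theorem eq_of_eq_on_schwartz {X : Type*} [TopologicalSpace X] [T2Space X] {Φ Ψ : L2C → X}
    (hΦ : Continuous Φ) (hΨ : Continuous Ψ)
    (h : ∀ φ : 𝓢(Plane, ℂ), Φ (φ.toLp 2) = Ψ (φ.toLp 2)) (f : L2C) : Φ f = Ψ f :=
  congrFun ((SchwartzMap.denseRange_toLpCLM (F := ℂ) (E := Plane) (p := 2)
    ENNReal.ofNat_ne_top).equalizer hΦ hΨ (funext h)) f

/-- The symmetry of the Fourier transform, for an arbitrary and an integrable function. -/
theorem integral_lp_mul_fourier (f : L2C) {w : Plane → ℂ} (h1 : Integrable w) (h2 : MemLp w 2) :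
    ∫ x, f x * 𝓕 w x = ∫ ξ, (𝓕 f : L2C) ξ * w ξ := by
  have hw : MemLp (𝓕 w) 2 (volume : Measure Plane) :=
    (memLp_congr_ae (fourier_toLp_ae h1 h2)).mp (Lp.memLp _)
  refine eq_of_eq_on_schwartz (continuous_integral_lp_mul hw)
    ((continuous_integral_lp_mul h2).comp (FourierTransform.continuous_fourier (E := L2C)))
    (fun φ => ?_) f
  simp only [Function.comp_apply]
  rw [SchwartzMap.toLp_fourier_eq]
  have e1 : ∫ x, (φ.toLp 2 : L2C) x * 𝓕 w x = ∫ x, φ x * 𝓕 w x := by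
    refine integral_congr_ae ?_
    filter_upwards [φ.coeFn_toLp 2] with x hx
    rw [hx]
  have e2 : ∫ x, ((𝓕 φ).toLp 2 : L2C) x * w x = ∫ x, 𝓕 (φ : Plane → ℂ) x * w x := by
    refine integral_congr_ae ?_
    filter_upwards [(𝓕 φ).coeFn_toLp 2] with x hx
    rw [hx, SchwartzMap.fourier_coe]
  rw [e1, e2, integral_fourier_mul φ.integrable h1]

theorem continuous_of_sub_of_enorm {Φ : L2C → L2C} (hs : ∀ a b, Φ (a - b) = Φ a - Φ b)
    (hn : ∀ a, ‖Φ a‖ₑ = ‖a‖ₑ) : Continuous Φ :=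
  Isometry.continuous fun a b => by
    rw [edist_eq_enorm_sub, edist_eq_enorm_sub, ← hs, hn]

theorem memLp_conjWave (ξ : Plane) {f : Plane → ℂ} (hf : MemLp f 2) :
    MemLp (fun x => starRingEnd ℂ (planeWave (-ξ) x * f x)) 2 (volume : Measure Plane) := by
  refine MemLp.star (f := fun x => planeWave (-ξ) x * f x) (hf.of_le
    ((continuous_planeWave _).aestronglyMeasurable.mul hf.1)
    (Filter.Eventually.of_forall fun x => ?_))
  rw [norm_mul, norm_planeWave, one_mul]

/-- The complex conjugate of a modulated function. -/
def conjWave (ξ : Plane) (f : L2C) : L2C := (memLp_conjWave ξ (Lp.memLp f)).toLp _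

theorem coeFn_conjWave (ξ : Plane) (f : L2C) :
    conjWave ξ f =ᵐ[volume] fun x => starRingEnd ℂ (planeWave (-ξ) x * f x) :=
  MemLp.coeFn_toLp _

theorem continuous_conjWave (ξ : Plane) : Continuous (conjWave ξ) := by
  refine continuous_of_sub_of_enorm (fun a b => Lp.ext ?_) fun a => ?_
  · filter_upwards [coeFn_conjWave ξ (a - b), coeFn_conjWave ξ a, coeFn_conjWave ξ b,
      Lp.coeFn_sub (conjWave ξ a) (conjWave ξ b), Lp.coeFn_sub a b] with x h1 h2 h3 h4 h5
    rw [h1, h4, Pi.sub_apply, h2, h3, h5, Pi.sub_apply, mul_sub, map_sub]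
  · refine (ENNReal.pow_right_strictMono two_ne_zero).injective ?_
    simp only [enorm_sq_eq_lintegral]
    refine lintegral_congr_ae ?_
    filter_upwards [coeFn_conjWave ξ a] with x h1
    rw [h1, ← ofReal_norm, RCLike.norm_conj, norm_mul, norm_planeWave, one_mul, ofReal_norm]

theorem memLp_conjSub (ξ : Plane) (a : L2C) :
    MemLp (fun η => starRingEnd ℂ (a (ξ - η))) 2 (volume : Measure Plane) :=
  ((Lp.memLp a).comp_measurePreserving (Measure.measurePreserving_sub_left volume ξ)).star

/-- The complex conjugate of a function reflected about `ξ / 2`. -/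
def conjSub (ξ : Plane) (a : L2C) : L2C := (memLp_conjSub ξ a).toLp _

theorem coeFn_conjSub (ξ : Plane) (a : L2C) :
    conjSub ξ a =ᵐ[volume] fun η => starRingEnd ℂ (a (ξ - η)) :=
  MemLp.coeFn_toLp _

theorem continuous_conjSub (ξ : Plane) : Continuous (conjSub ξ) := by
  refine continuous_of_sub_of_enorm (fun a b => Lp.ext ?_) fun a => ?_
  · filter_upwards [coeFn_conjSub ξ (a - b), coeFn_conjSub ξ a, coeFn_conjSub ξ b,
      Lp.coeFn_sub (conjSub ξ a) (conjSub ξ b), ae_eq_comp_sub_left (Lp.coeFn_sub a b) ξ]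
      with x h1 h2 h3 h4 h5
    rw [h1, h4, Pi.sub_apply, h2, h3, h5, Pi.sub_apply, map_sub]
  · refine (ENNReal.pow_right_strictMono two_ne_zero).injective ?_
    simp only [enorm_sq_eq_lintegral]
    rw [← lintegral_sub_left_eq_self (fun η => ‖a η‖ₑ ^ 2) ξ]
    refine lintegral_congr_ae ?_
    filter_upwards [coeFn_conjSub ξ a] with x h1
    rw [h1, ← ofReal_norm, RCLike.norm_conj, ofReal_norm]

theorem fourier_conjWave (ξ : Plane) (f : L2C) : 𝓕 (conjWave ξ f) = conjSub ξ (𝓕 f) := by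
  refine eq_of_eq_on_schwartz
    ((FourierTransform.continuous_fourier (E := L2C)).comp (continuous_conjWave ξ))
    ((continuous_conjSub ξ).comp (FourierTransform.continuous_fourier (E := L2C)))
    (fun φ => ?_) f
  simp only [Function.comp_apply]
  have h2 := memLp_conjWave ξ (φ.memLp 2)
  have h1 : Integrable fun x => starRingEnd ℂ (planeWave (-ξ) x * φ x) := by
    refine φ.integrable.mono h2.1 (Filter.Eventually.of_forall fun x => ?_)
    rw [RCLike.norm_conj, norm_mul, norm_planeWave, one_mul]
  have e : conjWave ξ (φ.toLp 2) = h2.toLp _ := by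
    refine Lp.ext ?_
    filter_upwards [coeFn_conjWave ξ (φ.toLp 2), h2.coeFn_toLp, φ.coeFn_toLp 2] with x h3 h4 h5
    rw [h3, h4, h5]
  rw [e, SchwartzMap.toLp_fourier_eq]
  refine Lp.ext ?_
  filter_upwards [fourier_toLp_ae h1 h2, coeFn_conjSub ξ ((𝓕 φ).toLp 2),
    ae_eq_comp_sub_left ((𝓕 φ).coeFn_toLp 2) ξ] with η h3 h4 h5
  rw [h3, h4, h5, SchwartzMap.fourier_coe, fourier_eq_integral, fourier_eq_integral,
    ← integral_conj]
  refine integral_congr_ae (Filter.Eventually.of_forall fun x => ?_)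
  simp only [map_mul, conj_planeWave, neg_neg]
  rw [← mul_assoc, ← planeWave_add]
  congr 2
  abel

/-- The Fourier transform of a product of two `L²` functions is the convolution of their Fourier
transforms: this is Parseval's identity for the conjugate of a modulated factor. -/
theorem fourier_mul_eq (f h : L2C) (ξ : Plane) :
    𝓕 (fun x => f x * h x) ξ = ∫ η, (𝓕 f : L2C) (ξ - η) * (𝓕 h : L2C) η := by
  have key := Lp.inner_fourier_eq (conjWave ξ f) h
  rw [fourier_conjWave, inner_eq_integral, inner_eq_integral] at key
  rw [fourier_eq_integral]
  trans ∫ x, starRingEnd ℂ (conjWave ξ f x) * h x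
  · refine integral_congr_ae ?_
    filter_upwards [coeFn_conjWave ξ f] with x hx
    rw [hx, Complex.conj_conj, mul_assoc]
  · rw [← key]
    refine integral_congr_ae ?_
    filter_upwards [coeFn_conjSub ξ (𝓕 f)] with x hx
    rw [hx, Complex.conj_conj]

theorem fourier_star_eq_herm (f : L2C) : 𝓕 (conjWave 0 f) = herm (𝓕 f) := by
  rw [fourier_conjWave]
  refine Lp.ext ?_
  filter_upwards [coeFn_conjSub 0 (𝓕 f), coeFn_herm (𝓕 f)] with x h1 h2
  rw [h1, h2, zero_sub]

/-- A function is real if and only if its Fourier transform has Hermitian symmetry. -/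
theorem herm_fourier_eq_iff (f : L2C) :
    herm (𝓕 f) = 𝓕 f ↔ ∀ᵐ x, starRingEnd ℂ (f x) = f x := by
  have hinj : 𝓕 (conjWave 0 f) = 𝓕 f ↔ conjWave 0 f = f :=
    (Lp.fourierTransformₗᵢ Plane ℂ).injective.eq_iff
  rw [← fourier_star_eq_herm, hinj, Lp.ext_iff]
  refine Filter.eventually_congr ?_
  filter_upwards [coeFn_conjWave 0 f] with x hx
  rw [hx]
  simp [planeWave]

/-! ### Real functions and the velocity -/

theorem coeFn_toComplex (θ : L2) : toComplex θ =ᵐ[volume] fun x => (θ x : ℂ) :=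
  Complex.ofRealCLM.coeFn_compLp θ

theorem continuous_toComplex : Continuous toComplex :=
  (Complex.ofRealCLM.compLpL 2 (volume : Measure Plane)).continuous

theorem toComplex_injective : Function.Injective toComplex := fun f g h => by
  refine Lp.ext ?_
  filter_upwards [coeFn_toComplex f, coeFn_toComplex g] with x h1 h2
  rw [h, h2] at h1
  exact_mod_cast h1.symm

theorem herm_fourier_toComplex (θ : L2) : herm (𝓕 (toComplex θ)) = 𝓕 (toComplex θ) := by
  rw [herm_fourier_eq_iff]
  filter_upwards [coeFn_toComplex θ] with x hx
  rw [hx, Complex.conj_ofReal]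

/-- The real part of a complex `L²` function. -/
def rePart (f : L2C) : L2 := Complex.reCLM.compLp f

theorem continuous_rePart : Continuous rePart :=
  (Complex.reCLM.compLpL 2 (volume : Measure Plane)).continuous

theorem toComplex_rePart {f : L2C} (hf : herm (𝓕 f) = 𝓕 f) : toComplex (rePart f) = f := by
  refine Lp.ext ?_
  filter_upwards [coeFn_toComplex (rePart f), (herm_fourier_eq_iff f).mp hf,
    Complex.reCLM.coeFn_compLp f] with x h1 h2 h3
  rw [h1, ← Complex.conj_eq_iff_re.mp h2]
  exact congrArg _ h3

/-- The operator `∂_j Λ⁻¹` applied to the complexification of `θ`. -/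
def derivLambdaInvC (j : Fin 2) (θ : L2) : L2C :=
  fourierMultiplier ((memLp_derivLambdaInvSymbol j).toLp _) (toComplex θ)

theorem fourier_derivLambdaInvC (j : Fin 2) (θ : L2) :
    (𝓕 (derivLambdaInvC j θ) : L2C) =ᵐ[volume]
      fun ξ => derivLambdaInvSymbol j ξ * (𝓕 (toComplex θ) : L2C) ξ := by
  have h : (𝓕 (derivLambdaInvC j θ) : L2C) =
      (memLp_derivLambdaInvSymbol j).toLp _ • (𝓕 (toComplex θ) : L2C) :=
    FourierTransform.fourier_fourierInv_eq _
  rw [h]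
  filter_upwards [Lp.coeFn_lpSMul (r := 2) ((memLp_derivLambdaInvSymbol j).toLp _)
    (𝓕 (toComplex θ) : L2C), (memLp_derivLambdaInvSymbol j).coeFn_toLp] with ξ h1 h2
  rw [h1, Pi.smul_apply', h2, smul_eq_mul]

theorem derivLambdaInvSymbol_neg (j : Fin 2) (ξ : Plane) :
    starRingEnd ℂ (derivLambdaInvSymbol j (-ξ)) = derivLambdaInvSymbol j ξ := by
  simp [derivLambdaInvSymbol, neg_div]

/-- The operator `∂_j Λ⁻¹` maps real functions to real functions. -/
theorem derivLambdaInvC_eq (j : Fin 2) (θ : L2) :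
    derivLambdaInvC j θ =ᵐ[volume] fun x => (derivLambdaInv j θ x : ℂ) := by
  have h : herm (𝓕 (derivLambdaInvC j θ)) = 𝓕 (derivLambdaInvC j θ) := by
    refine Lp.ext ?_
    have h0 := coeFn_herm (𝓕 (toComplex θ))
    rw [herm_fourier_toComplex] at h0
    filter_upwards [coeFn_herm (𝓕 (derivLambdaInvC j θ)), fourier_derivLambdaInvC j θ,
      ae_eq_comp_neg (fourier_derivLambdaInvC j θ), h0] with ξ h1 h2 h3 h4
    rw [h1, h2, h3, map_mul, derivLambdaInvSymbol_neg, h4]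
  filter_upwards [(herm_fourier_eq_iff _).mp h] with x hx
  exact (Complex.conj_eq_iff_re.mp hx).symm

/-! ### The Fourier transform of the flux -/

/-- The components of the flux, as complex functions. -/
def fluxC (j : Fin 2) (θ : L2) (x : Plane) : ℂ := (flux θ x j : ℂ)

theorem fluxC_zero (θ : L2) :
    fluxC 0 θ =ᵐ[volume] fun x => -(toComplex θ x * derivLambdaInvC 1 θ x) := by
  filter_upwards [coeFn_toComplex θ, derivLambdaInvC_eq 1 θ] with x h1 h2
  rw [h1, h2]
  simp [fluxC, flux, velocity]

theorem fluxC_one (θ : L2) :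
    fluxC 1 θ =ᵐ[volume] fun x => toComplex θ x * derivLambdaInvC 0 θ x := by
  filter_upwards [coeFn_toComplex θ, derivLambdaInvC_eq 0 θ] with x h1 h2
  rw [h1, h2]
  simp [fluxC, flux, velocity]

theorem integrable_fluxC (j : Fin 2) (θ : L2) : Integrable (fluxC j θ) := by
  fin_cases j
  · exact (integrable_congr (fluxC_zero θ)).mpr
      (integrable_lp_mul (Lp.memLp (toComplex θ)) (Lp.memLp (derivLambdaInvC 1 θ))).neg
  · exact (integrable_congr (fluxC_one θ)).mpr
      (integrable_lp_mul (Lp.memLp (toComplex θ)) (Lp.memLp (derivLambdaInvC 0 θ)))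

theorem fourier_mul_derivLambdaInvC (j : Fin 2) (θ : L2) (ξ : Plane) :
    𝓕 (fun x => toComplex θ x * derivLambdaInvC j θ x) ξ =
      ∫ η, derivLambdaInvSymbol j η *
        ((𝓕 (toComplex θ) : L2C) (ξ - η) * (𝓕 (toComplex θ) : L2C) η) := by
  rw [fourier_mul_eq]
  refine integral_congr_ae ?_
  filter_upwards [fourier_derivLambdaInvC j θ] with η hη
  rw [hη]
  ring

theorem integrable_derivLambdaInvSymbol_mul (j : Fin 2) (a : L2C) (ξ : Plane) :
    Integrable fun η => derivLambdaInvSymbol j η * (a (ξ - η) * a η) := by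
  refine (integrable_mul_comp_sub a a ξ).bdd_mul (c := 1) (memLp_derivLambdaInvSymbol j).1
    (Filter.Eventually.of_forall fun η => ?_)
  simp only [derivLambdaInvSymbol, norm_mul, Complex.norm_I, one_mul, Complex.norm_real,
    norm_div, norm_norm]
  exact div_le_one_of_le₀ (PiLp.norm_apply_le η j) (norm_nonneg η)

/-- On the Fourier side, the divergence of the flux is the negative of the bilinear form `bilin`. -/
theorem sum_mul_fourier_fluxC (θ : L2) (ξ : Plane) :
    ∑ j : Fin 2, 2 * Real.pi * Complex.I * (ξ j : ℂ) * 𝓕 (fluxC j θ) ξ =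
      -bilin (𝓕 (toComplex θ) : L2C) (𝓕 (toComplex θ) : L2C) ξ := by
  set a : L2C := 𝓕 (toComplex θ)
  have h0 : 𝓕 (fluxC 0 θ) ξ = -∫ η, derivLambdaInvSymbol 1 η * (a (ξ - η) * a η) := by
    rw [Real.fourier_congr_ae (fluxC_zero θ), fourier_eq_integral]
    simp only [mul_neg]
    rw [integral_neg, ← fourier_eq_integral, fourier_mul_derivLambdaInvC]
  have h1 : 𝓕 (fluxC 1 θ) ξ = ∫ η, derivLambdaInvSymbol 0 η * (a (ξ - η) * a η) := by
    rw [Real.fourier_congr_ae (fluxC_one θ), fourier_mul_derivLambdaInvC]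
  have e : ∫ η, ((cross ξ η * ‖η‖⁻¹ : ℝ) : ℂ) * (a (ξ - η) * a η) =
      -Complex.I * ((ξ 1 : ℂ) * ∫ η, derivLambdaInvSymbol 0 η * (a (ξ - η) * a η)) +
      Complex.I * ((ξ 0 : ℂ) * ∫ η, derivLambdaInvSymbol 1 η * (a (ξ - η) * a η)) := by
    rw [← integral_const_mul, ← integral_const_mul, ← integral_const_mul, ← integral_const_mul,
      ← integral_add (((integrable_derivLambdaInvSymbol_mul 0 a ξ).const_mul _).const_mul _)
        (((integrable_derivLambdaInvSymbol_mul 1 a ξ).const_mul _).const_mul _)]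
    refine integral_congr_ae (Filter.Eventually.of_forall fun η => ?_)
    simp only [cross, derivLambdaInvSymbol]
    push_cast
    linear_combination (((η 1 : ℂ) * ξ 0 - η 0 * ξ 1) * (‖η‖ : ℂ)⁻¹ * (-1) *
      (a (ξ - η) * a η)) * Complex.I_sq
  rw [Fin.sum_univ_two, h0, h1, bilin_self_eq, e]
  ring

/-! ### The heat semigroup on the Fourier side -/

/-- The Fourier symbol of the heat semigroup. -/
def heatSymbol (t : ℝ) (ξ : Plane) : ℝ := Real.exp (-(heatRate * ‖ξ‖ ^ 2 * t))

theorem continuous_heatSymbol (t : ℝ) : Continuous (heatSymbol t) := by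
  unfold heatSymbol
  fun_prop

theorem heatSymbol_le_one {t : ℝ} (ht : 0 ≤ t) (ξ : Plane) : heatSymbol t ξ ≤ 1 := by
  have := heatRate_pos
  rw [heatSymbol, Real.exp_le_one_iff, Left.neg_nonpos_iff]
  positivity

theorem heatSymbol_pos (t : ℝ) (ξ : Plane) : 0 < heatSymbol t ξ := Real.exp_pos _

theorem planeWave_mul_heatSymbol (t : ℝ) (x ξ : Plane) :
    planeWave x ξ * heatSymbol t ξ = Complex.exp (-((heatRate * t : ℝ) : ℂ) * ‖ξ‖ ^ 2 +
      2 * Real.pi * Complex.I * inner ℝ x ξ) := by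
  rw [planeWave, heatSymbol, Complex.ofReal_exp, ← Complex.exp_add]
  push_cast
  ring_nf

theorem integrable_planeWave_mul_heatSymbol {t : ℝ} (ht : 0 < t) (x : Plane) :
    Integrable fun ξ => planeWave x ξ * heatSymbol t ξ := by
  have := heatRate_pos
  simp only [planeWave_mul_heatSymbol]
  refine GaussianFourier.integrable_cexp_neg_mul_sq_norm_add ?_ _ _
  rw [Complex.ofReal_re]
  positivity

theorem integrable_heatSymbol {t : ℝ} (ht : 0 < t) : Integrable (heatSymbol t) := by
  have h := (integrable_planeWave_mul_heatSymbol ht 0).norm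
  refine h.congr (Filter.Eventually.of_forall fun ξ => ?_)
  simp only [norm_mul, norm_planeWave, one_mul, Complex.norm_real, Real.norm_eq_abs,
    abs_of_pos (heatSymbol_pos t ξ)]

theorem memLp_heatSymbol {t : ℝ} (ht : 0 < t) : MemLp (fun ξ => (heatSymbol t ξ : ℂ)) 2 volume := by
  have hc : Continuous fun ξ => (heatSymbol t ξ : ℂ) :=
    Complex.continuous_ofReal.comp (continuous_heatSymbol t)
  rw [memLp_two_iff_integrable_sq_norm hc.aestronglyMeasurable]
  refine (integrable_heatSymbol (t := 2 * t) (by positivity)).congr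
    (Filter.Eventually.of_forall fun ξ => ?_)
  simp only [Complex.norm_real, Real.norm_eq_abs, sq_abs, heatSymbol, ← Real.exp_nat_mul]
  congr 1
  push_cast
  ring

theorem memLp_planeWave_mul_heatSymbol {t : ℝ} (ht : 0 < t) (x : Plane) :
    MemLp (fun ξ => planeWave x ξ * heatSymbol t ξ) 2 volume := by
  refine (memLp_heatSymbol ht).of_le ((continuous_planeWave x).mul
    (Complex.continuous_ofReal.comp (continuous_heatSymbol t))).aestronglyMeasurable
    (Filter.Eventually.of_forall fun ξ => ?_)
  rw [norm_mul, norm_planeWave, one_mul]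

/-- The heat kernel is the Fourier transform of a Gaussian. -/
theorem fourier_planeWave_mul_heatSymbol {t : ℝ} (ht : 0 < t) (x y : Plane) :
    𝓕 (fun ξ => planeWave x ξ * heatSymbol t ξ) y = heatKernel t (x - y) := by
  have hk := heatRate_pos
  simp only [planeWave_mul_heatSymbol]
  rw [fourier_gaussian_innerProductSpace' (by rw [Complex.ofReal_re]; positivity)]
  have hfin : (Module.finrank ℝ Plane : ℂ) / 2 = 1 := by simp
  have hpi := Real.pi_pos
  rw [hfin, Complex.cpow_one, heatKernel]
  push_cast
  have e1 : ((Real.pi : ℂ) / ((heatRate : ℂ) * t)) = (4 * Real.pi * t : ℂ)⁻¹ := by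
    have h : Real.pi / (heatRate * t) = (4 * Real.pi * t)⁻¹ := by
      rw [heatRate]; field_simp
    exact_mod_cast h
  have e2 : (-(Real.pi : ℂ) ^ 2 * (‖x - y‖ : ℂ) ^ 2 / ((heatRate : ℂ) * t)) =
      -(‖x - y‖ : ℂ) ^ 2 / (4 * t) := by
    have h : -Real.pi ^ 2 * ‖x - y‖ ^ 2 / (heatRate * t) = -‖x - y‖ ^ 2 / (4 * t) := by
      rw [heatRate]; field_simp
    exact_mod_cast h
  rw [e1, e2]

theorem abs_heatKernel_le {t : ℝ} (ht : 0 < t) (x : Plane) :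
    |heatKernel t x| ≤ (4 * Real.pi * t)⁻¹ := by
  have hpi := Real.pi_pos
  rw [heatKernel, abs_mul, Real.abs_exp, abs_of_pos (by positivity)]
  refine mul_le_of_le_one_right (by positivity) (Real.exp_le_one_iff.mpr ?_)
  rw [neg_div, Left.neg_nonpos_iff]
  positivity

theorem continuous_heatKernel (t : ℝ) : Continuous (heatKernel t) := by
  unfold heatKernel
  fun_prop

/-- The heat semigroup on `L²` has the symbol `heatSymbol`. -/
theorem heatSemigroup_eq_fourierInv {t : ℝ} (ht : 0 < t) (θ : L2) (x : Plane) :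
    ((heatSemigroup t (θ : Plane → ℝ) x : ℝ) : ℂ) =
      𝓕⁻ (fun ξ => heatSymbol t ξ * (𝓕 (toComplex θ) : L2C) ξ) x := by
  rw [heatSemigroup, if_pos ht, ← integral_complex_ofReal, fourierInv_eq_integral]
  have h := integral_lp_mul_fourier (toComplex θ) (integrable_planeWave_mul_heatSymbol ht x)
    (memLp_planeWave_mul_heatSymbol ht x)
  simp only [fourier_planeWave_mul_heatSymbol ht] at h
  trans ∫ y, toComplex θ y * heatKernel t (x - y)
  · refine integral_congr_ae ?_
    filter_upwards [coeFn_toComplex θ] with y hy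
    rw [hy, smul_eq_mul]
    push_cast
    ring
  · rw [h]
    refine integral_congr_ae (Filter.Eventually.of_forall fun ξ => ?_)
    ring

theorem integrable_flux (θ : L2) : Integrable (flux θ) := by
  refine Integrable.of_eval_piLp fun j => ?_
  exact (integrable_fluxC j θ).re

/-- The heat semigroup on the components of the flux, which are merely integrable, has the symbol
`heatSymbol`. -/
theorem heatSemigroup_flux_eq_fourierInv {t : ℝ} (ht : 0 < t) (θ : L2) (j : Fin 2) (x : Plane) :
    ((heatSemigroup t (flux θ) x j : ℝ) : ℂ) =
      𝓕⁻ (fun ξ => heatSymbol t ξ * 𝓕 (fluxC j θ) ξ) x := by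
  have hi : Integrable fun y => heatKernel t (x - y) • flux θ y := by
    refine (integrable_flux θ).bdd_smul (φ := fun y => heatKernel t (x - y)) (4 * Real.pi * t)⁻¹ ?_
      (Filter.Eventually.of_forall fun y => ?_)
    · exact ((continuous_heatKernel t).comp (continuous_const.sub continuous_id)).aestronglyMeasurable
    · exact abs_heatKernel_le ht _
  rw [heatSemigroup, if_pos ht, eval_integral_piLp fun j => hi.eval_piLp j,
    ← integral_complex_ofReal, fourierInv_eq_integral]
  have h := integral_fourier_mul (integrable_planeWave_mul_heatSymbol ht x) (integrable_fluxC j θ)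
  simp only [fourier_planeWave_mul_heatSymbol ht] at h
  trans ∫ y, heatKernel t (x - y) * fluxC j θ y
  · refine integral_congr_ae (Filter.Eventually.of_forall fun y => ?_)
    simp [fluxC]
  · rw [h]
    refine integral_congr_ae (Filter.Eventually.of_forall fun ξ => ?_)
    ring

/-! ### The divergence -/

/-- The derivative of an inverse Fourier integral, obtained by differentiating the integrand. -/
theorem hasFDerivAt_fourierInv {G : Plane → ℂ} (hG : Integrable G)
    (hG' : Integrable fun ξ => ‖ξ‖ * ‖G ξ‖) (x : Plane) :
    ∃ L : Plane →L[ℝ] ℂ, HasFDerivAt (𝓕⁻ G) L x ∧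
      ∀ v, L v = 𝓕⁻ (fun ξ => 2 * Real.pi * Complex.I * (inner ℝ ξ v : ℂ) * G ξ) x := by
  have h := Real.hasFDerivAt_fourier hG hG' (-x)
  have h2 := h.comp x (hasFDerivAt_id (𝕜 := ℝ) x).neg
  have e : 𝓕 G ∘ Neg.neg = 𝓕⁻ G := by
    ext y
    rw [Real.fourierInv_eq_fourier_neg, Function.comp_apply]
  rw [e] at h2
  refine ⟨_, h2, fun v => ?_⟩
  have hi : Integrable (VectorFourier.fourierSMulRight (innerSL ℝ) G) := by
    refine (hG'.const_mul (2 * Real.pi * ‖innerSL (E := Plane) ℝ‖)).mono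
      hG.1.fourierSMulRight (Filter.Eventually.of_forall fun ξ => ?_)
    refine (VectorFourier.norm_fourierSMulRight_le _ G ξ).trans (le_of_eq ?_)
    rw [Real.norm_of_nonneg (by positivity)]
    ring
  rw [Real.fourierInv_eq_fourier_neg, ContinuousLinearMap.comp_apply,
    neg_apply, ContinuousLinearMap.id_apply, map_neg,
    Real.fourier_continuousLinearMap_apply hi, fourier_eq_integral, fourier_eq_integral,
    ← integral_neg]
  refine integral_congr_ae (Filter.Eventually.of_forall fun ξ => ?_)
  have hin : innerSL ℝ ξ v = inner ℝ ξ v := rfl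
  simp only [VectorFourier.fourierSMulRight_apply, smul_eq_mul, Complex.real_smul, hin]
  ring

/-- The divergence of a real vector field with components given by inverse Fourier integrals. -/
theorem divergence_eq_fourierInv {V : Plane → Plane} {G : Fin 2 → Plane → ℂ}
    (hV : ∀ j x, (V x j : ℂ) = 𝓕⁻ (G j) x) (hG : ∀ j, Integrable (G j))
    (hG' : ∀ j, Integrable fun ξ => ‖ξ‖ * ‖G j ξ‖) (x : Plane) :
    (divergence V x : ℂ) =
      𝓕⁻ (fun ξ => ∑ j, 2 * Real.pi * Complex.I * (ξ j : ℂ) * G j ξ) x := by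
  have hd (j : Fin 2) := hasFDerivAt_fourierInv (hG j) (hG' j) x
  choose L hL hLv using hd
  have hVj (j : Fin 2) : HasFDerivAt (fun y => V y j) (Complex.reCLM ∘L L j) x := by
    have h := Complex.reCLM.hasFDerivAt.comp x (hL j)
    have e : (fun y => V y j) = Complex.reCLM ∘ 𝓕⁻ (G j) := by
      ext y
      simp [← hV]
    rw [e]
    exact h
  have hdV : DifferentiableAt ℝ V x :=
    (differentiableAt_euclidean (𝕜 := ℝ)).mpr fun j => (hVj j).differentiableAt
  have hre (j : Fin 2) (v : Plane) : ((L j v).re : ℂ) = L j v := by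
    have h1 := Complex.ofRealCLM.hasFDerivAt.comp x (hVj j)
    have e : Complex.ofRealCLM ∘ (fun y => V y j) = 𝓕⁻ (G j) := by
      ext y
      simp [← hV]
    rw [e] at h1
    have h2 := h1.unique (hL j)
    exact congrArg (fun M => M v) h2
  have hcomp (j : Fin 2) (v : Plane) : (fderiv ℝ V x v) j = (L j v).re := by
    have h1 := (EuclideanSpace.proj (𝕜 := ℝ) j).hasFDerivAt.comp x hdV.hasFDerivAt
    have h2 := h1.unique (hVj j)
    exact congrArg (fun M => M v) h2
  have hint (j : Fin 2) : Integrable fun ξ => planeWave x ξ *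
      (2 * Real.pi * Complex.I * (ξ j : ℂ) * G j ξ) := by
    refine ((hG' j).const_mul (2 * Real.pi)).mono ?_ (Filter.Eventually.of_forall fun ξ => ?_)
    · have h1 : Continuous fun ξ : Plane => 2 * Real.pi * Complex.I * (ξ j : ℂ) := by fun_prop
      exact (continuous_planeWave x).aestronglyMeasurable.mul
        (h1.aestronglyMeasurable.mul (hG j).1)
    · simp only [norm_mul, norm_planeWave, one_mul, Complex.norm_I, Complex.norm_real, norm_norm,
        Complex.norm_ofNat, Real.norm_ofNat, mul_one]
      rw [mul_assoc]
      gcongr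
      exact PiLp.norm_apply_le ξ j
  simp only [divergence, hcomp, Complex.ofReal_sum, hre]
  simp only [hLv, fourierInv_eq_integral, Finset.mul_sum]
  rw [integral_finsetSum _ fun j _ => hint j]
  simp [EuclideanSpace.inner_single_right]

theorem integrable_norm_mul_heatSymbol {t : ℝ} (ht : 0 < t) :
    Integrable fun ξ : Plane => ‖ξ‖ * heatSymbol t ξ := by
  have hk := heatRate_pos
  set c : ℝ := heatRate * t / 2 with hc
  have hc0 : 0 < c := by positivity
  refine ((integrable_heatSymbol (t := t / 2) (by positivity)).const_mul (1 + c⁻¹)).mono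
    (continuous_norm.mul (continuous_heatSymbol t)).aestronglyMeasurable
    (Filter.Eventually.of_forall fun ξ => ?_)
  rw [Real.norm_of_nonneg (mul_nonneg (norm_nonneg _) (heatSymbol_pos _ _).le),
    Real.norm_of_nonneg (mul_nonneg (by positivity) (heatSymbol_pos _ _).le)]
  have e : heatSymbol t ξ = Real.exp (-(c * ‖ξ‖ ^ 2)) * heatSymbol (t / 2) ξ := by
    rw [heatSymbol, heatSymbol, ← Real.exp_add, hc]
    ring_nf
  rw [e, ← mul_assoc]
  refine mul_le_mul_of_nonneg_right ?_ (heatSymbol_pos _ _).le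
  rw [Real.exp_neg, ← div_eq_mul_inv, div_le_iff₀ (Real.exp_pos _)]
  have h1 := Real.add_one_le_exp (c * ‖ξ‖ ^ 2)
  calc ‖ξ‖ ≤ 1 + ‖ξ‖ ^ 2 := by nlinarith [sq_nonneg (‖ξ‖ - 1), norm_nonneg ξ]
    _ ≤ 1 + ‖ξ‖ ^ 2 + (c⁻¹ + c * ‖ξ‖ ^ 2) := le_add_of_nonneg_right (by positivity)
    _ = (1 + c⁻¹) * (c * ‖ξ‖ ^ 2 + 1) := by field_simp; ring
    _ ≤ _ := by gcongr

theorem integrable_heatSymbol_mul_bilin {t : ℝ} (ht : 0 < t) (a : L2C) :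
    Integrable fun ξ => (heatSymbol t ξ : ℂ) * bilin a a ξ := by
  refine ((integrable_norm_mul_heatSymbol ht).const_mul (Real.pi * ‖a‖ * ‖a‖)).mono
    ((Complex.continuous_ofReal.comp (continuous_heatSymbol t)).aestronglyMeasurable.mul
      (measurable_bilin (measurable_coe a) (measurable_coe a)).aestronglyMeasurable)
    (Filter.Eventually.of_forall fun ξ => ?_)
  have h := norm_bilin_le a a ξ
  have h1 := (heatSymbol_pos t ξ).le
  rw [norm_mul, Complex.norm_real, Real.norm_of_nonneg h1, Real.norm_of_nonneg (by positivity)]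
  calc heatSymbol t ξ * ‖bilin a a ξ‖ ≤ heatSymbol t ξ * (Real.pi * ‖ξ‖ * ‖a‖ * ‖a‖) := by gcongr
    _ = _ := by ring

/-- The integrand of the mild formulation on the Fourier side. -/
theorem divergence_heatSemigroup_flux {t : ℝ} (ht : 0 < t) (θ : L2) (x : Plane) :
    (divergence (heatSemigroup t (flux θ)) x : ℂ) = 𝓕⁻ (fun ξ => -(heatSymbol t ξ *
      bilin (𝓕 (toComplex θ) : L2C) (𝓕 (toComplex θ) : L2C) ξ)) x := by
  have hb (j : Fin 2) (ξ : Plane) : ‖𝓕 (fluxC j θ) ξ‖ ≤ ∫ y, ‖fluxC j θ y‖ :=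
    VectorFourier.norm_fourierIntegral_le_integral_norm _ _ _ _ ξ
  have hc (j : Fin 2) : AEStronglyMeasurable (𝓕 (fluxC j θ)) volume :=
    (continuous_fourier (integrable_fluxC j θ)).aestronglyMeasurable
  rw [divergence_eq_fourierInv (fun j x => heatSemigroup_flux_eq_fourierInv ht θ j x)
    (fun j => ?_) fun j => ?_]
  · refine congrFun (congrArg _ (funext fun ξ => ?_)) x
    rw [← mul_neg, ← sum_mul_fourier_fluxC, Finset.mul_sum]
    refine Finset.sum_congr rfl fun j _ => ?_
    ring
  · exact (integrable_heatSymbol ht).ofReal.mul_bdd (hc j) (Filter.Eventually.of_forall (hb j))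
  · refine ((integrable_norm_mul_heatSymbol ht).mul_bdd (hc j).norm
      (Filter.Eventually.of_forall fun ξ => (norm_norm _).trans_le (hb j ξ))).congr
      (Filter.Eventually.of_forall fun ξ => ?_)
    simp only [norm_mul, Complex.norm_real, Real.norm_of_nonneg (heatSymbol_pos t ξ).le, mul_assoc]

/-! ### Mild solutions and their Fourier transforms -/

section MildSolutions

/-- A real Schwartz function as a complex Schwartz function. -/
def schwartzC (φ : 𝓢(Plane, ℝ)) : 𝓢(Plane, ℂ) := φ.postcompCLM Complex.ofRealCLM

theorem schwartzC_apply (φ : 𝓢(Plane, ℝ)) (x : Plane) : schwartzC φ x = (φ x : ℂ) := rfl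

theorem integral_divergence_mul {t : ℝ} (ht : 0 < t) (θ : L2) (φ : 𝓢(Plane, ℝ)) :
    ((∫ x, divergence (heatSemigroup t (flux θ)) x * φ x : ℝ) : ℂ) =
      -∫ ξ, heatSymbol t ξ * bilin (𝓕 (toComplex θ) : L2C) (𝓕 (toComplex θ) : L2C) ξ *
        (𝓕⁻ (schwartzC φ)) ξ := by
  have hi : Integrable fun ξ => -((heatSymbol t ξ : ℂ) *
      bilin (𝓕 (toComplex θ) : L2C) (𝓕 (toComplex θ) : L2C) ξ) :=
    (integrable_heatSymbol_mul_bilin ht (𝓕 (toComplex θ))).neg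
  have h := integral_fourierInv_mul hi (schwartzC φ)
  simp only [neg_mul] at h
  rw [← integral_complex_ofReal, ← integral_neg, ← h]
  refine integral_congr_ae (Filter.Eventually.of_forall fun x => ?_)
  simp only [Complex.ofReal_mul, divergence_heatSemigroup_flux ht, schwartzC_apply]

theorem memLp_heatSymbol_mul {t : ℝ} (ht : 0 ≤ t) (a : L2C) :
    MemLp (fun ξ => (heatSymbol t ξ : ℂ) * a ξ) 2 volume := by
  refine (Lp.memLp a).of_le ((Complex.continuous_ofReal.comp
    (continuous_heatSymbol t)).aestronglyMeasurable.mul (Lp.memLp a).1)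
    (Filter.Eventually.of_forall fun ξ => ?_)
  rw [norm_mul, Complex.norm_real, Real.norm_of_nonneg (heatSymbol_pos t ξ).le]
  exact mul_le_of_le_one_left (norm_nonneg _) (heatSymbol_le_one ht ξ)

theorem integral_toComplex_mul (θ : L2) (φ : 𝓢(Plane, ℝ)) :
    Integrable (fun x => θ x * φ x) ∧ ((∫ x, θ x * φ x : ℝ) : ℂ) =
      ∫ ξ, (𝓕 (toComplex θ) : L2C) ξ * (𝓕⁻ (schwartzC φ)) ξ := by
  refine ⟨(Lp.memLp θ).integrable_mul (φ.memLp 2), ?_⟩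
  rw [← integral_lp_mul, ← integral_complex_ofReal]
  refine integral_congr_ae ?_
  filter_upwards [coeFn_toComplex θ] with x hx
  rw [hx, schwartzC_apply, Complex.ofReal_mul]

/-- The pairing of the linear evolution with a test function, including the time `t = 0`, at which
the semigroup is the identity. -/
theorem integral_heatSemigroup_mul {t : ℝ} (ht : 0 ≤ t) (θ : L2) (φ : 𝓢(Plane, ℝ)) :
    Integrable (fun x => heatSemigroup t (θ : Plane → ℝ) x * φ x) ∧
    ((∫ x, heatSemigroup t (θ : Plane → ℝ) x * φ x : ℝ) : ℂ) =
      ∫ ξ, heatSymbol t ξ * (𝓕 (toComplex θ) : L2C) ξ * (𝓕⁻ (schwartzC φ)) ξ := by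
  rcases ht.eq_or_lt with rfl | ht
  · simpa [heatSemigroup, heatSymbol] using integral_toComplex_mul θ φ
  have hG : Integrable fun ξ => (heatSymbol t ξ : ℂ) * (𝓕 (toComplex θ) : L2C) ξ :=
    integrable_lp_mul (memLp_heatSymbol ht) (Lp.memLp _)
  set G : Plane → ℂ := fun ξ => (heatSymbol t ξ : ℂ) * (𝓕 (toComplex θ) : L2C) ξ with hGdef
  have e (x : Plane) : ((heatSemigroup t (θ : Plane → ℝ) x * φ x : ℝ) : ℂ) =
      𝓕⁻ G x * schwartzC φ x := by
    rw [Complex.ofReal_mul, heatSemigroup_eq_fourierInv ht, schwartzC_apply]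
  constructor
  · have h1 : Integrable fun x => 𝓕⁻ G x * schwartzC φ x := by
      refine (schwartzC φ).integrable.bdd_mul (c := ∫ ξ, ‖G ξ‖) ?_
        (Filter.Eventually.of_forall fun x => ?_)
      · rw [Real.fourierInv_eq_fourier_comp_neg]
        exact (continuous_fourier hG.comp_neg).aestronglyMeasurable
      · rw [Real.fourierInv_eq_fourier_neg]
        exact VectorFourier.norm_fourierIntegral_le_integral_norm _ _ _ _ _
    simp only [← e] at h1
    exact h1.re
  · rw [← integral_complex_ofReal]
    simp only [e]
    exact integral_fourierInv_mul hG (schwartzC φ)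

theorem measurable_swap_of_caratheodory {F : ℝ → Plane → ℂ}
    (hc : ∀ ξ, Continuous fun s => F s ξ) (hm : ∀ s, Measurable (F s)) :
    Measurable fun p : Plane × ℝ => F p.2 p.1 :=
  (measurable_uncurry_of_caratheodory hc hm).comp measurable_swap

/-- The integrand of the Duhamel term, paired with a test function, is integrable in time and
frequency. -/
theorem integrable_prod_duhamel {g : ℝ → L2C} (hg : Continuous g) (t : ℝ) {ψ : Plane → ℂ}
    (hψ : Measurable ψ) (hψi : Integrable fun ξ => ‖ξ‖ * ‖ψ ξ‖) :
    Integrable (fun p : Plane × ℝ => heatSymbol (t - p.2) p.1 *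
      bilin (g p.2) (g p.2) p.1 * ψ p.1) (volume.prod (volume.restrict (Ioc 0 t))) := by
  obtain ⟨M, hM⟩ := isCompact_Icc.exists_bound_of_continuousOn (hg.continuousOn (s := Icc 0 t))
  set F : ℝ → Plane → ℂ := fun s => bilin (g s) (g s) with hF
  have hFc (ξ : Plane) : Continuous fun s => F s ξ := continuous_bilin hg hg ξ
  have hFm (s : ℝ) : Measurable (F s) := measurable_bilin (measurable_coe _) (measurable_coe _)
  have hm : Measurable fun p : Plane × ℝ => F p.2 p.1 :=
    measurable_swap_of_caratheodory hFc hFm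
  have hm2 : Measurable fun p : Plane × ℝ => (heatSymbol (t - p.2) p.1 : ℂ) := by
    unfold heatSymbol
    fun_prop
  have hb : Integrable (fun p : Plane × ℝ => (Real.pi * M ^ 2 * (‖p.1‖ * ‖ψ p.1‖)) * (1 : ℝ))
      (volume.prod (volume.restrict (Ioc 0 t))) :=
    (hψi.const_mul (Real.pi * M ^ 2)).mul_prod (integrable_const 1)
  have hmeas : Measurable fun p : Plane × ℝ => (heatSymbol (t - p.2) p.1 : ℂ) * F p.2 p.1 * ψ p.1 :=
    (hm2.mul hm).mul (hψ.comp measurable_fst)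
  refine hb.mono' hmeas.aestronglyMeasurable ?_
  have hmem : ∀ᵐ p : Plane × ℝ ∂(volume.prod (volume.restrict (Ioc 0 t))), p.2 ∈ Ioc 0 t :=
    Measure.quasiMeasurePreserving_snd.ae (ae_restrict_mem measurableSet_Ioc)
  filter_upwards [hmem] with p hp
  have h1 := norm_bilin_le (g p.2) (g p.2) p.1
  have h2 := hM p.2 ⟨hp.1.le, hp.2⟩
  have hM₀ : 0 ≤ M := (norm_nonneg _).trans h2
  have h3 := heatSymbol_le_one (sub_nonneg.mpr hp.2) p.1
  rw [norm_mul, norm_mul, Complex.norm_real, Real.norm_of_nonneg (heatSymbol_pos _ _).le]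
  calc heatSymbol (t - p.2) p.1 * ‖bilin (g p.2) (g p.2) p.1‖ * ‖ψ p.1‖
      ≤ 1 * (Real.pi * ‖p.1‖ * M * M) * ‖ψ p.1‖ := by
        gcongr
        refine h1.trans ?_
        gcongr
    _ = _ := by ring

/-- The time integral at fixed frequency is the Duhamel term. -/
theorem setIntegral_heatSymbol_mul_bilin {g : ℝ → L2C} {t : ℝ} (ht : 0 ≤ t)
    (a ψ : Plane → ℂ) (ξ : Plane) :
    ∫ s in Ioc 0 t, heatSymbol (t - s) ξ * bilin (g s) (g s) ξ * ψ ξ =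
      (duhamel a (fun s => bilin (g s) (g s)) t ξ - heatSymbol t ξ * a ξ) * ψ ξ := by
  rw [integral_mul_const, ← intervalIntegral.integral_of_le ht, duhamel, scalarDuhamel,
    heatSymbol, add_sub_cancel_left]
  rfl

/-- The difference between the two sides of the mild equation, on the Fourier side. -/
def mildDefect (a : L2C) (g : ℝ → L2C) (t : ℝ) (ξ : Plane) : ℂ :=
  duhamel a (fun s => bilin (g s) (g s)) t ξ - g t ξ

theorem integrable_mildDefect_mul {a : L2C} {g : ℝ → L2C} (hg : Continuous g) {t : ℝ}
    (ht : 0 ≤ t) {ψ : Plane → ℂ} (hψ : Measurable ψ) (hψi : Integrable fun ξ => ‖ξ‖ * ‖ψ ξ‖)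
    (hψ2 : MemLp ψ 2) : Integrable fun ξ => mildDefect a g t ξ * ψ ξ := by
  have h1 := (integrable_prod_duhamel hg t hψ hψi).integral_prod_left
  simp only [setIntegral_heatSymbol_mul_bilin ht a ψ] at h1
  have h2 := integrable_lp_mul (memLp_heatSymbol_mul ht a) hψ2
  have h3 := integrable_lp_mul (Lp.memLp (g t)) hψ2
  refine ((h1.add h2).sub h3).congr (Filter.Eventually.of_forall fun ξ => ?_)
  simp only [Pi.sub_apply, Pi.add_apply, mildDefect]
  ring

theorem locallyIntegrable_mildDefect {a : L2C} {g : ℝ → L2C} (hg : Continuous g) {t : ℝ}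
    (ht : 0 ≤ t) : LocallyIntegrable (mildDefect a g t) volume := by
  rw [locallyIntegrable_iff]
  intro K hK
  obtain ⟨R, hR⟩ := hK.isBounded.subset_closedBall (0 : Plane)
  refine IntegrableOn.mono_set ?_ hR
  set B : Set Plane := Metric.closedBall 0 R
  have hB : MeasurableSet B := measurableSet_closedBall
  have hBf : volume B ≠ ∞ := measure_closedBall_lt_top.ne
  have h := integrable_mildDefect_mul (a := a) hg ht (ψ := B.indicator fun _ => (1 : ℂ))
    (measurable_const.indicator hB) ?_ (memLp_indicator_const 2 hB 1 (Or.inr hBf))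
  · rw [← integrable_indicator_iff hB]
    refine h.congr (Filter.Eventually.of_forall fun ξ => ?_)
    by_cases hξ : ξ ∈ B <;> simp [hξ]
  · have h1 : IntegrableOn (fun ξ : Plane => ‖ξ‖) B :=
      continuous_norm.continuousOn.integrableOn_compact (isCompact_closedBall 0 R)
    refine (h1.integrable_indicator hB).congr (Filter.Eventually.of_forall fun ξ => ?_)
    by_cases hξ : ξ ∈ B <;> simp [hξ]

theorem integrable_norm_mul_schwartz (ψ : 𝓢(Plane, ℂ)) : Integrable fun ξ => ‖ξ‖ * ‖ψ ξ‖ := by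
  simpa using ψ.integrable_pow_mul volume 1

/-- For a continuous curve in `L²`, the Duhamel formula in the sense of distributions means that
the defect annihilates the Fourier transforms of all real test functions. -/
theorem hasDistributionalIntegral_iff {θ₀ : L2} {θ : ℝ → L2} (hθ : Continuous θ) {t : ℝ}
    (ht : 0 ≤ t) :
    HasDistributionalIntegral (fun s => divergence (heatSemigroup (t - s) (flux (θ s)))) 0 t
      (fun x => heatSemigroup t (θ₀ : Plane → ℝ) x - θ t x) ↔
    ∀ φ : 𝓢(Plane, ℝ), ∫ ξ, mildDefect (𝓕 (toComplex θ₀)) (fun s => 𝓕 (toComplex (θ s))) t ξ *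
      (𝓕⁻ (schwartzC φ)) ξ = 0 := by
  set g : ℝ → L2C := fun s => 𝓕 (toComplex (θ s)) with hg
  set a : L2C := 𝓕 (toComplex θ₀) with ha
  have hgc : Continuous g :=
    (FourierTransform.continuous_fourier (E := L2C)).comp (continuous_toComplex.comp hθ)
  refine forall_congr' fun φ => ?_
  set ψ : 𝓢(Plane, ℂ) := 𝓕⁻ (schwartzC φ) with hψ
  have hψm : Measurable ψ := ψ.continuous.measurable
  have hprod := integrable_prod_duhamel hgc t hψm (integrable_norm_mul_schwartz ψ)
  set J : ℝ → ℂ := fun s => ∫ ξ, heatSymbol (t - s) ξ * bilin (g s) (g s) ξ * ψ ξ with hJ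
  set I : ℝ → ℝ := fun s => ∫ x, divergence (heatSemigroup (t - s) (flux (θ s))) x * φ x with hI
  have hJi : Integrable J (volume.restrict (Ioc 0 t)) := hprod.integral_prod_right
  have hIJ : (fun s => (I s : ℂ)) =ᵐ[volume.restrict (Ioc 0 t)] fun s => -J s := by
    -- at `s = t` the flux is not smoothed, so this single time has to be discarded
    rw [← Measure.restrict_congr_set Ioo_ae_eq_Ioc]
    filter_upwards [ae_restrict_mem measurableSet_Ioo] with s hs
    exact integral_divergence_mul (sub_pos.mpr hs.2) (θ s) φ
  have hIi : IntervalIntegrable I volume 0 t := by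
    rw [intervalIntegrable_iff_integrableOn_Ioc_of_le ht]
    exact ((integrable_congr hIJ).mpr hJi.neg).re
  have hIint : ((∫ s in (0 : ℝ)..t, I s : ℝ) : ℂ) =
      -∫ ξ, (duhamel a (fun s => bilin (g s) (g s)) t ξ - heatSymbol t ξ * a ξ) * ψ ξ := by
    rw [intervalIntegral.integral_of_le ht, ← integral_complex_ofReal, integral_congr_ae hIJ,
      integral_neg, hJ, ← integral_integral_swap hprod]
    simp only [setIntegral_heatSymbol_mul_bilin ht a ψ]
  obtain ⟨h1, h1'⟩ := integral_heatSemigroup_mul ht θ₀ φ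
  obtain ⟨h2, h2'⟩ := integral_toComplex_mul (θ t) φ
  have hψ2 : MemLp ψ 2 := ψ.memLp 2
  have hD := integrable_mildDefect_mul (a := a) hgc ht hψm (integrable_norm_mul_schwartz ψ) hψ2
  have h3 := integrable_lp_mul (memLp_heatSymbol_mul ht a) hψ2
  have h4 := integrable_lp_mul (Lp.memLp (g t)) hψ2
  have hR : ((∫ x, (heatSemigroup t (θ₀ : Plane → ℝ) x - θ t x) * φ x : ℝ) : ℂ) =
      (∫ ξ, heatSymbol t ξ * a ξ * ψ ξ) - ∫ ξ, g t ξ * ψ ξ := by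
    simp only [sub_mul]
    rw [integral_sub h1 h2, Complex.ofReal_sub, h1', h2']
  have hL : ∫ ξ, (duhamel a (fun s => bilin (g s) (g s)) t ξ - heatSymbol t ξ * a ξ) * ψ ξ =
      (∫ ξ, mildDefect a g t ξ * ψ ξ) + (∫ ξ, g t ξ * ψ ξ) - ∫ ξ, heatSymbol t ξ * a ξ * ψ ξ := by
    have h5 : Integrable fun ξ => mildDefect a g t ξ * ψ ξ + g t ξ * ψ ξ := hD.add h4
    rw [← integral_add hD h4, ← integral_sub h5 h3]
    refine integral_congr_ae (Filter.Eventually.of_forall fun ξ => ?_)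
    simp only [mildDefect]
    ring
  constructor
  · rintro ⟨-, h⟩
    have h' := congrArg (fun r : ℝ => (r : ℂ)) h
    simp only at h'
    rw [hIint, hR, hL] at h'
    linear_combination -h'
  · intro h
    refine ⟨hIi, Complex.ofReal_injective ?_⟩
    rw [hIint, hR, hL, h]
    ring

/-- A locally integrable function that annihilates the inverse Fourier transforms of all real
Schwartz functions vanishes: complex test functions split into real and imaginary parts. -/
theorem ae_eq_zero_of_integral_mul_fourierInv {D : Plane → ℂ} (hD : LocallyIntegrable D volume)
    (hi : ∀ ψ : 𝓢(Plane, ℂ), Integrable fun ξ => D ξ * ψ ξ)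
    (h : ∀ φ : 𝓢(Plane, ℝ), ∫ ξ, D ξ * (𝓕⁻ (schwartzC φ)) ξ = 0) : D =ᵐ[volume] 0 := by
  refine ae_eq_zero_of_integral_contDiff_smul_eq_zero hD fun G hG hG' => ?_
  have hc : HasCompactSupport fun x => (G x : ℂ) := hG'.comp_left Complex.ofReal_zero
  set Ψ : 𝓢(Plane, ℂ) := hc.toSchwartzMap (Complex.ofRealCLM.contDiff.comp hG)
  have hΨ (x : Plane) : Ψ x = G x := rfl
  set φ₁ : 𝓢(Plane, ℝ) := (𝓕 Ψ).postcompCLM Complex.reCLM with h₁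
  set φ₂ : 𝓢(Plane, ℝ) := (𝓕 Ψ).postcompCLM Complex.imCLM with h₂
  have e : 𝓕 Ψ = schwartzC φ₁ + Complex.I • schwartzC φ₂ := by
    ext x
    have : ((𝓕 Ψ) x : ℂ) = ((𝓕 Ψ) x).re + Complex.I * ((𝓕 Ψ) x).im := by
      rw [mul_comm]; exact (Complex.re_add_im _).symm
    exact this
  have e2 : Ψ = 𝓕⁻ (schwartzC φ₁) + Complex.I • 𝓕⁻ (schwartzC φ₂) := by
    rw [← FourierTransform.fourierInv_smul, ← FourierTransform.fourierInv_add, ← e,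
      FourierTransform.fourierInv_fourier_eq]
  have e3 (x : Plane) : (G x : ℂ) = (𝓕⁻ (schwartzC φ₁)) x + Complex.I * (𝓕⁻ (schwartzC φ₂)) x := by
    rw [← hΨ]
    exact congrArg (fun f : 𝓢(Plane, ℂ) => f x) e2
  have e4 : ∫ x, G x • D x = (∫ x, D x * (𝓕⁻ (schwartzC φ₁)) x) +
      Complex.I * ∫ x, D x * (𝓕⁻ (schwartzC φ₂)) x := by
    rw [← integral_const_mul, ← integral_add (hi _) ((hi _).const_mul _)]
    refine integral_congr_ae (Filter.Eventually.of_forall fun x => ?_)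
    simp only [Complex.real_smul, e3]
    ring
  rw [e4, h, h, mul_zero, add_zero]

theorem HasDistributionalIntegral.congr {u v : ℝ → Plane → ℝ} {t : ℝ} {h : Plane → ℝ}
    (ht : 0 ≤ t) (huv : ∀ s ∈ Icc 0 t, u s = v s) (hu : HasDistributionalIntegral u 0 t h) :
    HasDistributionalIntegral v 0 t h := by
  intro φ
  obtain ⟨h1, h2⟩ := hu φ
  have e : EqOn (fun s => ∫ x, u s x * φ x) (fun s => ∫ x, v s x * φ x) (uIcc 0 t) := by
    intro s hs
    rw [uIcc_of_le ht] at hs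
    simp only [huv s hs]
  refine ⟨IntervalIntegrable.congr (e.mono uIoc_subset_uIcc) h1, ?_⟩
  rw [← h2]
  exact (intervalIntegral.integral_congr e).symm

theorem IsMildSolution.congr {T : ℝ} {θ₀ : L2} {θ θ' : ℝ → L2} (h : IsMildSolution T θ₀ θ)
    (hθ : EqOn θ' θ (Icc 0 T)) : IsMildSolution T θ₀ θ' := by
  refine ⟨h.1.congr hθ, fun t ht => ?_⟩
  rw [hθ ht]
  refine (h.2 t ht).congr ht.1 fun s hs => ?_
  rw [hθ ⟨hs.1, hs.2.trans ht.2⟩]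

/-- The case of `isMildSolution_iff` in which measurability in time is available on all of `ℝ`. -/
theorem isMildSolution_iff_of_continuous {T : ℝ} {θ₀ : L2} {θ : ℝ → L2} (hθ : Continuous θ) :
    IsMildSolution T θ₀ θ ↔
      IsFourierMild T (𝓕 (toComplex θ₀)) fun t => 𝓕 (toComplex (θ t)) := by
  have hgc : Continuous fun t => (𝓕 (toComplex (θ t)) : L2C) :=
    (FourierTransform.continuous_fourier (E := L2C)).comp (continuous_toComplex.comp hθ)
  refine and_congr (iff_of_true hθ.continuousOn hgc.continuousOn)
    (forall₂_congr fun t ht => ?_)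
  rw [hasDistributionalIntegral_iff hθ ht.1]
  constructor
  · intro h
    have h0 := ae_eq_zero_of_integral_mul_fourierInv (locallyIntegrable_mildDefect hgc ht.1)
      (fun ψ => integrable_mildDefect_mul hgc ht.1 ψ.continuous.measurable
        (integrable_norm_mul_schwartz ψ) (ψ.memLp 2)) h
    filter_upwards [h0] with ξ hξ
    exact (sub_eq_zero.mp hξ).symm
  · intro h φ
    rw [integral_eq_zero_of_ae]
    filter_upwards [h] with ξ hξ
    rw [mildDefect, hξ, sub_self, zero_mul, Pi.zero_apply]

/-- Mild solutions are characterised by the Duhamel formula for their Fourier transforms. -/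
theorem isMildSolution_iff {T : ℝ} (hT : 0 ≤ T) {θ₀ : L2} {θ : ℝ → L2}
    (hθ : ContinuousOn θ (Icc 0 T)) : IsMildSolution T θ₀ θ ↔
      IsFourierMild T (𝓕 (toComplex θ₀)) fun t => 𝓕 (toComplex (θ t)) := by
  set Θ : ℝ → L2 := IccExtend hT ((Icc 0 T).domRestrict θ)
  have hΘ : Continuous Θ := (continuousOn_iff_continuous_domRestrict.mp hθ).Icc_extend'
  have he : EqOn Θ θ (Icc 0 T) := fun t ht => by simp [Θ, IccExtend_of_mem hT _ ht]
  have he' : EqOn (fun t => (𝓕 (toComplex (Θ t)) : L2C)) (fun t => 𝓕 (toComplex (θ t)))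
      (Icc 0 T) := fun t ht => by simp only [he ht]
  constructor
  · intro h
    exact ((isMildSolution_iff_of_continuous hΘ).mp (h.congr he)).congr he'.symm
  · intro h
    exact ((isMildSolution_iff_of_continuous hΘ).mpr (h.congr he')).congr he.symm

end MildSolutions

/-! ### Well-posedness -/

/-- The inverse Fourier transform of the global solution on the Fourier side is real by Hermitian
symmetry, and it is a mild solution. -/
theorem exists_isGlobalMildSolution (θ₀ : L2) : ∃ θ : ℝ → L2, IsGlobalMildSolution θ₀ θ := by
  obtain ⟨g, hg⟩ := exists_global_isFourierMild (herm_fourier_toComplex θ₀)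
  have hcont (T : ℝ) : ContinuousOn (fun t => rePart (𝓕⁻ (g t))) (Icc 0 T) :=
    (continuous_rePart.comp (FourierTransform.continuous_fourierInv (E := L2C))).comp_continuousOn
      (hg T).1
  have heq (T : ℝ) : EqOn (fun t => (𝓕 (toComplex (rePart (𝓕⁻ (g t)))) : L2C)) g (Icc 0 T) := by
    intro t ht
    have h1 : (𝓕 (𝓕⁻ (g t)) : L2C) = g t := FourierTransform.fourier_fourierInv_eq _
    have h2 := (hg T).herm_eq (ht.1.trans ht.2) (herm_fourier_toComplex θ₀) ht
    simp only
    rw [toComplex_rePart (by rw [h1, h2]), h1]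
  refine ⟨fun t => rePart (𝓕⁻ (g t)), fun t ht => ?_, fun T hT => ?_⟩
  · refine ((hcont (t + 1)) t ⟨ht, by linarith⟩).mono_of_mem_nhdsWithin ?_
    rw [← Ici_inter_Iic]
    exact Filter.inter_mem self_mem_nhdsWithin
      (mem_nhdsWithin_of_mem_nhds (Iic_mem_nhds (by linarith)))
  · exact (isMildSolution_iff hT.le (hcont T)).mpr ((hg T).congr (heq T))

theorem IsGlobalMildSolution.unique {θ₀ : L2} {θ θ' : ℝ → L2} (h : IsGlobalMildSolution θ₀ θ)
    (h' : IsGlobalMildSolution θ₀ θ') {t : ℝ} (ht : 0 ≤ t) : θ t = θ' t := by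
  have hT : 0 < t + 1 := by linarith
  have h1 := (isMildSolution_iff hT.le (h.2 _ hT).1).mp (h.2 _ hT)
  have h2 := (isMildSolution_iff hT.le (h'.2 _ hT).1).mp (h'.2 _ hT)
  have h3 := h1.unique hT.le h2 ⟨ht, by linarith⟩
  exact toComplex_injective ((Lp.fourierTransformₗᵢ Plane ℂ).injective h3)

end SQG

end

theorem mainTheorem2 (θ₀ : SQG.L2) :
    (∃ θ : ℝ → SQG.L2, SQG.IsGlobalMildSolution θ₀ θ) ∧
      ∀ θ θ' : ℝ → SQG.L2, SQG.IsGlobalMildSolution θ₀ θ → SQG.IsGlobalMildSolution θ₀ θ' →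
        ∀ t : ℝ, 0 ≤ t → θ t = θ' t :=
  ⟨SQG.exists_isGlobalMildSolution θ₀, fun _ _ h h' _ ht => h.unique h' ht⟩
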